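/- **Model.** Let $T\ge 1$. Observed data are $Y^T=(Y_0,\dots,Y_T)$ and $X^T=(X_1,\dots,X_T)$; $A$ is latent. With respect to fixed $\sigma$-finite reference measures, the joint density of $(Y^T,X^T,A)$ at $(\theta,\omega)$, $\theta\in\Theta\subset\mathbb R^K$, $\omega=(g,\pi,\nu)\in\Omega$, is $$p_{\theta,\omega}(y^T,x^T,a)=\prod_{t=1}^T f_{t,\theta}(y_t\mid y_{t-1},x_t,a)\,\prod_{t=2}^T g_t(x_t\mid y^{t-1},x^{t-1},a)\;\pi(a\mid y_0,x_1)\,\nu(y_0,x_1),$$ where the conditional densities $f_{t,\theta}$ are known up to $\theta$, and $\Omega$ is the set of all triples of (conditional) densities $g=(g_t)_{2\le t\le T}$, $\pi$, $\nu$ that have a known common support (each density is positive exactly on a given set) and are otherwise unrestricted. The likelihood of the observed data is $\ell(\theta,\omega\mid y^T,x^T)=\int p_{\theta,\omega}(y^T,x^T,a)\,da$, and $\mathbb E_{\theta,\omega}$ denotes expectation at $(\theta,\omega)$. **Tangent set.** Let $\theta_0$ be an interior point of $\Theta$ and let $\omega\in\Omega$. A regular parametric submodel at $(\theta_0,\omega)$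 is a path $\eta\mapsto\omega_\eta\in\Omega$, $\eta\in\mathbb R$, with $\omega_{\eta_0}=\omega$, such that $\ell(\theta,\omega_\eta)^{1/2}$ is differentiable in quadratic mean in $(\theta,\eta)$ at $(\theta_0,\eta_0)$, with score $S^\theta_\omega=\partial\ln\ell(\theta_0,\omega\mid Y^T,X^T)/\partial\theta$ for $\theta$ and some score $S^\eta$ for $\eta$, and with nonsingular information matrix for $(\theta,\eta)$. For a dimension $L$, the tangent set $\mathcal T_{\theta_0,\omega,L}$ is the mean-square closure under $(\theta_0,\omega)$ of the $L\times1$ linear combinations of the scores $S^\eta$ of all regular parametric submodels at $(\theta_0,\omega)$. Its orthocomplement $\mathcal T^\perp_{\theta_0,\omega,L}$ is taken in the space of $\mathbb R^L$-valued functions of $(Y^T,X^T)$ that are square-integrable with mean zero under $(\theta_0,\omega)$, and $\Pi_\omega(\cdot\mid\mathcal T^\perp_{\theta_0,\omega,L})$ is the orthogonal projection onto it in mean square under $(\theta_0,\omega)$. **Setting.** Let $\omega_0\in\Omega$ be the true nuisance parameter and $\widetilde\omega\in\Omega$ any working model such that (regularity) $\theta\mapsto p_{\theta,\widetilde\omega}(y^T,x^T,a)$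 is continuous at $\theta_0$ for almost every $(y^T,x^T,a)$, and at least one regular parametric submodel exists at $(\theta_0,\widetilde\omega)$. Let $\mu_0=\mathbb E_{\theta_0,\omega_0}[h_{\theta_0}(Y^T,X^T,A)]\in\mathbb R^L$, with $h_{\theta_0}$ integrable, be an average effect, and let $\varphi_{\theta_0}$ be a moment function that is integrable under $(\theta_0,\omega_0)$, satisfies $\mathbb E_{\theta_0,\omega_0}[\varphi_{\theta_0}(Y^T,X^T)]=\mu_0$, and is square-integrable under $(\theta_0,\widetilde\omega)$. Define $$\widetilde\phi^{\rm eff}=\arg\min_{\phi\in\mathcal T^\perp_{\theta_0,\widetilde\omega,K}}\mathbb E_{\theta_0,\widetilde\omega}\big\|S^\theta_{\widetilde\omega}-\phi\big\|^2,\qquad \widetilde\varphi^{\rm eff}=\varphi_{\theta_0}-\arg\min_{\phi\in\mathcal T^\perp_{\theta_0,\widetilde\omega,L}}\mathbb E_{\theta_0,\widetilde\omega}\big\|\varphi_{\theta_0}-\phi\big\|^2 .$$ **Theorem.** The functions $\widetilde\phi^{\rm eff}$ and $\widetilde\varphi^{\rm eff}$ exist and are almost surely unique. If $\widetilde\phi^{\rm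 eff}$ is absolutely integrable under $(\theta_0,\omega_0)$, then $$\mathbb E_{\theta_0,\omega_0}\big[\widetilde\phi^{\rm eff}(Y^T,X^T)\big]=0,$$ and if $\widetilde\varphi^{\rm eff}$ is absolutely integrable under $(\theta_0,\omega_0)$, then $$\mathbb E_{\theta_0,\omega_0}\big[\widetilde\varphi^{\rm eff}(Y^T,X^T)-\mu_0\big]=0 .$$ Moreover, if $\widetilde\omega=\omega_0$, these coincide with the efficient moment restrictions for $\theta_0$ and $\mu_0$: almost surely, $\widetilde\phi^{\rm eff}$ equals the efficient score $\Pi_{\omega_0}(S^\theta_{\omega_0}\mid\mathcal T^\perp_{\theta_0,\omega_0,K})$ and $\widetilde\varphi^{\rm eff}$ equals $\varphi_{\theta_0}-\Pi_{\omega_0}(\varphi_{\theta_0}\mid\mathcal T^\perp_{\theta_0,\omega_0,L})$. -/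

import Mathlib

open MeasureTheory Filter Topology

noncomputable section

/-- `ℝ^L` with the Euclidean norm. -/
abbrev Vec (L : ℕ) : Type := EuclideanSpace ℝ (Fin L)

/-- The known ingredients of a panel data model with `T = n + 1` periods and a parameter in `ℝ^K`.
Outcomes `y_0, …, y_T` take values in `𝒴`, regressors `x_1, …, x_T` in `𝒳`, heterogeneity in `𝒜`.
The outcome `y_t` is stored at index `t`, the regressor `x_t` at index `t - 1`. All densities
are taken with respect to fixed σ-finite reference measures (Lebesgue, counting, …). -/
structure PanelModel (n K : ℕ) (𝒴 𝒳 𝒜 : Type*)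
    [MeasurableSpace 𝒴] [MeasurableSpace 𝒳] [MeasurableSpace 𝒜] where
  /-- reference measures for the outcomes -/
  refY : Fin (n + 2) → Measure 𝒴
  /-- reference measures for the regressors -/
  refX : Fin (n + 1) → Measure 𝒳
  /-- reference measure for the heterogeneity -/
  refA : Measure 𝒜
  sigmaFinite_refY : ∀ t, SigmaFinite (refY t)
  sigmaFinite_refX : ∀ t, SigmaFinite (refX t)
  sigmaFinite_refA : SigmaFinite refA
  /-- the parameter space -/
  Θ : Set (Vec K)
  /-- the parametric conditional density: `f t θ y y' x a` is the density of the outcome at `y`,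
  given that the previous outcome is `y'`, the current regressor `x` and the heterogeneity `a` -/
  f : Fin (n + 1) → Vec K → 𝒴 → 𝒴 → 𝒳 → 𝒜 → ℝ
  f_measurable : ∀ t, ∀ θ ∈ Θ,
    Measurable fun q : 𝒴 × 𝒴 × 𝒳 × 𝒜 => f t θ q.1 q.2.1 q.2.2.1 q.2.2.2
  f_nonneg : ∀ t, ∀ θ ∈ Θ, ∀ y y' x a, 0 ≤ f t θ y y' x a
  f_normalized : ∀ t, ∀ θ ∈ Θ, ∀ y' x a,
    ∫⁻ y, ENNReal.ofReal (f t θ y y' x a) ∂(refY t.succ) = 1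
  /-- known common support of the feedback densities -/
  suppG : (j : Fin n) → Set (𝒳 × (Fin (j + 2) → 𝒴) × (Fin (j + 1) → 𝒳) × 𝒜)
  /-- known common support of the heterogeneity densities -/
  suppPi : Set (𝒜 × 𝒴 × 𝒳)
  /-- known common support of the initial condition densities -/
  suppNu : Set (𝒴 × 𝒳)

attribute [instance] PanelModel.sigmaFinite_refY PanelModel.sigmaFinite_refX
  PanelModel.sigmaFinite_refA

variable {n K : ℕ} {𝒴 𝒳 𝒜 : Type*}
  [MeasurableSpace 𝒴] [MeasurableSpace 𝒳] [MeasurableSpace 𝒜]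

/-- The nuisance space `Ω`: all triples `ω = (g, π, ν)` of a feedback process, a heterogeneity
distribution and an initial condition density which have the given common support and are
otherwise unrestricted. -/
@[ext]
structure Nuisance (M : PanelModel n K 𝒴 𝒳 𝒜) where
  /-- `g j x yh xh a` is the density at `x` of the regressor of period `j + 2`, given the outcomes
  `yh` of periods `0, …, j + 1`, the regressors `xh` of periods `1, …, j + 1`, and `a` -/
  g : (j : Fin n) → 𝒳 → (Fin (j + 2) → 𝒴) → (Fin (j + 1) → 𝒳) → 𝒜 → ℝ
  /-- `pi a y₀ x₁` is the conditional density of the heterogeneity at `a` given `(y₀, x₁)` -/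
  pi : 𝒜 → 𝒴 → 𝒳 → ℝ
  /-- `nu y₀ x₁` is the density of the initial condition -/
  nu : 𝒴 → 𝒳 → ℝ
  g_measurable : ∀ j : Fin n, Measurable
    fun q : 𝒳 × (Fin (j + 2) → 𝒴) × (Fin (j + 1) → 𝒳) × 𝒜 => g j q.1 q.2.1 q.2.2.1 q.2.2.2
  pi_measurable : Measurable fun q : 𝒜 × 𝒴 × 𝒳 => pi q.1 q.2.1 q.2.2
  nu_measurable : Measurable fun q : 𝒴 × 𝒳 => nu q.1 q.2
  g_nonneg : ∀ (j : Fin n) x yh xh a, 0 ≤ g j x yh xh a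
  pi_nonneg : ∀ a y x, 0 ≤ pi a y x
  nu_nonneg : ∀ y x, 0 ≤ nu y x
  g_normalized : ∀ (j : Fin n) yh xh a, ∫⁻ x, ENNReal.ofReal (g j x yh xh a) ∂(M.refX j.succ) = 1
  pi_normalized : ∀ y x, ∫⁻ a, ENNReal.ofReal (pi a y x) ∂M.refA = 1
  nu_normalized :
    ∫⁻ q : 𝒴 × 𝒳, ENNReal.ofReal (nu q.1 q.2) ∂((M.refY 0).prod (M.refX 0)) = 1
  g_support : ∀ (j : Fin n) x yh xh a, 0 < g j x yh xh a ↔ (x, yh, xh, a) ∈ M.suppG j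
  pi_support : ∀ a y x, 0 < pi a y x ↔ (a, y, x) ∈ M.suppPi
  nu_support : ∀ y x, 0 < nu y x ↔ (y, x) ∈ M.suppNu

/-- The space of the observed data `(y_0, …, y_T)`, `(x_1, …, x_T)`. -/
abbrev Obs (n : ℕ) (𝒴 𝒳 : Type*) : Type _ := (Fin (n + 2) → 𝒴) × (Fin (n + 1) → 𝒳)

namespace PanelModel

variable (M : PanelModel n K 𝒴 𝒳 𝒜)

/-- Reference measure for the observed data. -/
def obsRef : Measure (Obs n 𝒴 𝒳) := (Measure.pi M.refY).prod (Measure.pi M.refX)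

/-- Reference measure for the observed data together with the heterogeneity. -/
def fullRef : Measure (Obs n 𝒴 𝒳 × 𝒜) := M.obsRef.prod M.refA

/-- The joint density of outcomes, regressors and heterogeneity at `(θ, ω)`. -/
def fullDensity (θ : Vec K) (ω : Nuisance M) (z : Obs n 𝒴 𝒳 × 𝒜) : ℝ :=
  (∏ t : Fin (n + 1), M.f t θ (z.1.1 t.succ) (z.1.1 t.castSucc) (z.1.2 t) z.2) *
  (∏ j : Fin n, ω.g j (z.1.2 j.succ)
    (fun i : Fin (j + 2) => z.1.1 (Fin.castLE (by omega) i))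
    (fun i : Fin (j + 1) => z.1.2 (Fin.castLE (by omega) i)) z.2) *
  ω.pi z.2 (z.1.1 0) (z.1.2 0) * ω.nu (z.1.1 0) (z.1.2 0)

/-- The law of `(Y^T, X^T, A)` under the data generating process `(θ, ω)`. -/
def fullLaw (θ : Vec K) (ω : Nuisance M) : Measure (Obs n 𝒴 𝒳 × 𝒜) :=
  M.fullRef.withDensity fun z => ENNReal.ofReal (M.fullDensity θ ω z)

/-- The law of the observed data `(Y^T, X^T)` under the data generating process `(θ, ω)`. -/
def obsLaw (θ : Vec K) (ω : Nuisance M) : Measure (Obs n 𝒴 𝒳) :=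
  (M.fullLaw θ ω).map Prod.fst

/-- The likelihood of the observed data: heterogeneity is integrated out. -/
def lik (θ : Vec K) (ω : Nuisance M) (d : Obs n 𝒴 𝒳) : ℝ :=
  ∫ a, M.fullDensity θ ω (d, a) ∂M.refA

/-- The score for `θ`: the gradient of the log-likelihood in `θ`. -/
def score (θ : Vec K) (ω : Nuisance M) (d : Obs n 𝒴 𝒳) : Vec K :=
  gradient (fun ϑ => Real.log (M.lik ϑ ω d)) θ

/-- The joint score for `(θ, η)`, built from the score for `θ` and a score `s` for `η`. -/
def jointScore (θ : Vec K) (ω : Nuisance M) (s : Obs n 𝒴 𝒳 → ℝ) (d : Obs n 𝒴 𝒳) :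
    Fin K ⊕ Unit → ℝ :=
  Sum.elim (fun i => M.score θ ω d i) (fun _ => s d)

/-- The information matrix of a submodel, for the parameter `(θ, η)`. -/
def infoMatrix (θ : Vec K) (ω : Nuisance M) (s : Obs n 𝒴 𝒳 → ℝ) :
    Matrix (Fin K ⊕ Unit) (Fin K ⊕ Unit) ℝ :=
  Matrix.of fun i j => ∫ d, M.jointScore θ ω s d i * M.jointScore θ ω s d j ∂(M.obsLaw θ ω)

/-- `η ↦ path η` is a regular parametric submodel through `ω` at `η₀`, with score `s` for `η`:
the root likelihood is differentiable in quadratic mean with respect to `(θ, η)` at `(θ₀, η₀)`,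
and the information matrix for `(θ, η)` is nonsingular. -/
structure IsRegularSubmodel (θ₀ : Vec K) (ω : Nuisance M) (path : ℝ → Nuisance M) (η₀ : ℝ)
    (s : Obs n 𝒴 𝒳 → ℝ) : Prop where
  through : path η₀ = ω
  differentiable : ∀ᵐ d ∂(M.obsLaw θ₀ ω),
    DifferentiableAt ℝ (fun ϑ => Real.log (M.lik ϑ ω d)) θ₀
  score_memLp : MemLp (M.score θ₀ ω) 2 (M.obsLaw θ₀ ω)
  memLp : MemLp s 2 (M.obsLaw θ₀ ω)
  quadraticMean : ∀ ε : ℝ, 0 < ε → ∀ᶠ q : Vec K × ℝ in 𝓝 (θ₀, η₀),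
    eLpNorm (fun d => √(M.lik q.1 (path q.2) d) - √(M.lik θ₀ ω d)
        - (1 / 2) * (inner ℝ (q.1 - θ₀) (M.score θ₀ ω d) + (q.2 - η₀) * s d) * √(M.lik θ₀ ω d))
      2 M.obsRef ≤ ENNReal.ofReal (ε * ‖q - (θ₀, η₀)‖)
  info_nonsingular : (M.infoMatrix θ₀ ω s).det ≠ 0

/-- `s` is the score for the nuisance parameter `η` of some regular parametric submodel. -/
def IsNuisanceScore (θ₀ : Vec K) (ω : Nuisance M) (s : Obs n 𝒴 𝒳 → ℝ) : Prop :=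
  ∃ (path : ℝ → Nuisance M) (η₀ : ℝ), M.IsRegularSubmodel θ₀ ω path η₀ s

/-- The nonparametric tangent set of dimension `L`: the mean-square closure of the `L × 1` linear
combinations of nuisance scores of regular parametric submodels. -/
def tangentSet (θ₀ : Vec K) (ω : Nuisance M) (L : ℕ) :
    Submodule ℝ (Lp (Vec L) 2 (M.obsLaw θ₀ ω)) :=
  (Submodule.span ℝ {u : Lp (Vec L) 2 (M.obsLaw θ₀ ω) |
    ∃ (s : Obs n 𝒴 𝒳 → ℝ) (v : Vec L), M.IsNuisanceScore θ₀ ω s ∧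
      u =ᵐ[M.obsLaw θ₀ ω] fun d => s d • v}).topologicalClosure

/-- The orthocomplement of the tangent set in the space of square-integrable mean-zero functions. -/
def tangentPerp (θ₀ : Vec K) (ω : Nuisance M) (L : ℕ) : Set (Lp (Vec L) 2 (M.obsLaw θ₀ ω)) :=
  {φ | ∫ d, φ d ∂(M.obsLaw θ₀ ω) = 0 ∧ ∀ u ∈ M.tangentSet θ₀ ω L, inner ℝ φ u = 0}

/-- `p` is (a version of) the mean-square best approximation under `(θ₀, ω)` of `S` by elements of
the orthocomplement of the tangent set. -/
def IsArgMin (θ₀ : Vec K) (ω : Nuisance M) {L : ℕ} (S p : Obs n 𝒴 𝒳 → Vec L) : Prop :=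
  (∃ hp : MemLp p 2 (M.obsLaw θ₀ ω), hp.toLp p ∈ M.tangentPerp θ₀ ω L) ∧
  ∀ q ∈ M.tangentPerp θ₀ ω L,
    ∫⁻ d, ‖S d - p d‖ₑ ^ 2 ∂(M.obsLaw θ₀ ω) ≤ ∫⁻ d, ‖S d - q d‖ₑ ^ 2 ∂(M.obsLaw θ₀ ω)

/-- `p` is (a version of) the orthogonal projection under `(θ₀, ω)` of the square-integrable
function `S` onto the orthocomplement of the tangent set. -/
def IsOrthProj (θ₀ : Vec K) (ω : Nuisance M) {L : ℕ} (S p : Obs n 𝒴 𝒳 → Vec L) : Prop :=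
  ∃ (hS : MemLp S 2 (M.obsLaw θ₀ ω)) (hp : MemLp p 2 (M.obsLaw θ₀ ω)),
    hp.toLp p ∈ M.tangentPerp θ₀ ω L ∧
    ∀ q ∈ M.tangentPerp θ₀ ω L, inner ℝ (hS.toLp S - hp.toLp p) q = 0

/-- `φ` is the efficient score for `θ` under the working model `ω`. -/
def IsLocEffScore (θ₀ : Vec K) (ω : Nuisance M) (φ : Obs n 𝒴 𝒳 → Vec K) : Prop :=
  M.IsArgMin θ₀ ω (M.score θ₀ ω) φ

/-- `ψ` is the moment function for the average effect obtained from `φ` by residualizing it under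
the working model `ω`. -/
def IsLocEffAverage (θ₀ : Vec K) (ω : Nuisance M) {L : ℕ} (φ ψ : Obs n 𝒴 𝒳 → Vec L) : Prop :=
  ∃ p, M.IsArgMin θ₀ ω φ p ∧ ψ = fun d => φ d - p d

/-- `φ` is the efficient score for `θ` at `(θ₀, ω)`. -/
def IsEfficientScore (θ₀ : Vec K) (ω : Nuisance M) (φ : Obs n 𝒴 𝒳 → Vec K) : Prop :=
  M.IsOrthProj θ₀ ω (M.score θ₀ ω) φ

/-- `ψ` is the efficient moment function for the average effect at `(θ₀, ω)`, built from the
identifying moment function `φ`. -/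
def IsEfficientAverage (θ₀ : Vec K) (ω : Nuisance M) {L : ℕ} (φ ψ : Obs n 𝒴 𝒳 → Vec L) :
    Prop :=
  ∃ p, M.IsOrthProj θ₀ ω φ p ∧ ψ = fun d => φ d - p d

/-- The average effect `μ(θ, ω)`, the mean of `h θ (Y^T, X^T, A)` under `(θ, ω)`. -/
def averageEffect {L : ℕ} (h : Vec K → Obs n 𝒴 𝒳 × 𝒜 → Vec L) (θ : Vec K) (ω : Nuisance M) :
    Vec L :=
  ∫ z, h θ z ∂(M.fullLaw θ ω)

end PanelModel

end

noncomputable section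

variable {n K : ℕ} {𝒴 𝒳 𝒜 : Type*}
  [MeasurableSpace 𝒴] [MeasurableSpace 𝒳] [MeasurableSpace 𝒜]

/-! ### Normalization of the joint density -/

/-! The core fact is that a function of the data which is orthogonal to the tangent set at one
nuisance value has the same mean at every other. Passing from `ω` to `ω'` multiplies the joint
density by the ratios of `ν`, of `π` and of each feedback density, all well behaved because the
supports are common. Truncating a ratio at `m` and subtracting its conditional mean given the past
gives a bounded, conditionally centred direction, and so does its product with any bounded function
of that past. Orthogonality to such directions exchanges the truncated ratio for its conditional
mean, which tends to one as `m` grows. Nested truncations remove all ratios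
(`Nuisance.integral_mul_ratio`, `integral_obsLaw_eq_of_orthogonal`); the untruncated integrand
dominates, so integrability under both laws is all that is required.

It remains to see that orthogonality to nuisance scores implies orthogonality to bounded directions.
Along `p (1 + η b)` the density has a uniform quadratic remainder in `η`. Continuity in `θ` gives
continuity of the density in `L¹`, by Scheffé, and the one regular submodel assumed to exist
supplies differentiability in `θ`. Together these yield joint differentiability in quadratic mean,
with score the conditional mean of the direction given the data (`exists_path_quadraticMean`).

Such a path is regular exactly when its score lies outside the span of the `θ`-score. A direction
inside the span is handled as the difference of two directions outside it. A direction outside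
exists: otherwise every simple function orthogonal to the `θ`-score would be orthogonal to all
directions, so its mean would not depend on the nuisance parameter and it would be uncorrelated with
the score of the given submodel. By finite-dimensional duality that score would lie in the span,
contradicting nonsingular information (`exists_condMean_notMem_span`).

Existence, uniqueness and the efficiency claim hold because the orthocomplement is a closed subspace
of `L²`, where best approximation and orthogonal projection coincide (`isArgMin_iff`,
`isOrthProj_iff`). -/

theorem lintegral_pi_snoc {m : ℕ} {α : Type*} [MeasurableSpace α] (μ : Fin (m + 1) → Measure α)
    [∀ i, SigmaFinite (μ i)] {F : (Fin (m + 1) → α) → ENNReal} (hF : Measurable F) :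
    ∫⁻ y, F y ∂(Measure.pi μ) =
      ∫⁻ y, ∫⁻ l, F (Fin.snoc (α := fun _ => α) y l) ∂(μ (Fin.last m))
        ∂(Measure.pi fun i => μ i.castSucc) := by
  have h := (measurePreserving_piFinSuccAbove μ (Fin.last m)).symm
  rw [← h.lintegral_comp hF]
  have hsymm : ∀ p : α × (Fin m → α),
      (MeasurableEquiv.piFinSuccAbove (fun _ => α) (Fin.last m)).symm p
        = Fin.snoc (α := fun _ => α) p.2 p.1 := by
    intro p
    exact Fin.insertNth_last' p.1 p.2
  have hmeas : Measurable fun p : α × (Fin m → α) => F (Fin.snoc (α := fun _ => α) p.2 p.1) := by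
    simp_rw [← hsymm]
    exact hF.comp (MeasurableEquiv.measurable _)
  simp only [hsymm, Fin.succAbove_last]
  rw [lintegral_prod_symm' _ hmeas]

theorem lintegral_pi_fin_one {α : Type*} [MeasurableSpace α] (μ : Fin 1 → Measure α)
    [∀ i, SigmaFinite (μ i)] {F : (Fin 1 → α) → ENNReal} (hF : Measurable F) :
    ∫⁻ y, F y ∂(Measure.pi μ) = ∫⁻ l, F (fun _ => l) ∂(μ 0) := by
  have h := (measurePreserving_piUnique μ).symm
  rw [← h.lintegral_comp hF]
  rfl

namespace PanelModel

theorem measurable_fullDensity (M : PanelModel n K 𝒴 𝒳 𝒜) {θ : Vec K} (hθ : θ ∈ M.Θ)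
    (ω : Nuisance M) : Measurable (M.fullDensity θ ω) := by
  unfold fullDensity
  refine ((Measurable.mul ?_ ?_).mul ?_).mul ?_
  · refine Finset.measurable_prod _ fun t _ => ?_
    exact (M.f_measurable t θ hθ).comp
      (g := fun q : 𝒴 × 𝒴 × 𝒳 × 𝒜 => M.f t θ q.1 q.2.1 q.2.2.1 q.2.2.2)
      (f := fun z : Obs n 𝒴 𝒳 × 𝒜 => (z.1.1 t.succ, z.1.1 t.castSucc, z.1.2 t, z.2))
      (by fun_prop)
  · refine Finset.measurable_prod _ fun j _ => ?_
    exact (ω.g_measurable j).comp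
      (f := fun z : Obs n 𝒴 𝒳 × 𝒜 => (z.1.2 j.succ,
        (fun i : Fin (j + 2) => z.1.1 (Fin.castLE (by omega) i)),
        (fun i : Fin (j + 1) => z.1.2 (Fin.castLE (by omega) i)), z.2))
      (by fun_prop)
  · exact ω.pi_measurable.comp
      (f := fun z : Obs n 𝒴 𝒳 × 𝒜 => (z.2, z.1.1 0, z.1.2 0)) (by fun_prop)
  · exact ω.nu_measurable.comp
      (f := fun z : Obs n 𝒴 𝒳 × 𝒜 => (z.1.1 0, z.1.2 0)) (by fun_prop)

theorem fullDensity_nonneg (M : PanelModel n K 𝒴 𝒳 𝒜) {θ : Vec K} (hθ : θ ∈ M.Θ)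
    (ω : Nuisance M) (z : Obs n 𝒴 𝒳 × 𝒜) : 0 ≤ M.fullDensity θ ω z := by
  unfold fullDensity
  refine mul_nonneg (mul_nonneg (mul_nonneg ?_ ?_) (ω.pi_nonneg _ _ _)) (ω.nu_nonneg _ _)
  · exact Finset.prod_nonneg fun t _ => M.f_nonneg t θ hθ _ _ _ _
  · exact Finset.prod_nonneg fun j _ => ω.g_nonneg j _ _ _ _

/-- The model with the last period dropped. -/
def dropLast (M : PanelModel (n + 1) K 𝒴 𝒳 𝒜) : PanelModel n K 𝒴 𝒳 𝒜 where
  refY t := M.refY t.castSucc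
  refX t := M.refX t.castSucc
  refA := M.refA
  sigmaFinite_refY t := M.sigmaFinite_refY t.castSucc
  sigmaFinite_refX t := M.sigmaFinite_refX t.castSucc
  sigmaFinite_refA := M.sigmaFinite_refA
  Θ := M.Θ
  f t := M.f t.castSucc
  f_measurable t := M.f_measurable t.castSucc
  f_nonneg t := M.f_nonneg t.castSucc
  f_normalized t := M.f_normalized t.castSucc
  suppG j := M.suppG j.castSucc
  suppPi := M.suppPi
  suppNu := M.suppNu

end PanelModel

/-- The nuisance parameter with the last period dropped. -/
def Nuisance.dropLast {M : PanelModel (n + 1) K 𝒴 𝒳 𝒜} (ω : Nuisance M) :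
    Nuisance M.dropLast where
  g j := ω.g j.castSucc
  pi := ω.pi
  nu := ω.nu
  g_measurable j := ω.g_measurable j.castSucc
  pi_measurable := ω.pi_measurable
  nu_measurable := ω.nu_measurable
  g_nonneg j := ω.g_nonneg j.castSucc
  pi_nonneg := ω.pi_nonneg
  nu_nonneg := ω.nu_nonneg
  g_normalized j := ω.g_normalized j.castSucc
  pi_normalized := ω.pi_normalized
  nu_normalized := ω.nu_normalized
  g_support j := ω.g_support j.castSucc
  pi_support := ω.pi_support
  nu_support := ω.nu_support

namespace PanelModel

/-- Earlier factors involve only earlier coordinates, so the last period contributes just one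
feedback factor and one outcome factor. This drives the induction in `lintegral_fullDensity`. -/
theorem fullDensity_snoc (M : PanelModel (n + 1) K 𝒴 𝒳 𝒜) (θ : Vec K) (ω : Nuisance M)
    (y : Fin (n + 2) → 𝒴) (l : 𝒴) (x : Fin (n + 1) → 𝒳) (k : 𝒳) (a : 𝒜) :
    M.fullDensity θ ω ((Fin.snoc (α := fun _ => 𝒴) y l, Fin.snoc (α := fun _ => 𝒳) x k), a) =
      M.dropLast.fullDensity θ ω.dropLast ((y, x), a) * ω.g (Fin.last n) k y x a *
        M.f (Fin.last (n + 1)) θ l (y (Fin.last (n + 1))) k a := by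
  have hy : ∀ (i : Fin (n + 2)),
    (Fin.snoc (α := fun _ => 𝒴) y l : Fin (n + 3) → 𝒴) i.castSucc = y i := fun i =>
      Fin.snoc_castSucc (α := fun _ => 𝒴) l y i
  have hx : ∀ (i : Fin (n + 1)),
    (Fin.snoc (α := fun _ => 𝒳) x k : Fin (n + 2) → 𝒳) i.castSucc = x i := fun i =>
      Fin.snoc_castSucc (α := fun _ => 𝒳) k x i
  have hyl : (Fin.snoc (α := fun _ => 𝒴) y l : Fin (n + 3) → 𝒴) (Fin.last _) = l :=
    Fin.snoc_last (α := fun _ => 𝒴) l y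
  have hxl : (Fin.snoc (α := fun _ => 𝒳) x k : Fin (n + 2) → 𝒳) (Fin.last _) = k :=
    Fin.snoc_last (α := fun _ => 𝒳) k x
  have hyc : ∀ {m : ℕ} (hm : m ≤ n + 2) (h' : m ≤ n + 3), (fun i : Fin m =>
      (Fin.snoc (α := fun _ => 𝒴) y l : Fin (n + 3) → 𝒴) (Fin.castLE h' i)) =
      fun i => y (Fin.castLE hm i) := fun hm h' => funext fun i => hy (Fin.castLE hm i)
  have hxc : ∀ {m : ℕ} (hm : m ≤ n + 1) (h' : m ≤ n + 2), (fun i : Fin m =>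
      (Fin.snoc (α := fun _ => 𝒳) x k : Fin (n + 2) → 𝒳) (Fin.castLE h' i)) =
      fun i => x (Fin.castLE hm i) := fun hm h' => funext fun i => hx (Fin.castLE hm i)
  have hF : ∀ t : Fin (n + 1), M.f t.castSucc θ
      ((Fin.snoc (α := fun _ => 𝒴) y l : Fin (n + 3) → 𝒴) t.castSucc.succ)
      ((Fin.snoc (α := fun _ => 𝒴) y l : Fin (n + 3) → 𝒴) t.castSucc.castSucc)
      ((Fin.snoc (α := fun _ => 𝒳) x k : Fin (n + 2) → 𝒳) t.castSucc) a =
      M.f t.castSucc θ (y t.succ) (y t.castSucc) (x t) a := by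
    intro t
    rw [hx, hy, Fin.succ_castSucc, hy]
  have hG : ∀ j : Fin n, ω.g j.castSucc
      ((Fin.snoc (α := fun _ => 𝒳) x k : Fin (n + 2) → 𝒳) j.castSucc.succ)
      (fun i : Fin (j.castSucc + 2) =>
        (Fin.snoc (α := fun _ => 𝒴) y l : Fin (n + 3) → 𝒴) (Fin.castLE (by omega) i))
      (fun i : Fin (j.castSucc + 1) =>
        (Fin.snoc (α := fun _ => 𝒳) x k : Fin (n + 2) → 𝒳) (Fin.castLE (by omega) i)) a =
      ω.g j.castSucc (x j.succ)
        (fun i : Fin (j + 2) => y (Fin.castLE (by omega) i))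
        (fun i : Fin (j + 1) => x (Fin.castLE (by omega) i)) a := by
    intro j
    rw [Fin.succ_castSucc, hx, hyc (by simp), hxc (by simp)]
    rfl
  have hGl : ω.g (Fin.last n)
      ((Fin.snoc (α := fun _ => 𝒳) x k : Fin (n + 2) → 𝒳) (Fin.last n).succ)
      (fun i : Fin ((Fin.last n : Fin (n + 1)) + 2) =>
        (Fin.snoc (α := fun _ => 𝒴) y l : Fin (n + 3) → 𝒴) (Fin.castLE (by simp) i))
      (fun i : Fin ((Fin.last n : Fin (n + 1)) + 1) =>
        (Fin.snoc (α := fun _ => 𝒳) x k : Fin (n + 2) → 𝒳) (Fin.castLE (by simp) i)) a =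
      ω.g (Fin.last n) k y x a := by
    rw [Fin.succ_last, hxl, hyc (by simp), hxc (by simp)]
    rfl
  have hFl : M.f (Fin.last (n + 1)) θ
      ((Fin.snoc (α := fun _ => 𝒴) y l : Fin (n + 3) → 𝒴) (Fin.last (n + 1)).succ)
      ((Fin.snoc (α := fun _ => 𝒴) y l : Fin (n + 3) → 𝒴) (Fin.last (n + 1)).castSucc)
      ((Fin.snoc (α := fun _ => 𝒳) x k : Fin (n + 2) → 𝒳) (Fin.last (n + 1))) a =
      M.f (Fin.last (n + 1)) θ l (y (Fin.last (n + 1))) k a := by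
    rw [hxl, hy, Fin.succ_last, hyl]
  have hy0 : (Fin.snoc (α := fun _ => 𝒴) y l : Fin (n + 3) → 𝒴) 0 = y 0 := hy 0
  have hx0 : (Fin.snoc (α := fun _ => 𝒳) x k : Fin (n + 2) → 𝒳) 0 = x 0 := hx 0
  unfold fullDensity
  simp only
  rw [Fin.prod_univ_castSucc, Fin.prod_univ_castSucc (n := n)
    (f := fun j => ω.g j ((Fin.snoc (α := fun _ => 𝒳) x k : Fin (n + 2) → 𝒳) j.succ)
      (fun i : Fin (j + 2) =>
        (Fin.snoc (α := fun _ => 𝒴) y l : Fin (n + 3) → 𝒴) (Fin.castLE (by omega) i))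
      (fun i : Fin (j + 1) =>
        (Fin.snoc (α := fun _ => 𝒳) x k : Fin (n + 2) → 𝒳) (Fin.castLE (by omega) i)) a),
    hy0, hx0, hFl, hGl,
    Finset.prod_congr rfl fun t _ => hF t, Finset.prod_congr rfl fun j _ => hG j]
  simp only [dropLast, Nuisance.dropLast]
  ring

theorem lintegral_fullRef (M : PanelModel n K 𝒴 𝒳 𝒜) {F : Obs n 𝒴 𝒳 × 𝒜 → ENNReal}
    (hF : Measurable F) :
    ∫⁻ z, F z ∂M.fullRef = ∫⁻ a, ∫⁻ x, ∫⁻ y, F ((y, x), a) ∂(Measure.pi M.refY)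
      ∂(Measure.pi M.refX) ∂M.refA := by
  unfold fullRef obsRef
  rw [lintegral_prod_symm' _ hF]
  refine lintegral_congr fun a => ?_
  rw [lintegral_prod_symm' _ (by fun_prop)]

/-- Induction on the number of periods, integrating backwards in time: the last outcome against `f`,
then the last regressor against `g`. The base case `n = 0` is a single transition, where `f`, `π`
and `ν` integrate to one in that order. -/
theorem lintegral_fullDensity : ∀ {n : ℕ} (M : PanelModel n K 𝒴 𝒳 𝒜) {θ : Vec K}
    (_ : θ ∈ M.Θ) (ω : Nuisance M),
    ∫⁻ z, ENNReal.ofReal (M.fullDensity θ ω z) ∂M.fullRef = 1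
  | 0, M, θ, hθ, ω => by
    have hm : Measurable fun z => ENNReal.ofReal (M.fullDensity θ ω z) :=
      (M.measurable_fullDensity hθ ω).ennreal_ofReal
    have hp := ω.pi_measurable
    have hn := ω.nu_measurable
    rw [M.lintegral_fullRef hm]
    have key : ∀ a, ∫⁻ x, ∫⁻ y, ENNReal.ofReal (M.fullDensity θ ω ((y, x), a))
        ∂(Measure.pi M.refY) ∂(Measure.pi M.refX) =
        ∫⁻ x, ∫⁻ y, ENNReal.ofReal (ω.pi a y x) * ENNReal.ofReal (ω.nu y x)
          ∂(M.refY 0) ∂(M.refX 0) := by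
      intro a
      have hmx : Measurable fun x => ∫⁻ y, ENNReal.ofReal (M.fullDensity θ ω ((y, x), a))
          ∂(Measure.pi M.refY) := Measurable.lintegral_prod_right'
        (f := fun p : (Fin 1 → 𝒳) × (Fin 2 → 𝒴) =>
          ENNReal.ofReal (M.fullDensity θ ω ((p.2, p.1), a)))
        (hm.comp (f := fun p : (Fin 1 → 𝒳) × (Fin 2 → 𝒴) => ((p.2, p.1), a)) (by fun_prop))
      rw [lintegral_pi_fin_one _ hmx]
      refine lintegral_congr fun x => ?_
      have hmy : Measurable fun y : Fin 2 → 𝒴 =>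
          ENNReal.ofReal (M.fullDensity θ ω ((y, fun _ => x), a)) :=
        hm.comp (f := fun y : Fin 2 → 𝒴 => ((y, fun _ => x), a)) (by fun_prop)
      rw [lintegral_pi_snoc (m := 1) M.refY hmy]
      have hin : ∀ y : Fin 1 → 𝒴, ∫⁻ l, ENNReal.ofReal (M.fullDensity θ ω
          ((Fin.snoc (α := fun _ => 𝒴) y l, fun _ => x), a)) ∂(M.refY (Fin.last 1)) =
          ENNReal.ofReal (ω.pi a (y 0) x) * ENNReal.ofReal (ω.nu (y 0) x) := by
        intro y
        have h1 : ∀ l, ENNReal.ofReal (M.fullDensity θ ω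
            ((Fin.snoc (α := fun _ => 𝒴) y l, fun _ => x), a)) =
            ENNReal.ofReal (ω.pi a (y 0) x) * ENNReal.ofReal (ω.nu (y 0) x) *
            ENNReal.ofReal (M.f 0 θ l (y 0) x a) := by
          intro l
          have e0 : (Fin.snoc (α := fun _ => 𝒴) y l : Fin 2 → 𝒴) 0 = y 0 :=
            Fin.snoc_castSucc (α := fun _ => 𝒴) l y 0
          have e1 : (Fin.snoc (α := fun _ => 𝒴) y l : Fin 2 → 𝒴) 1 = l :=
            Fin.snoc_last (α := fun _ => 𝒴) l y
          have e2 : M.fullDensity θ ω ((Fin.snoc (α := fun _ => 𝒴) y l, fun _ => x), a) =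
              M.f 0 θ l (y 0) x a * ω.pi a (y 0) x * ω.nu (y 0) x := by
            unfold fullDensity
            rw [Fin.prod_univ_succ, Fin.prod_univ_zero, Fin.prod_univ_zero]
            simp only [mul_one]
            erw [e0, e1]
          rw [e2]
          rw [ENNReal.ofReal_mul (mul_nonneg (M.f_nonneg _ θ hθ _ _ _ _) (ω.pi_nonneg _ _ _)),
            ENNReal.ofReal_mul (M.f_nonneg _ θ hθ _ _ _ _)]
          ring
        simp_rw [h1]
        rw [lintegral_const_mul _ (by
          have := M.f_measurable 0 θ hθ
          exact (this.comp (f := fun l => (l, y 0, x, a)) (by fun_prop)).ennreal_ofReal)]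
        rw [show Fin.last 1 = (0 : Fin 1).succ from rfl, M.f_normalized 0 θ hθ, mul_one]
      simp_rw [hin]
      rw [lintegral_pi_fin_one (fun i : Fin 1 => M.refY i.castSucc)
        (F := fun y => ENNReal.ofReal (ω.pi a (y 0) x) * ENNReal.ofReal (ω.nu (y 0) x))
        (((hp.comp (f := fun y : Fin 1 → 𝒴 => (a, y 0, x)) (by fun_prop)).ennreal_ofReal).mul
          (hn.comp (f := fun y : Fin 1 → 𝒴 => (y 0, x)) (by fun_prop)).ennreal_ofReal)]
      rfl
    simp_rw [key]
    have hq : Measurable fun q : (𝒴 × 𝒳) × 𝒜 =>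
        ENNReal.ofReal (ω.pi q.2 q.1.1 q.1.2) * ENNReal.ofReal (ω.nu q.1.1 q.1.2) :=
      ((hp.comp (f := fun q : (𝒴 × 𝒳) × 𝒜 => (q.2, q.1.1, q.1.2)) (by fun_prop)).ennreal_ofReal).mul
        (hn.comp (f := fun q : (𝒴 × 𝒳) × 𝒜 => (q.1.1, q.1.2)) (by fun_prop)).ennreal_ofReal
    have e1 : ∀ a, ∫⁻ x, ∫⁻ y, ENNReal.ofReal (ω.pi a y x) * ENNReal.ofReal (ω.nu y x)
          ∂(M.refY 0) ∂(M.refX 0) = ∫⁻ q : 𝒴 × 𝒳, ENNReal.ofReal (ω.pi a q.1 q.2) *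
          ENNReal.ofReal (ω.nu q.1 q.2) ∂((M.refY 0).prod (M.refX 0)) := by
      intro a
      rw [lintegral_prod_symm' (fun q : 𝒴 × 𝒳 => ENNReal.ofReal (ω.pi a q.1 q.2) *
        ENNReal.ofReal (ω.nu q.1 q.2)) (hq.comp (f := fun q => (q, a)) (by fun_prop))]
    simp_rw [e1]
    -- The heterogeneity moves to the innermost place, since `π` is normalized given the initial
    -- condition.
    rw [← lintegral_prod_symm' _ hq, lintegral_prod _ hq.aemeasurable, ← ω.nu_normalized]
    refine lintegral_congr fun q => ?_
    simp only
    have hpa : Measurable fun a => ENNReal.ofReal (ω.pi a q.1 q.2) :=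
      (hp.comp (f := fun a => (a, q.1, q.2)) (by fun_prop)).ennreal_ofReal
    rw [lintegral_mul_const _ hpa, ω.pi_normalized, one_mul]
  | n + 1, M, θ, hθ, ω => by
    have ih := lintegral_fullDensity M.dropLast (θ := θ) hθ ω.dropLast
    have hm : Measurable fun z => ENNReal.ofReal (M.fullDensity θ ω z) :=
      (M.measurable_fullDensity hθ ω).ennreal_ofReal
    have hm' : Measurable fun z => ENNReal.ofReal (M.dropLast.fullDensity θ ω.dropLast z) :=
      (M.dropLast.measurable_fullDensity hθ ω.dropLast).ennreal_ofReal
    rw [M.dropLast.lintegral_fullRef hm'] at ih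
    rw [M.lintegral_fullRef hm, ← ih]
    refine lintegral_congr fun a => ?_
    have hmx : Measurable fun x => ∫⁻ y, ENNReal.ofReal (M.fullDensity θ ω ((y, x), a))
        ∂(Measure.pi M.refY) := Measurable.lintegral_prod_right'
      (f := fun p : (Fin (n + 2) → 𝒳) × (Fin (n + 3) → 𝒴) =>
        ENNReal.ofReal (M.fullDensity θ ω ((p.2, p.1), a)))
      (hm.comp (f := fun p : (Fin (n + 2) → 𝒳) × (Fin (n + 3) → 𝒴) => ((p.2, p.1), a))
        (by fun_prop))
    rw [lintegral_pi_snoc _ hmx]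
    refine lintegral_congr fun x => ?_
    have hD := fun y => M.dropLast.fullDensity_nonneg (θ := θ) hθ ω.dropLast ((y, x), a)
    have hin : ∀ (k : 𝒳), ∫⁻ y, ENNReal.ofReal (M.fullDensity θ ω
        ((y, Fin.snoc (α := fun _ => 𝒳) x k), a)) ∂(Measure.pi M.refY) =
        ∫⁻ y, ENNReal.ofReal (M.dropLast.fullDensity θ ω.dropLast ((y, x), a)) *
          ENNReal.ofReal (ω.g (Fin.last n) k y x a) ∂(Measure.pi M.dropLast.refY) := by
      intro k
      have hmy : Measurable fun y : Fin (n + 3) → 𝒴 =>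
          ENNReal.ofReal (M.fullDensity θ ω ((y, Fin.snoc (α := fun _ => 𝒳) x k), a)) :=
        hm.comp (f := fun y : Fin (n + 3) → 𝒴 => ((y, Fin.snoc (α := fun _ => 𝒳) x k), a))
          (by fun_prop)
      rw [lintegral_pi_snoc (m := n + 2) M.refY hmy]
      refine lintegral_congr fun y => ?_
      have hgn : 0 ≤ ω.g (Fin.last n) k y x a := ω.g_nonneg (Fin.last n) k y x a
      simp only [fullDensity_snoc,
        ENNReal.ofReal_mul (mul_nonneg (hD y) hgn), ENNReal.ofReal_mul (hD y)]
      rw [lintegral_const_mul _ (by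
          have := M.f_measurable (Fin.last (n + 1)) θ hθ
          exact (this.comp (f := fun l => (l, y (Fin.last (n + 1)), k, a))
            (by fun_prop)).ennreal_ofReal)]
      rw [show Fin.last (n + 2) = (Fin.last (n + 1)).succ from rfl, M.f_normalized _ θ hθ, mul_one]
    simp_rw [hin]
    have hg : Measurable fun q : 𝒳 × (Fin (n + 2) → 𝒴) =>
        ENNReal.ofReal (ω.g (Fin.last n) q.1 q.2 x a) :=
      ((ω.g_measurable (Fin.last n)).comp
        (f := fun q : 𝒳 × (Fin (n + 2) → 𝒴) => (q.1, q.2, x, a)) (by fun_prop)).ennreal_ofReal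
    -- With the last outcome gone, the last regressor must be integrated for fixed past outcomes, as
    -- `g` is normalized given them.
    rw [lintegral_lintegral_swap (Measurable.aemeasurable (by
      refine Measurable.mul ?_ hg
      exact hm'.comp (f := fun q : 𝒳 × (Fin (n + 2) → 𝒴) => ((q.2, x), a)) (by fun_prop)))]
    refine lintegral_congr fun y => ?_
    have hgk : Measurable fun k => ENNReal.ofReal (ω.g (Fin.last n) k y x a) :=
      hg.comp (f := fun k => (k, y)) (by fun_prop)
    rw [lintegral_const_mul _ hgk]
    rw [show Fin.last (n + 1) = (Fin.last n).succ from rfl]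
    erw [ω.g_normalized (Fin.last n) y x a]
    rw [mul_one]

theorem isProbabilityMeasure_fullLaw (M : PanelModel n K 𝒴 𝒳 𝒜) {θ : Vec K} (hθ : θ ∈ M.Θ)
    (ω : Nuisance M) : IsProbabilityMeasure (M.fullLaw θ ω) :=
  ⟨by rw [fullLaw, withDensity_apply _ MeasurableSet.univ, Measure.restrict_univ,
    M.lintegral_fullDensity hθ ω]⟩

theorem isProbabilityMeasure_obsLaw (M : PanelModel n K 𝒴 𝒳 𝒜) {θ : Vec K} (hθ : θ ∈ M.Θ)
    (ω : Nuisance M) : IsProbabilityMeasure (M.obsLaw θ ω) :=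
  have := M.isProbabilityMeasure_fullLaw hθ ω
  Measure.isProbabilityMeasure_map measurable_fst.aemeasurable

end PanelModel

namespace PanelModel

/-! ### The likelihood and conditional means given the observed data -/

instance (M : PanelModel n K 𝒴 𝒳 𝒜) : SigmaFinite M.obsRef := by
  unfold obsRef; infer_instance

instance (M : PanelModel n K 𝒴 𝒳 𝒜) : SigmaFinite M.fullRef := by
  unfold fullRef; infer_instance

variable (M : PanelModel n K 𝒴 𝒳 𝒜) {θ : Vec K} (hθ : θ ∈ M.Θ) (ω : Nuisance M)

/-- The conditional mean under `(θ, ω)` of a function of all variables given the observed data. -/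
def condMean (θ : Vec K) (ω : Nuisance M) (w : Obs n 𝒴 𝒳 × 𝒜 → ℝ) (d : Obs n 𝒴 𝒳) : ℝ :=
  (∫ a, M.fullDensity θ ω (d, a) * w (d, a) ∂M.refA) / M.lik θ ω d

include hθ

theorem integrable_fullDensity : Integrable (M.fullDensity θ ω) M.fullRef := by
  refine ⟨(M.measurable_fullDensity hθ ω).aestronglyMeasurable, ?_⟩
  rw [hasFiniteIntegral_iff_ofReal (.of_forall (M.fullDensity_nonneg hθ ω)),
    M.lintegral_fullDensity hθ ω]
  exact ENNReal.one_lt_top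

theorem ae_integrable_fullDensity :
    ∀ᵐ d ∂M.obsRef, Integrable (fun a => M.fullDensity θ ω (d, a)) M.refA :=
  (M.integrable_fullDensity hθ ω).prod_right_ae

theorem measurable_lik : Measurable (M.lik θ ω) :=
  (M.measurable_fullDensity hθ ω).stronglyMeasurable.integral_prod_right'.measurable

theorem lik_nonneg (d : Obs n 𝒴 𝒳) : 0 ≤ M.lik θ ω d :=
  integral_nonneg fun _ => M.fullDensity_nonneg hθ ω _

/-- Only almost everywhere: where the section is not integrable, the Bochner integral defaults to
zero while the Lebesgue integral is infinite. -/
theorem ae_ofReal_lik : ∀ᵐ d ∂M.obsRef,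
    ENNReal.ofReal (M.lik θ ω d) = ∫⁻ a, ENNReal.ofReal (M.fullDensity θ ω (d, a)) ∂M.refA := by
  filter_upwards [M.ae_integrable_fullDensity hθ ω] with d hd
  exact ofReal_integral_eq_lintegral_ofReal hd (.of_forall fun _ => M.fullDensity_nonneg hθ ω _)

theorem obsLaw_eq_withDensity :
    M.obsLaw θ ω = M.obsRef.withDensity fun d => ENNReal.ofReal (M.lik θ ω d) := by
  have hm := (M.measurable_fullDensity hθ ω).ennreal_ofReal
  rw [withDensity_congr_ae (M.ae_ofReal_lik hθ ω)]
  ext s hs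
  rw [obsLaw, Measure.map_apply measurable_fst hs, fullLaw,
    withDensity_apply _ (measurable_fst hs), withDensity_apply _ hs, fullRef,
    ← lintegral_indicator (measurable_fst hs),
    lintegral_prod _ (hm.indicator (measurable_fst hs)).aemeasurable, ← lintegral_indicator hs]
  refine lintegral_congr fun d => ?_
  by_cases hd : d ∈ s <;> simp [Set.indicator, hd]

theorem integral_obsLaw {E : Type*} [NormedAddCommGroup E] [NormedSpace ℝ E]
    (g : Obs n 𝒴 𝒳 → E) : ∫ d, g d ∂(M.obsLaw θ ω) = ∫ d, M.lik θ ω d • g d ∂M.obsRef := by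
  rw [M.obsLaw_eq_withDensity hθ ω, integral_withDensity_eq_integral_toReal_smul
    (M.measurable_lik hθ ω).ennreal_ofReal (.of_forall fun _ => ENNReal.ofReal_lt_top)]
  simp only [ENNReal.toReal_ofReal (M.lik_nonneg hθ ω _)]

theorem integral_fullLaw {E : Type*} [NormedAddCommGroup E] [NormedSpace ℝ E]
    (g : Obs n 𝒴 𝒳 × 𝒜 → E) :
    ∫ z, g z ∂(M.fullLaw θ ω) = ∫ z, M.fullDensity θ ω z • g z ∂M.fullRef := by
  rw [fullLaw, integral_withDensity_eq_integral_toReal_smul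
    (M.measurable_fullDensity hθ ω).ennreal_ofReal (.of_forall fun _ => ENNReal.ofReal_lt_top)]
  simp only [ENNReal.toReal_ofReal (M.fullDensity_nonneg hθ ω _)]

theorem integrable_fullLaw_iff {E : Type*} [NormedAddCommGroup E] [NormedSpace ℝ E]
    {g : Obs n 𝒴 𝒳 × 𝒜 → E} :
    Integrable g (M.fullLaw θ ω) ↔ Integrable (fun z => M.fullDensity θ ω z • g z) M.fullRef := by
  rw [fullLaw, integrable_withDensity_iff_integrable_smul'
    (M.measurable_fullDensity hθ ω).ennreal_ofReal (.of_forall fun _ => ENNReal.ofReal_lt_top)]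
  simp only [ENNReal.toReal_ofReal (M.fullDensity_nonneg hθ ω _)]

omit hθ in
theorem integrable_comp_fst {g : Obs n 𝒴 𝒳 → ℝ} (hg : Integrable g (M.obsLaw θ ω)) :
    Integrable (fun z => g z.1) (M.fullLaw θ ω) :=
  (integrable_map_measure hg.1 measurable_fst.aemeasurable).1 hg

omit hθ in
theorem integral_comp_fst {g : Obs n 𝒴 𝒳 → ℝ} (hg : Integrable g (M.obsLaw θ ω)) :
    ∫ z, g z.1 ∂(M.fullLaw θ ω) = ∫ d, g d ∂(M.obsLaw θ ω) :=
  (integral_map measurable_fst.aemeasurable hg.1).symm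

variable {w : Obs n 𝒴 𝒳 × 𝒜 → ℝ} (hw : Measurable w) {B : ℝ} (hB : ∀ z, |w z| ≤ B)
include hw

theorem measurable_condMean : Measurable (M.condMean θ ω w) :=
  (((M.measurable_fullDensity hθ ω).mul hw).stronglyMeasurable.integral_prod_right'.measurable).div
    (M.measurable_lik hθ ω)

include hB

omit hw in
theorem abs_integral_fullDensity_mul_le {d : Obs n 𝒴 𝒳}
    (hd : Integrable (fun a => M.fullDensity θ ω (d, a)) M.refA) :
    |∫ a, M.fullDensity θ ω (d, a) * w (d, a) ∂M.refA| ≤ B * M.lik θ ω d := by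
  rw [lik, ← integral_const_mul, ← Real.norm_eq_abs]
  refine norm_integral_le_of_norm_le (hd.const_mul B) (.of_forall fun a => ?_)
  rw [Real.norm_eq_abs, abs_mul, abs_of_nonneg (M.fullDensity_nonneg hθ ω _), mul_comm]
  exact mul_le_mul_of_nonneg_right (hB _) (M.fullDensity_nonneg hθ ω _)

omit hw in
-- Where the likelihood vanishes, the bound on `w` forces the numerator of the conditional mean to
-- vanish too, so division by zero does no harm.
theorem ae_lik_mul_condMean : ∀ᵐ d ∂M.obsRef, M.lik θ ω d * M.condMean θ ω w d =
    ∫ a, M.fullDensity θ ω (d, a) * w (d, a) ∂M.refA := by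
  filter_upwards [M.ae_integrable_fullDensity hθ ω] with d hd
  have h := M.abs_integral_fullDensity_mul_le hθ ω hB hd
  rcases eq_or_ne (M.lik θ ω d) 0 with h0 | h0
  · rw [h0, mul_zero] at h
    rw [h0, zero_mul, abs_nonpos_iff.1 h]
  · rw [condMean, mul_div_cancel₀ _ h0]

omit hw in
theorem ae_abs_condMean_le : ∀ᵐ d ∂M.obsRef, |M.condMean θ ω w d| ≤ B := by
  filter_upwards [M.ae_integrable_fullDensity hθ ω] with d hd
  have h := M.abs_integral_fullDensity_mul_le hθ ω hB hd
  rcases (M.lik_nonneg hθ ω d).eq_or_lt with h0 | h0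
  · rw [condMean, ← h0, div_zero, abs_zero]
    -- `0 ≤ B` follows from the bound at any single point; total mass one rules out an empty space.
    have hne : Nonempty 𝒜 := by
      have : Nonempty (Obs n 𝒴 𝒳 × 𝒜) := by
        by_contra hcon
        have : IsEmpty (Obs n 𝒴 𝒳 × 𝒜) := not_nonempty_iff.1 hcon
        have h1 := M.lintegral_fullDensity hθ ω
        rw [Measure.eq_zero_of_isEmpty M.fullRef, lintegral_zero_measure] at h1
        exact zero_ne_one h1
      exact this.map Prod.snd
    exact (abs_nonneg _).trans (hB (d, hne.some))
  · rw [condMean, abs_div, abs_of_pos h0, div_le_iff₀ h0]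
    exact h

/-- The tower property, by Fubini. It translates orthogonality to a direction on the full space into
orthogonality to its score on the observed data. -/
theorem integral_mul_condMean {g : Obs n 𝒴 𝒳 → ℝ} (hg : Integrable g (M.obsLaw θ ω)) :
    ∫ d, g d * M.condMean θ ω w d ∂(M.obsLaw θ ω) = ∫ z, g z.1 * w z ∂(M.fullLaw θ ω) := by
  rw [M.integral_obsLaw hθ, M.integral_fullLaw hθ]
  have hint : Integrable (fun z => M.fullDensity θ ω z • (g z.1 * w z)) M.fullRef :=
    (M.integrable_fullLaw_iff hθ ω).1
      ((M.integrable_comp_fst ω hg).mul_bdd hw.aestronglyMeasurable (.of_forall hB))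
  rw [fullRef, integral_prod _ hint]
  refine integral_congr_ae ?_
  filter_upwards [M.ae_lik_mul_condMean hθ ω hB] with d hd
  rw [smul_eq_mul, mul_left_comm, hd, ← integral_const_mul]
  refine integral_congr_ae (.of_forall fun a => ?_)
  simp only [smul_eq_mul]
  ring

end PanelModel

/-! ### Bounded perturbations of the nuisance parameter -/

section Density

variable {X : Type*} [MeasurableSpace X] {μ : Measure X} {p b : X → ℝ} {B η : ℝ}

theorem integrable_of_lintegral_ofReal_eq_one (hp : Measurable p) (hp0 : ∀ x, 0 ≤ p x)
    (hp1 : ∫⁻ x, ENNReal.ofReal (p x) ∂μ = 1) : Integrable p μ := by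
  refine ⟨hp.aestronglyMeasurable, ?_⟩
  rw [hasFiniteIntegral_iff_ofReal (.of_forall hp0), hp1]
  exact ENNReal.one_lt_top

theorem integral_eq_one_of_lintegral_ofReal_eq_one (hp : Measurable p) (hp0 : ∀ x, 0 ≤ p x)
    (hp1 : ∫⁻ x, ENNReal.ofReal (p x) ∂μ = 1) : ∫ x, p x ∂μ = 1 := by
  rw [integral_eq_lintegral_of_nonneg_ae (.of_forall hp0) hp.aestronglyMeasurable, hp1,
    ENNReal.toReal_one]

/-- Keeping `1 + η r` away from zero makes a perturbed density nonnegative with exactly the same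
support. -/
theorem half_le_one_add_mul (hη : |η| * B ≤ 1 / 2) {r : ℝ} (hr : |r| ≤ B) :
    1 / 2 ≤ 1 + η * r := by
  have h1 : |η * r| ≤ 1 / 2 := by
    rw [abs_mul]
    exact (mul_le_mul_of_nonneg_left hr (abs_nonneg η)).trans hη
  linarith [neg_le_of_abs_le h1]

theorem lintegral_ofReal_mul_one_add (hp : Measurable p) (hp0 : ∀ x, 0 ≤ p x)
    (hp1 : ∫⁻ x, ENNReal.ofReal (p x) ∂μ = 1) (hb : Measurable b) (hB : ∀ x, |b x| ≤ B)
    (hpb : ∫ x, p x * b x ∂μ = 0) (hη : |η| * B ≤ 1 / 2) :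
    ∫⁻ x, ENNReal.ofReal (p x * (1 + η * b x)) ∂μ = 1 := by
  have hi := integrable_of_lintegral_ofReal_eq_one hp hp0 hp1
  have hib : Integrable (fun x => p x * b x) μ := hi.mul_bdd hb.aestronglyMeasurable (.of_forall hB)
  have he : (fun x => p x * (1 + η * b x)) = fun x => p x + η * (p x * b x) := by
    funext x; ring
  rw [← ofReal_integral_eq_lintegral_ofReal, he, integral_add hi (hib.const_mul η),
    integral_const_mul, hpb, integral_eq_one_of_lintegral_ofReal_eq_one hp hp0 hp1]
  · simp
  · rw [he]
    exact hi.add (hib.const_mul η)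
  · refine .of_forall fun x => mul_nonneg (hp0 x) ?_
    linarith [half_le_one_add_mul hη (hB x)]

end Density

/-- With `r = P - 1 - η S`, the new remainder is exactly `η² b S + r + r η b`. Hence a quadratic
remainder survives each further factor. -/
theorem abs_mul_one_add_sub_le {P S b η B C D : ℝ} (hη : |η| ≤ 1) (hb : |b| ≤ B) (hS : |S| ≤ D)
    (hP : |P - 1 - η * S| ≤ C * η ^ 2) :
    |P * (1 + η * b) - 1 - η * (S + b)| ≤ (B * D + C + C * B) * η ^ 2 := by
  have e : P * (1 + η * b) - 1 - η * (S + b) =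
      η ^ 2 * (b * S) + (P - 1 - η * S) + (P - 1 - η * S) * (η * b) := by ring
  have hB : 0 ≤ B := (abs_nonneg b).trans hb
  have hD : 0 ≤ D := (abs_nonneg S).trans hS
  have h1 : |η ^ 2 * (b * S)| ≤ η ^ 2 * (B * D) := by
    rw [abs_mul, abs_mul, abs_of_nonneg (sq_nonneg η)]
    gcongr
  have h2 : |(P - 1 - η * S) * (η * b)| ≤ C * η ^ 2 * (1 * B) := by
    rw [abs_mul, abs_mul]
    have := (abs_nonneg _).trans hP
    gcongr
  rw [e]
  calc _ ≤ |η ^ 2 * (b * S)| + |P - 1 - η * S| + |(P - 1 - η * S) * (η * b)| := abs_add_three _ _ _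
    _ ≤ η ^ 2 * (B * D) + C * η ^ 2 + C * η ^ 2 * (1 * B) := by gcongr
    _ = _ := by ring

/-- The constant depends only on the bound `B`, so it stays uniform when the `b i` are values of
functions at varying points. -/
theorem exists_abs_prod_one_add_sub_le {ι : Type*} (s : Finset ι) (B : ℝ) :
    ∃ C, ∀ (b : ι → ℝ) (η : ℝ), (∀ i, |b i| ≤ B) → |η| ≤ 1 →
      |∏ i ∈ s, (1 + η * b i) - 1 - η * ∑ i ∈ s, b i| ≤ C * η ^ 2 := by
  classical
  induction s using Finset.induction_on with
  | empty => exact ⟨0, fun b η _ _ => by simp⟩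
  | insert i s hi ih =>
    obtain ⟨C, hC⟩ := ih
    refine ⟨B * (s.card * B) + C + C * B, fun b η hb hη => ?_⟩
    have hS : |∑ i ∈ s, b i| ≤ s.card * B :=
      (Finset.abs_sum_le_sum_abs _ _).trans (by
        simpa using Finset.sum_le_sum (s := s) fun i _ => hb i)
    rw [Finset.prod_insert hi, Finset.sum_insert hi, mul_comm, add_comm (b i)]
    exact abs_mul_one_add_sub_le hη (hb i) hS (hC b η hb hη)

namespace Nuisance

variable {M : PanelModel n K 𝒴 𝒳 𝒜}

/-- Bounded directions in which the factors of the density can be perturbed multiplicatively: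
each component has conditional mean zero given the past. -/
structure Direction (ω : Nuisance M) where
  g : (j : Fin n) → 𝒳 → (Fin (j + 2) → 𝒴) → (Fin (j + 1) → 𝒳) → 𝒜 → ℝ
  pi : 𝒜 → 𝒴 → 𝒳 → ℝ
  nu : 𝒴 → 𝒳 → ℝ
  g_measurable : ∀ j : Fin n, Measurable
    fun q : 𝒳 × (Fin (j + 2) → 𝒴) × (Fin (j + 1) → 𝒳) × 𝒜 => g j q.1 q.2.1 q.2.2.1 q.2.2.2
  pi_measurable : Measurable fun q : 𝒜 × 𝒴 × 𝒳 => pi q.1 q.2.1 q.2.2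
  nu_measurable : Measurable fun q : 𝒴 × 𝒳 => nu q.1 q.2
  bounded : ∃ B : ℝ, (∀ (j : Fin n) x yh xh a, |g j x yh xh a| ≤ B) ∧
    (∀ a y x, |pi a y x| ≤ B) ∧ ∀ y x, |nu y x| ≤ B
  g_centred : ∀ (j : Fin n) yh xh a,
    ∫ x, ω.g j x yh xh a * g j x yh xh a ∂(M.refX j.succ) = 0
  pi_centred : ∀ y x, ∫ a, ω.pi a y x * pi a y x ∂M.refA = 0
  nu_centred : ∫ q : 𝒴 × 𝒳, ω.nu q.1 q.2 * nu q.1 q.2 ∂((M.refY 0).prod (M.refX 0)) = 0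

theorem g_section_measurable (ω : Nuisance M) (j : Fin n) (yh : Fin (j + 2) → 𝒴)
    (xh : Fin (j + 1) → 𝒳) (a : 𝒜) : Measurable fun x => ω.g j x yh xh a :=
  (ω.g_measurable j).comp (f := fun x => (x, yh, xh, a)) (by fun_prop)

theorem pi_section_measurable (ω : Nuisance M) (y : 𝒴) (x : 𝒳) :
    Measurable fun a => ω.pi a y x :=
  ω.pi_measurable.comp (f := fun a => (a, y, x)) (by fun_prop)

namespace Direction

variable {ω : Nuisance M} (b c : ω.Direction)

theorem g_section_measurable (j : Fin n) (yh : Fin (j + 2) → 𝒴)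
    (xh : Fin (j + 1) → 𝒳) (a : 𝒜) : Measurable fun x => b.g j x yh xh a :=
  (b.g_measurable j).comp (f := fun x => (x, yh, xh, a)) (by fun_prop)

theorem pi_section_measurable (y : 𝒴) (x : 𝒳) : Measurable fun a => b.pi a y x :=
  b.pi_measurable.comp (f := fun a => (a, y, x)) (by fun_prop)

theorem g_integrable (j : Fin n) (yh : Fin (j + 2) → 𝒴)
    (xh : Fin (j + 1) → 𝒳) (a : 𝒜) :
    Integrable (fun x => ω.g j x yh xh a * b.g j x yh xh a) (M.refX j.succ) := by
  obtain ⟨B, hB, -⟩ := b.bounded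
  exact (integrable_of_lintegral_ofReal_eq_one (ω.g_section_measurable j yh xh a)
    (fun _ => ω.g_nonneg _ _ _ _ _) (ω.g_normalized j yh xh a)).mul_bdd
    (b.g_section_measurable j yh xh a).aestronglyMeasurable (.of_forall fun _ => hB _ _ _ _ _)

theorem pi_integrable (y : 𝒴) (x : 𝒳) :
    Integrable (fun a => ω.pi a y x * b.pi a y x) M.refA := by
  obtain ⟨B, -, hB, -⟩ := b.bounded
  exact (integrable_of_lintegral_ofReal_eq_one (ω.pi_section_measurable y x)
    (fun _ => ω.pi_nonneg _ _ _) (ω.pi_normalized y x)).mul_bdd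
    (b.pi_section_measurable y x).aestronglyMeasurable (.of_forall fun _ => hB _ _ _)

theorem nu_integrable :
    Integrable (fun q : 𝒴 × 𝒳 => ω.nu q.1 q.2 * b.nu q.1 q.2) ((M.refY 0).prod (M.refX 0)) := by
  obtain ⟨B, -, -, hB⟩ := b.bounded
  exact (integrable_of_lintegral_ofReal_eq_one ω.nu_measurable
    (fun _ => ω.nu_nonneg _ _) ω.nu_normalized).mul_bdd
    b.nu_measurable.aestronglyMeasurable (.of_forall fun _ => hB _ _)

/-- The sum of two directions. -/
protected def add : ω.Direction where
  g j x yh xh a := b.g j x yh xh a + c.g j x yh xh a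
  pi a y x := b.pi a y x + c.pi a y x
  nu y x := b.nu y x + c.nu y x
  g_measurable j := (b.g_measurable j).add (c.g_measurable j)
  pi_measurable := b.pi_measurable.add c.pi_measurable
  nu_measurable := b.nu_measurable.add c.nu_measurable
  bounded := by
    obtain ⟨B, h1, h2, h3⟩ := b.bounded
    obtain ⟨C, k1, k2, k3⟩ := c.bounded
    exact ⟨B + C, fun j x yh xh a => (abs_add_le _ _).trans (add_le_add (h1 ..) (k1 ..)),
      fun a y x => (abs_add_le _ _).trans (add_le_add (h2 ..) (k2 ..)),
      fun y x => (abs_add_le _ _).trans (add_le_add (h3 ..) (k3 ..))⟩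
  g_centred j yh xh a := by
    simp_rw [mul_add]
    rw [integral_add (b.g_integrable ..) (c.g_integrable ..), b.g_centred, c.g_centred, add_zero]
  pi_centred y x := by
    simp_rw [mul_add]
    rw [integral_add (b.pi_integrable ..) (c.pi_integrable ..), b.pi_centred, c.pi_centred,
      add_zero]
  nu_centred := by
    simp_rw [mul_add]
    rw [integral_add b.nu_integrable c.nu_integrable, b.nu_centred, c.nu_centred, add_zero]

/-- The derivative of the log density along the direction. -/
def toFun (z : Obs n 𝒴 𝒳 × 𝒜) : ℝ :=
  (∑ j : Fin n, b.g j (z.1.2 j.succ)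
    (fun i : Fin (j + 2) => z.1.1 (Fin.castLE (by omega) i))
    (fun i : Fin (j + 1) => z.1.2 (Fin.castLE (by omega) i)) z.2) +
  b.pi z.2 (z.1.1 0) (z.1.2 0) + b.nu (z.1.1 0) (z.1.2 0)

theorem add_toFun (z : Obs n 𝒴 𝒳 × 𝒜) : (b.add c).toFun z = b.toFun z + c.toFun z := by
  simp only [toFun, Direction.add, Finset.sum_add_distrib]
  ring

theorem measurable_toFun : Measurable b.toFun := by
  refine (Measurable.add ?_ ?_).add ?_
  · refine Finset.measurable_sum _ fun j _ => ?_
    exact (b.g_measurable j).comp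
      (f := fun z : Obs n 𝒴 𝒳 × 𝒜 => (z.1.2 j.succ,
        (fun i : Fin (j + 2) => z.1.1 (Fin.castLE (by omega) i)),
        (fun i : Fin (j + 1) => z.1.2 (Fin.castLE (by omega) i)), z.2))
      (by fun_prop)
  · exact b.pi_measurable.comp
      (f := fun z : Obs n 𝒴 𝒳 × 𝒜 => (z.2, z.1.1 0, z.1.2 0)) (by fun_prop)
  · exact b.nu_measurable.comp
      (f := fun z : Obs n 𝒴 𝒳 × 𝒜 => (z.1.1 0, z.1.2 0)) (by fun_prop)

theorem exists_abs_toFun_le : ∃ B, ∀ z, |b.toFun z| ≤ B := by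
  obtain ⟨B, h1, h2, h3⟩ := b.bounded
  refine ⟨∑ _j : Fin n, B + B + B, fun z => (abs_add_three _ _ _).trans ?_⟩
  gcongr
  · exact (Finset.abs_sum_le_sum_abs _ _).trans (Finset.sum_le_sum fun _ _ => h1 ..)
  · exact h2 ..
  · exact h3 ..

/-- The nuisance parameter with each factor `p` of the density replaced by `p (1 + η b)`. -/
def perturb (η B : ℝ) (hη : |η| * B ≤ 1 / 2)
    (hB : (∀ (j : Fin n) x yh xh a, |b.g j x yh xh a| ≤ B) ∧
      (∀ a y x, |b.pi a y x| ≤ B) ∧ ∀ y x, |b.nu y x| ≤ B) : Nuisance M where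
  g j x yh xh a := ω.g j x yh xh a * (1 + η * b.g j x yh xh a)
  pi a y x := ω.pi a y x * (1 + η * b.pi a y x)
  nu y x := ω.nu y x * (1 + η * b.nu y x)
  g_measurable j := (ω.g_measurable j).mul (((b.g_measurable j).const_mul η).const_add 1)
  pi_measurable := ω.pi_measurable.mul ((b.pi_measurable.const_mul η).const_add 1)
  nu_measurable := ω.nu_measurable.mul ((b.nu_measurable.const_mul η).const_add 1)
  g_nonneg j x yh xh a := mul_nonneg (ω.g_nonneg ..)
    (by linarith [half_le_one_add_mul hη (hB.1 j x yh xh a)])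
  pi_nonneg a y x := mul_nonneg (ω.pi_nonneg ..)
    (by linarith [half_le_one_add_mul hη (hB.2.1 a y x)])
  nu_nonneg y x := mul_nonneg (ω.nu_nonneg ..)
    (by linarith [half_le_one_add_mul hη (hB.2.2 y x)])
  g_normalized j yh xh a := lintegral_ofReal_mul_one_add (ω.g_section_measurable j yh xh a)
    (fun _ => ω.g_nonneg ..) (ω.g_normalized j yh xh a) (b.g_section_measurable j yh xh a)
    (fun _ => hB.1 ..) (b.g_centred j yh xh a) hη
  pi_normalized y x := lintegral_ofReal_mul_one_add (ω.pi_section_measurable y x)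
    (fun _ => ω.pi_nonneg ..) (ω.pi_normalized y x) (b.pi_section_measurable y x)
    (fun _ => hB.2.1 ..) (b.pi_centred y x) hη
  nu_normalized := lintegral_ofReal_mul_one_add ω.nu_measurable
    (fun _ => ω.nu_nonneg ..) ω.nu_normalized b.nu_measurable
    (fun _ => hB.2.2 ..) b.nu_centred hη
  g_support j x yh xh a := by
    rw [← ω.g_support, mul_pos_iff_of_pos_right]
    linarith [half_le_one_add_mul hη (hB.1 j x yh xh a)]
  pi_support a y x := by
    rw [← ω.pi_support, mul_pos_iff_of_pos_right]
    linarith [half_le_one_add_mul hη (hB.2.1 a y x)]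
  nu_support y x := by
    rw [← ω.nu_support, mul_pos_iff_of_pos_right]
    linarith [half_le_one_add_mul hη (hB.2.2 y x)]

theorem fullDensity_perturb (θ : Vec K) (η B : ℝ) (hη hB) (z : Obs n 𝒴 𝒳 × 𝒜) :
    M.fullDensity θ (b.perturb η B hη hB) z = M.fullDensity θ ω z *
      ((∏ j : Fin n, (1 + η * b.g j (z.1.2 j.succ)
        (fun i : Fin (j + 2) => z.1.1 (Fin.castLE (by omega) i))
        (fun i : Fin (j + 1) => z.1.2 (Fin.castLE (by omega) i)) z.2)) *
      (1 + η * b.pi z.2 (z.1.1 0) (z.1.2 0)) * (1 + η * b.nu (z.1.1 0) (z.1.2 0))) := by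
  simp only [PanelModel.fullDensity, perturb, Finset.prod_mul_distrib]
  ring

/-- Every bounded direction is the derivative of a path of nuisance parameters, along which the
density is multiplied by weights with a uniform quadratic remainder. -/
theorem exists_path : ∃ (path : ℝ → Nuisance M) (w : ℝ → Obs n 𝒴 𝒳 × 𝒜 → ℝ) (C δ : ℝ),
    0 < δ ∧ path 0 = ω ∧ (∀ η, Measurable (w η)) ∧
    (∀ θ η z, M.fullDensity θ (path η) z = M.fullDensity θ ω z * w η z) ∧
    ∀ η z, |η| ≤ δ → |w η z - 1 - η * b.toFun z| ≤ C * η ^ 2 := by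
  classical
  obtain ⟨B, hB⟩ := b.bounded
  obtain ⟨C, hC⟩ := exists_abs_prod_one_add_sub_le (Finset.univ : Finset (Fin n)) B
  let W : ℝ → Obs n 𝒴 𝒳 × 𝒜 → ℝ := fun η z => ((∏ j : Fin n, (1 + η * b.g j (z.1.2 j.succ)
        (fun i : Fin (j + 2) => z.1.1 (Fin.castLE (by omega) i))
        (fun i : Fin (j + 1) => z.1.2 (Fin.castLE (by omega) i)) z.2)) *
      (1 + η * b.pi z.2 (z.1.1 0) (z.1.2 0)) * (1 + η * b.nu (z.1.1 0) (z.1.2 0)))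
  have hW : ∀ η, Measurable (W η) := by
    intro η
    refine (Measurable.mul ?_ ?_).mul ?_
    · refine Finset.measurable_prod _ fun j _ => ?_
      exact (((b.g_measurable j).comp
        (f := fun z : Obs n 𝒴 𝒳 × 𝒜 => (z.1.2 j.succ,
          (fun i : Fin (j + 2) => z.1.1 (Fin.castLE (by omega) i)),
          (fun i : Fin (j + 1) => z.1.2 (Fin.castLE (by omega) i)), z.2))
        (by fun_prop)).const_mul η).const_add 1
    · exact ((b.pi_measurable.comp
        (f := fun z : Obs n 𝒴 𝒳 × 𝒜 => (z.2, z.1.1 0, z.1.2 0)) (by fun_prop)).const_mul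
          η).const_add 1
    · exact ((b.nu_measurable.comp
        (f := fun z : Obs n 𝒴 𝒳 × 𝒜 => (z.1.1 0, z.1.2 0)) (by fun_prop)).const_mul
          η).const_add 1
  -- Where `|η| * B` exceeds `1 / 2` the path rests at `ω` with weight one, so it stays in the
  -- nuisance space for every real `η`. The remainder constant comes from two uses of
  -- `abs_mul_one_add_sub_le`, for the `π` and the `ν` factor; `δ` secures `|η| ≤ 1` and `|η| * B ≤
  -- 1 / 2`.
  refine ⟨fun η => if h : |η| * B ≤ 1 / 2 then b.perturb η B h hB else ω,
    fun η => if |η| * B ≤ 1 / 2 then W η else 1,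
    B * (∑ _j : Fin n, B + B) + (B * (∑ _j : Fin n, B) + C + C * B) +
      (B * (∑ _j : Fin n, B) + C + C * B) * B,
    min 1 (1 / 2 / (|B| + 1)), by positivity, ?_, ?_, ?_, ?_⟩
  · have h0 : |(0 : ℝ)| * B ≤ 1 / 2 := by simp
    beta_reduce
    rw [dif_pos h0]
    ext <;> simp [perturb]
  · intro η
    beta_reduce
    split_ifs
    · exact hW η
    · exact measurable_one
  · intro θ η z
    by_cases h : |η| * B ≤ 1 / 2
    · simp only [dif_pos h, if_pos h]
      exact b.fullDensity_perturb θ η B h hB z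
    · simp only [dif_neg h, if_neg h, Pi.one_apply, mul_one]
  · intro η z hη
    have hη1 : |η| ≤ 1 := hη.trans (min_le_left _ _)
    have hη2 : |η| * B ≤ 1 / 2 := by
      have h1 : |η| * (|B| + 1) ≤ 1 / 2 := by
        rw [← le_div_iff₀ (by positivity)]
        exact hη.trans (min_le_right _ _)
      nlinarith [abs_nonneg η, le_abs_self B]
    simp only [if_pos hη2]
    have hS : |∑ j : Fin n, b.g j (z.1.2 j.succ)
        (fun i : Fin (j + 2) => z.1.1 (Fin.castLE (by omega) i))
        (fun i : Fin (j + 1) => z.1.2 (Fin.castLE (by omega) i)) z.2| ≤ ∑ _j : Fin n, B :=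
      (Finset.abs_sum_le_sum_abs _ _).trans (Finset.sum_le_sum fun _ _ => hB.1 ..)
    have hS2 := (abs_add_le _ _).trans (add_le_add hS (hB.2.1 z.2 (z.1.1 0) (z.1.2 0)))
    exact abs_mul_one_add_sub_le hη1 (hB.2.2 _ _) hS2 (abs_mul_one_add_sub_le hη1 (hB.2.1 _ _ _) hS
      (hC _ η (fun j => hB.1 ..) hη1))

end Direction

end Nuisance

/-! ### Truncated density ratios -/

section TruncRatio

variable {X H : Type*} [MeasurableSpace X] [MeasurableSpace H]

/-- The ratio of two conditional densities, truncated at `m`. -/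
def truncRatio (p q : X → H → ℝ) (m : ℕ) (x : X) (h : H) : ℝ := min (q x h / p x h) m

/-- The mean of the truncated density ratio under the density in the denominator. -/
def truncMean (μ : Measure X) (p q : X → H → ℝ) (m : ℕ) (h : H) : ℝ :=
  ∫ x, p x h * truncRatio p q m x h ∂μ

variable {μ : Measure X} {p q : X → H → ℝ}
  (hp : Measurable (Function.uncurry p)) (hq : Measurable (Function.uncurry q))
  (hp0 : ∀ x h, 0 ≤ p x h) (hq0 : ∀ x h, 0 ≤ q x h)
  (hp1 : ∀ h, ∫⁻ x, ENNReal.ofReal (p x h) ∂μ = 1)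
  (hq1 : ∀ h, ∫⁻ x, ENNReal.ofReal (q x h) ∂μ = 1)

include hp hq in
theorem measurable_truncRatio (m : ℕ) : Measurable (Function.uncurry (truncRatio p q m)) :=
  (hq.div hp).min measurable_const

omit [MeasurableSpace X] [MeasurableSpace H] in
include hp0 hq0 in
theorem truncRatio_nonneg (m : ℕ) (x : X) (h : H) : 0 ≤ truncRatio p q m x h :=
  le_min (div_nonneg (hq0 x h) (hp0 x h)) m.cast_nonneg

omit [MeasurableSpace X] [MeasurableSpace H] in
theorem truncRatio_le (m : ℕ) (x : X) (h : H) : truncRatio p q m x h ≤ m := min_le_right _ _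

omit [MeasurableSpace X] [MeasurableSpace H] in
theorem truncRatio_le_div (m : ℕ) (x : X) (h : H) : truncRatio p q m x h ≤ q x h / p x h :=
  min_le_left _ _

omit [MeasurableSpace X] [MeasurableSpace H] in
theorem tendsto_truncRatio (x : X) (h : H) :
    Tendsto (fun m => truncRatio p q m x h) atTop (𝓝 (q x h / p x h)) := by
  refine tendsto_const_nhds.congr' ?_
  obtain ⟨N, hN⟩ := exists_nat_ge (q x h / p x h)
  filter_upwards [eventually_ge_atTop N] with m hm
  exact (min_eq_left (hN.trans (Nat.cast_le.2 hm))).symm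

include hp hq in
theorem measurable_truncMean [SFinite μ] (m : ℕ) : Measurable (truncMean μ p q m) := by
  have h1 : Measurable fun r : H × X => p r.2 r.1 * truncRatio p q m r.2 r.1 :=
    (hp.comp measurable_swap).mul ((measurable_truncRatio hp hq m).comp measurable_swap)
  exact h1.stronglyMeasurable.integral_prod_right'.measurable

omit [MeasurableSpace H] in
include hp0 hq0 in
theorem truncMean_nonneg (m : ℕ) (h : H) : 0 ≤ truncMean μ p q m h :=
  integral_nonneg fun x => mul_nonneg (hp0 x h) (truncRatio_nonneg hp0 hq0 m x h)

omit [MeasurableSpace X] [MeasurableSpace H] in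
include hp0 hq0 in
theorem mul_truncRatio_le (m : ℕ) (x : X) (h : H) : p x h * truncRatio p q m x h ≤ q x h := by
  rcases (hp0 x h).eq_or_lt with h0 | h0
  · rw [← h0, zero_mul]
    exact hq0 x h
  · calc p x h * truncRatio p q m x h ≤ p x h * (q x h / p x h) := by
          gcongr; exact truncRatio_le_div m x h
      _ = q x h := mul_div_cancel₀ _ h0.ne'

include hq hq0 hq1 in
theorem integrable_section_of_normalized (h : H) : Integrable (fun x => q x h) μ :=
  integrable_of_lintegral_ofReal_eq_one (hq.comp (measurable_prodMk_right (y := h)))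
    (fun x => hq0 x h) (hq1 h)

include hp hq hp0 hq0 hq1 in
theorem integrable_mul_truncRatio (m : ℕ) (h : H) :
    Integrable (fun x => p x h * truncRatio p q m x h) μ := by
  refine (integrable_section_of_normalized hq hq0 hq1 h).mono'
    ((hp.comp (measurable_prodMk_right (y := h))).mul
      ((measurable_truncRatio hp hq m).comp
        (measurable_prodMk_right (y := h)))).aestronglyMeasurable (.of_forall fun x => ?_)
  rw [Real.norm_of_nonneg (mul_nonneg (hp0 x h) (truncRatio_nonneg hp0 hq0 m x h))]
  exact mul_truncRatio_le hp0 hq0 m x h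

include hp hq hp0 hq0 hq1 in
theorem truncMean_le_one (m : ℕ) (h : H) : truncMean μ p q m h ≤ 1 := by
  rw [← integral_eq_one_of_lintegral_ofReal_eq_one (p := fun x => q x h)
    (hq.comp (measurable_prodMk_right (y := h))) (fun x => hq0 x h) (hq1 h)]
  exact integral_mono (integrable_mul_truncRatio hp hq hp0 hq0 hq1 m h)
    (integrable_section_of_normalized hq hq0 hq1 h) fun x => mul_truncRatio_le hp0 hq0 m x h

include hp hq hp0 hq0 hq1 in
-- Dominated convergence with dominating function `q`. The support condition gives `p * (q / p) = q`
-- even where `p = 0`, so the limit is the total mass of `q`.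
theorem tendsto_truncMean (hsupp : ∀ x h, p x h = 0 → q x h = 0) (h : H) :
    Tendsto (fun m => truncMean μ p q m h) atTop (𝓝 1) := by
  rw [← integral_eq_one_of_lintegral_ofReal_eq_one (p := fun x => q x h)
    (hq.comp (measurable_prodMk_right (y := h))) (fun x => hq0 x h) (hq1 h)]
  refine tendsto_integral_of_dominated_convergence (fun x => q x h)
    (fun m => (integrable_mul_truncRatio hp hq hp0 hq0 hq1 m h).1)
    (integrable_section_of_normalized hq hq0 hq1 h) (fun m => .of_forall fun x => ?_)
    (.of_forall fun x => ?_)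
  · rw [Real.norm_of_nonneg (mul_nonneg (hp0 x h) (truncRatio_nonneg hp0 hq0 m x h))]
    exact mul_truncRatio_le hp0 hq0 m x h
  · have h1 := (tendsto_truncRatio (p := p) (q := q) x h).const_mul (p x h)
    have h2 : p x h * (q x h / p x h) = q x h := by
      by_cases h0 : p x h = 0
      · rw [h0, zero_mul, hsupp x h h0]
      · exact mul_div_cancel₀ _ h0
    rwa [h2] at h1

include hp hq hp0 hq0 hp1 hq1 in
-- The centred truncated ratio is an admissible direction. The factor `r`, constant given the past,
-- will be a bounded function of the history.
theorem integral_mul_truncRatio_sub_truncMean (m : ℕ) (h : H) (r : ℝ) :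
    ∫ x, p x h * (r * (truncRatio p q m x h - truncMean μ p q m h)) ∂μ = 0 := by
  have he : ∀ x, p x h * (r * (truncRatio p q m x h - truncMean μ p q m h)) =
      r * (p x h * truncRatio p q m x h - p x h * truncMean μ p q m h) := fun x => by ring
  simp_rw [he]
  rw [integral_const_mul, integral_sub (integrable_mul_truncRatio hp hq hp0 hq0 hq1 m h)
    ((integrable_section_of_normalized hp hp0 hp1 h).mul_const _), integral_mul_const,
    integral_eq_one_of_lintegral_ofReal_eq_one (p := fun x => p x h)
    (hp.comp (measurable_prodMk_right (y := h))) (fun x => hp0 x h) (hp1 h), one_mul]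
  rw [truncMean, sub_self, mul_zero]

include hp hq hp0 hq0 hq1 in
theorem abs_truncRatio_sub_truncMean_le (m : ℕ) (x : X) (h : H) :
    |truncRatio p q m x h - truncMean μ p q m h| ≤ m + 1 := by
  have h1 := truncRatio_nonneg hp0 hq0 m x h
  have h2 := truncRatio_le (p := p) (q := q) m x h
  have h3 := truncMean_nonneg (μ := μ) hp0 hq0 m h
  have h4 := truncMean_le_one hp hq hp0 hq0 hq1 m h
  rw [abs_le]
  constructor <;> linarith

end TruncRatio

/-- If truncating a factor `ρ` of the integrand at `m` has the effect of replacing it by weights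
`c m ∈ [0, 1]` which tend to one, then the factor integrates out. -/
theorem integral_eq_of_truncation {Z : Type*} [MeasurableSpace Z] {P : Measure Z}
    {F ρ Q : Z → ℝ} {c : ℕ → Z → ℝ} (hF : Integrable F P)
    (hFQ : Integrable (fun z => F z * (ρ z * Q z)) P) (hρ : Measurable ρ) (hQ : Measurable Q)
    (hρ0 : ∀ z, 0 ≤ ρ z) (hc : ∀ m, Measurable (c m)) (hc0 : ∀ m z, 0 ≤ c m z)
    (hc1 : ∀ m z, c m z ≤ 1) (hclim : ∀ z, Tendsto (fun m => c m z) atTop (𝓝 1))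
    (hI : ∀ m : ℕ, ∫ z, F z * (min (ρ z) m * Q z) ∂P = ∫ z, F z * c m z ∂P) :
    ∫ z, F z * (ρ z * Q z) ∂P = ∫ z, F z ∂P := by
  have h1 : Tendsto (fun m : ℕ => ∫ z, F z * (min (ρ z) m * Q z) ∂P) atTop
      (𝓝 (∫ z, F z * (ρ z * Q z) ∂P)) := by
    refine tendsto_integral_of_dominated_convergence (fun z => ‖F z * (ρ z * Q z)‖)
      (fun m => hF.1.mul ((hρ.min measurable_const).mul hQ).aestronglyMeasurable) hFQ.norm
      (fun m => .of_forall fun z => ?_) (.of_forall fun z => ?_)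
    · simp only [norm_mul, Real.norm_eq_abs]
      rw [abs_of_nonneg (le_min (hρ0 z) m.cast_nonneg), abs_of_nonneg (hρ0 z)]
      gcongr
      exact min_le_left _ _
    · refine tendsto_const_nhds.congr' ?_
      obtain ⟨N, hN⟩ := exists_nat_ge (ρ z)
      filter_upwards [eventually_ge_atTop N] with m hm
      rw [min_eq_left (hN.trans (Nat.cast_le.2 hm))]
  have h2 : Tendsto (fun m : ℕ => ∫ z, F z * c m z ∂P) atTop (𝓝 (∫ z, F z ∂P)) := by
    refine tendsto_integral_of_dominated_convergence (fun z => ‖F z‖)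
      (fun m => hF.1.mul (hc m).aestronglyMeasurable) hF.norm
      (fun m => .of_forall fun z => ?_) (.of_forall fun z => ?_)
    · rw [norm_mul, Real.norm_of_nonneg (hc0 m z)]
      exact mul_le_of_le_one_right (norm_nonneg _) (hc1 m z)
    · simpa using (hclim z).const_mul (F z)
  exact tendsto_nhds_unique (h1.congr hI) h2

/-! ### Removing likelihood ratios by orthogonality to bounded directions -/

namespace Nuisance

variable {M : PanelModel n K 𝒴 𝒳 𝒜}

namespace Direction

variable {ω : Nuisance M}

/-- A direction which perturbs the feedback process of a single period. -/
def ofG (j : Fin n) (b : 𝒳 → (Fin (j + 2) → 𝒴) × (Fin (j + 1) → 𝒳) × 𝒜 → ℝ)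
    (hb : Measurable (Function.uncurry b)) {B : ℝ} (hB : ∀ x h, |b x h| ≤ B)
    (hc : ∀ h, ∫ x, ω.g j x h.1 h.2.1 h.2.2 * b x h ∂(M.refX j.succ) = 0) : ω.Direction where
  g := Pi.single j fun x yh xh a => b x (yh, xh, a)
  pi _ _ _ := 0
  nu _ _ := 0
  g_measurable i := by
    rcases eq_or_ne i j with rfl | hij
    · simp only [Pi.single_eq_same]
      exact hb
    · simp only [Pi.single_eq_of_ne hij]
      exact measurable_const
  pi_measurable := measurable_const
  nu_measurable := measurable_const
  bounded := by
    refine ⟨max B 0, fun i x yh xh a => ?_, fun a y x => by simp, fun y x => by simp⟩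
    rcases eq_or_ne i j with rfl | hij
    · simp only [Pi.single_eq_same]
      exact (hB _ _).trans (le_max_left _ _)
    · simp [Pi.single_eq_of_ne hij]
  g_centred i yh xh a := by
    rcases eq_or_ne i j with rfl | hij
    · simp only [Pi.single_eq_same]
      exact hc (yh, xh, a)
    · simp [Pi.single_eq_of_ne hij]
  pi_centred := by simp
  nu_centred := by simp

theorem ofG_toFun (j : Fin n) (b : 𝒳 → (Fin (j + 2) → 𝒴) × (Fin (j + 1) → 𝒳) × 𝒜 → ℝ)
    (hb) {B : ℝ} (hB : ∀ x h, |b x h| ≤ B) (hc) (z : Obs n 𝒴 𝒳 × 𝒜) :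
    (ofG (ω := ω) j b hb hB hc).toFun z = b (z.1.2 j.succ)
      (fun i : Fin (j + 2) => z.1.1 (Fin.castLE (by omega) i),
        fun i : Fin (j + 1) => z.1.2 (Fin.castLE (by omega) i), z.2) := by
  simp only [toFun, ofG, add_zero]
  rw [Finset.sum_eq_single j]
  · rw [Pi.single_eq_same]
  · intro i _ hij
    rw [Pi.single_eq_of_ne hij]
    rfl
  · simp

/-- A direction which perturbs the distribution of the heterogeneity. -/
def ofPi (b : 𝒜 → 𝒴 × 𝒳 → ℝ) (hb : Measurable (Function.uncurry b)) {B : ℝ}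
    (hB : ∀ a h, |b a h| ≤ B) (hc : ∀ h, ∫ a, ω.pi a h.1 h.2 * b a h ∂M.refA = 0) :
    ω.Direction where
  g _ _ _ _ _ := 0
  pi a y x := b a (y, x)
  nu _ _ := 0
  g_measurable _ := measurable_const
  pi_measurable := hb
  nu_measurable := measurable_const
  bounded := ⟨max B 0, by simp, fun a y x => (hB _ _).trans (le_max_left _ _), by simp⟩
  g_centred := by simp
  pi_centred y x := hc (y, x)
  nu_centred := by simp

/-- A direction which perturbs the distribution of the initial condition. -/
def ofNu (b : 𝒴 × 𝒳 → ℝ) (hb : Measurable b) {B : ℝ} (hB : ∀ q, |b q| ≤ B)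
    (hc : ∫ q, ω.nu q.1 q.2 * b q ∂((M.refY 0).prod (M.refX 0)) = 0) : ω.Direction where
  g _ _ _ _ _ := 0
  pi _ _ _ := 0
  nu y x := b (y, x)
  g_measurable _ := measurable_const
  pi_measurable := measurable_const
  nu_measurable := hb
  bounded := ⟨max B 0, by simp, by simp, fun y x => (hB _).trans (le_max_left _ _)⟩
  g_centred := by simp
  pi_centred := by simp
  nu_centred := hc

end Direction

theorem g_eq_zero (ω ω' : Nuisance M) {j : Fin n} {x yh xh a} (h : ω.g j x yh xh a = 0) :
    ω'.g j x yh xh a = 0 := by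
  refine le_antisymm (not_lt.1 fun hpos => ?_) (ω'.g_nonneg ..)
  exact ((ω.g_support ..).2 ((ω'.g_support ..).1 hpos)).ne' h

theorem pi_eq_zero (ω ω' : Nuisance M) {a y x} (h : ω.pi a y x = 0) : ω'.pi a y x = 0 := by
  refine le_antisymm (not_lt.1 fun hpos => ?_) (ω'.pi_nonneg ..)
  exact ((ω.pi_support ..).2 ((ω'.pi_support ..).1 hpos)).ne' h

theorem nu_eq_zero (ω ω' : Nuisance M) {y x} (h : ω.nu y x = 0) : ω'.nu y x = 0 := by
  refine le_antisymm (not_lt.1 fun hpos => ?_) (ω'.nu_nonneg ..)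
  exact ((ω.nu_support ..).2 ((ω'.nu_support ..).1 hpos)).ne' h

/-- The history of the outcomes up to period `k + 1` and of the regressors up to period `k + 1`,
together with the heterogeneity. -/
def history {k : ℕ} (hk : k ≤ n) (z : Obs n 𝒴 𝒳 × 𝒜) :
    (Fin (k + 2) → 𝒴) × (Fin (k + 1) → 𝒳) × 𝒜 :=
  (fun i => z.1.1 (Fin.castLE (by omega) i), fun i => z.1.2 (Fin.castLE (by omega) i), z.2)

theorem measurable_history {k : ℕ} (hk : k ≤ n) :
    Measurable (history hk : Obs n 𝒴 𝒳 × 𝒜 → _) := by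
  unfold history; fun_prop

/-- The ratio of the feedback densities of a given period at two nuisance parameters. -/
def gRatio (ω ω' : Nuisance M) (j : Fin n) (z : Obs n 𝒴 𝒳 × 𝒜) : ℝ :=
  ω'.g j (z.1.2 j.succ) (fun i : Fin (j + 2) => z.1.1 (Fin.castLE (by omega) i))
      (fun i : Fin (j + 1) => z.1.2 (Fin.castLE (by omega) i)) z.2 /
    ω.g j (z.1.2 j.succ) (fun i : Fin (j + 2) => z.1.1 (Fin.castLE (by omega) i))
      (fun i : Fin (j + 1) => z.1.2 (Fin.castLE (by omega) i)) z.2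

/-- The product of the ratios of the feedback densities from a given period on. -/
def gRatioFrom (ω ω' : Nuisance M) (k : ℕ) (z : Obs n 𝒴 𝒳 × 𝒜) : ℝ :=
  ∏ j ∈ Finset.univ.filter (fun j : Fin n => k ≤ j), gRatio ω ω' j z

theorem gRatio_nonneg (ω ω' : Nuisance M) (j : Fin n) (z : Obs n 𝒴 𝒳 × 𝒜) :
    0 ≤ gRatio ω ω' j z := div_nonneg (ω'.g_nonneg ..) (ω.g_nonneg ..)

theorem measurable_gRatio (ω ω' : Nuisance M) (j : Fin n) : Measurable (gRatio ω ω' j) := by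
  have h : Measurable fun z : Obs n 𝒴 𝒳 × 𝒜 => (z.1.2 j.succ,
        (fun i : Fin (j + 2) => z.1.1 (Fin.castLE (by omega) i)),
        (fun i : Fin (j + 1) => z.1.2 (Fin.castLE (by omega) i)), z.2) := by fun_prop
  exact ((ω'.g_measurable j).comp h).div ((ω.g_measurable j).comp h)

theorem measurable_gRatioFrom (ω ω' : Nuisance M) (k : ℕ) : Measurable (gRatioFrom ω ω' k) :=
  Finset.measurable_prod _ fun j _ => measurable_gRatio ω ω' j

theorem gRatioFrom_of_lt (ω ω' : Nuisance M) {k : ℕ} (hk : k < n) (z : Obs n 𝒴 𝒳 × 𝒜) :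
    gRatioFrom ω ω' k z = gRatio ω ω' ⟨k, hk⟩ z * gRatioFrom ω ω' (k + 1) z := by
  have h : Finset.univ.filter (fun j : Fin n => k ≤ j) =
      insert ⟨k, hk⟩ (Finset.univ.filter (fun j : Fin n => k + 1 ≤ j)) := by
    ext j
    simp only [Finset.mem_filter, Finset.mem_univ, true_and, Finset.mem_insert, Fin.ext_iff]
    omega
  rw [gRatioFrom, h, Finset.prod_insert (by simp), gRatioFrom]

theorem gRatioFrom_self (ω ω' : Nuisance M) (z : Obs n 𝒴 𝒳 × 𝒜) : gRatioFrom ω ω' n z = 1 := by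
  rw [gRatioFrom, Finset.filter_false_of_mem fun j _ => by omega, Finset.prod_empty]

variable {ω : Nuisance M} (ω' : Nuisance M) {P : Measure (Obs n 𝒴 𝒳 × 𝒜)}
  {ϕ : Obs n 𝒴 𝒳 × 𝒜 → ℝ} (hϕ : Integrable ϕ P)
  (horth : ∀ b : ω.Direction, ∫ z, ϕ z * b.toFun z ∂P = 0)
include hϕ horth

/-- Induction on the number `m` of remaining ratios. Once the earliest ratio is truncated, its
product with `R` is a bounded function of the next history, so the induction hypothesis removes all
later ratios. A feedback direction then replaces the truncated ratio by its conditional mean, and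
truncation is lifted by `integral_eq_of_truncation`. Quantifying over all bounded `R` is what makes
the induction close. -/
theorem integral_mul_gRatioFrom : ∀ (m k : ℕ) (hk : k + m = n)
    (R : (Fin (k + 2) → 𝒴) × (Fin (k + 1) → 𝒳) × 𝒜 → ℝ) (_ : Measurable R) (C : ℝ)
    (_ : ∀ h, |R h| ≤ C)
    (_ : Integrable (fun z => ϕ z * R (history (by omega : k ≤ n) z) * gRatioFrom ω ω' k z) P),
    ∫ z, ϕ z * R (history (by omega : k ≤ n) z) * gRatioFrom ω ω' k z ∂P =
      ∫ z, ϕ z * R (history (by omega : k ≤ n) z) ∂P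
  | 0, k, hk, R, hR, C, hC, hint => by
    obtain rfl : k = n := hk
    simp only [gRatioFrom_self, mul_one]
  | m + 1, k, hk, R, hR, C, hC, hint => by
    have hkn : k < n := by omega
    let j : Fin n := ⟨k, hkn⟩
    let p : 𝒳 → (Fin (k + 2) → 𝒴) × (Fin (k + 1) → 𝒳) × 𝒜 → ℝ :=
      fun x h => ω.g j x h.1 h.2.1 h.2.2
    let q : 𝒳 → (Fin (k + 2) → 𝒴) × (Fin (k + 1) → 𝒳) × 𝒜 → ℝ :=
      fun x h => ω'.g j x h.1 h.2.1 h.2.2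
    have hp : Measurable (Function.uncurry p) := ω.g_measurable j
    have hq : Measurable (Function.uncurry q) := ω'.g_measurable j
    have hp0 : ∀ x h, 0 ≤ p x h := fun x h => ω.g_nonneg j x h.1 h.2.1 h.2.2
    have hq0 : ∀ x h, 0 ≤ q x h := fun x h => ω'.g_nonneg j x h.1 h.2.1 h.2.2
    have hp1 : ∀ h, ∫⁻ x, ENNReal.ofReal (p x h) ∂(M.refX j.succ) = 1 :=
      fun h => ω.g_normalized j h.1 h.2.1 h.2.2
    have hq1 : ∀ h, ∫⁻ x, ENNReal.ofReal (q x h) ∂(M.refX j.succ) = 1 :=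
      fun h => ω'.g_normalized j h.1 h.2.1 h.2.2
    have hC0 : ∀ h, 0 ≤ C := fun h => (abs_nonneg _).trans (hC h)
    have hRm : Measurable fun z : Obs n 𝒴 𝒳 × 𝒜 => R (history hkn.le z) :=
      hR.comp (measurable_history hkn.le)
    have hF : Integrable (fun z => ϕ z * R (history hkn.le z)) P :=
      hϕ.mul_bdd hRm.aestronglyMeasurable (.of_forall fun z => hC _)
    have hint' : Integrable (fun z => ϕ z * R (history hkn.le z) *
        (gRatio ω ω' j z * gRatioFrom ω ω' (k + 1) z)) P := by
      simpa only [gRatioFrom_of_lt ω ω' hkn] using hint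
    simp only [gRatioFrom_of_lt ω ω' hkn]
    refine integral_eq_of_truncation (c := fun m z => truncMean (M.refX j.succ) p q m
      (history hkn.le z)) hF hint' (measurable_gRatio ω ω' j) (measurable_gRatioFrom ω ω' _)
      (gRatio_nonneg ω ω' j)
      (fun m => (measurable_truncMean hp hq m).comp (measurable_history hkn.le))
      (fun m z => truncMean_nonneg hp0 hq0 m _) (fun m z => truncMean_le_one hp hq hp0 hq0 hq1 m _)
      (fun z => tendsto_truncMean hp hq hp0 hq0 hq1 (fun x h h0 => g_eq_zero ω ω' h0) _)
      fun N => ?_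
    -- the truncated ratio as a function of the next history
    let restr : (Fin (k + 3) → 𝒴) × (Fin (k + 2) → 𝒳) × 𝒜 →
        (Fin (k + 2) → 𝒴) × (Fin (k + 1) → 𝒳) × 𝒜 :=
      fun h => (fun i => h.1 (Fin.castLE (by omega) i), fun i => h.2.1 (Fin.castLE (by omega) i),
        h.2.2)
    have hrestr : Measurable restr := by fun_prop
    let R' : (Fin (k + 3) → 𝒴) × (Fin (k + 2) → 𝒳) × 𝒜 → ℝ :=
      fun h => R (restr h) * truncRatio p q N (h.2.1 (Fin.last _)) (restr h)
    have htm : Measurable fun h : (Fin (k + 3) → 𝒴) × (Fin (k + 2) → 𝒳) × 𝒜 =>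
        truncRatio p q N (h.2.1 (Fin.last _)) (restr h) :=
      (measurable_truncRatio hp hq N).comp
        (f := fun h : (Fin (k + 3) → 𝒴) × (Fin (k + 2) → 𝒳) × 𝒜 => (h.2.1 (Fin.last _), restr h))
        (by fun_prop)
    have hR' : Measurable R' := (hR.comp hrestr).mul htm
    have hbd : ∀ h, |R' h| ≤ C * N := by
      intro h
      rw [abs_mul, abs_of_nonneg (truncRatio_nonneg hp0 hq0 N _ _)]
      have := truncRatio_nonneg hp0 hq0 N (h.2.1 (Fin.last _)) (restr h)
      have := hC0 (restr h)
      exact mul_le_mul (hC _) (truncRatio_le N _ _) (by assumption) (by assumption)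
    -- True by `rfl`: restricting the next history gives the current one, and its last regressor is
    -- the argument at which the current feedback density is evaluated.
    have heq : ∀ z, R' (history (by omega : k + 1 ≤ n) z) =
        R (history hkn.le z) * min (gRatio ω ω' j z) N := fun z => rfl
    have hmin0 : ∀ z, 0 ≤ min (gRatio ω ω' j z) N :=
      fun z => le_min (gRatio_nonneg ω ω' j z) N.cast_nonneg
    have hmin : Measurable fun z : Obs n 𝒴 𝒳 × 𝒜 => min (gRatio ω ω' j z) N :=
      (measurable_gRatio ω ω' j).min measurable_const
    -- Integrability is inherited, since truncation can only decrease the absolute value of the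
    -- integrand.
    have ih := integral_mul_gRatioFrom m (k + 1) (by omega) R' hR' (C * N) hbd (by
      refine hint'.mono ?_ (.of_forall fun z => ?_)
      · simp only [heq]
        exact (hϕ.1.mul (hRm.mul hmin).aestronglyMeasurable).mul
          (measurable_gRatioFrom ω ω' _).aestronglyMeasurable
      · simp only [heq, norm_mul, Real.norm_eq_abs]
        rw [abs_of_nonneg (hmin0 z), abs_of_nonneg (gRatio_nonneg ω ω' j z)]
        have : min (gRatio ω ω' j z) N ≤ gRatio ω ω' j z := min_le_left _ _
        calc _ = |ϕ z| * |R (history hkn.le z)| * (min (gRatio ω ω' j z) N *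
              |gRatioFrom ω ω' (k + 1) z|) := by ring
          _ ≤ _ := by gcongr)
    simp only [heq] at ih
    -- Multiplying by `R`, a function of the history alone, preserves conditional centring. In the
    -- bound `C * (N + 1)`, `N` bounds the truncated ratio and `1` its mean.
    let b : ω.Direction := Direction.ofG j
      (fun x h => R h * (truncRatio p q N x h - truncMean (M.refX j.succ) p q N h))
      ((hR.comp measurable_snd).mul ((measurable_truncRatio hp hq N).sub
        ((measurable_truncMean hp hq N).comp measurable_snd)))
      (B := C * (N + 1))
      (fun x h => by
        rw [abs_mul]
        have := hC0 h
        gcongr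
        · exact hC h
        · exact abs_truncRatio_sub_truncMean_le hp hq hp0 hq0 hq1 N x h)
      (fun h => integral_mul_truncRatio_sub_truncMean hp hq hp0 hq0 hp1 hq1 N h (R h))
    have hdir' : ∫ z, (ϕ z * R (history hkn.le z) * min (gRatio ω ω' j z) N -
        ϕ z * R (history hkn.le z) * truncMean (M.refX j.succ) p q N (history hkn.le z)) ∂P = 0 := by
      rw [← horth b]
      refine integral_congr_ae (.of_forall fun z => ?_)
      have hb : b.toFun z = R (history hkn.le z) * (min (gRatio ω ω' j z) N -
        truncMean (M.refX j.succ) p q N (history hkn.le z)) := Direction.ofG_toFun ..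
      simp only [hb]
      ring
    rw [integral_sub] at hdir'
    · rw [← sub_eq_zero, ← hdir']
      congr 1
      simp only [← mul_assoc] at ih ⊢
      exact ih
    · exact hF.mul_bdd (c := N) hmin.aestronglyMeasurable (.of_forall fun z => by
        rw [Real.norm_of_nonneg (hmin0 z)]; exact min_le_right _ _)
    · exact hF.mul_bdd (c := 1) ((measurable_truncMean hp hq N).comp
        (measurable_history hkn.le)).aestronglyMeasurable (.of_forall fun z => by
        rw [Real.norm_of_nonneg (truncMean_nonneg hp0 hq0 N _)]
        exact truncMean_le_one hp hq hp0 hq0 hq1 N _)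


/-- The same exchange one level up. The truncated `π` ratio times `S` is a bounded function of the
first history, so `integral_mul_gRatioFrom` at `k = 0` disposes of the feedback ratios, and a `π`
direction does the rest. -/
theorem integral_mul_piRatio (S : 𝒴 × 𝒳 → ℝ) (hS : Measurable S) {C : ℝ} (hC : ∀ h, |S h| ≤ C)
    (hint : Integrable (fun z => ϕ z * S (z.1.1 0, z.1.2 0) *
      (ω'.pi z.2 (z.1.1 0) (z.1.2 0) / ω.pi z.2 (z.1.1 0) (z.1.2 0) * gRatioFrom ω ω' 0 z)) P) :
    ∫ z, ϕ z * S (z.1.1 0, z.1.2 0) *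
      (ω'.pi z.2 (z.1.1 0) (z.1.2 0) / ω.pi z.2 (z.1.1 0) (z.1.2 0) * gRatioFrom ω ω' 0 z) ∂P =
    ∫ z, ϕ z * S (z.1.1 0, z.1.2 0) ∂P := by
  have h00 : Measurable fun z : Obs n 𝒴 𝒳 × 𝒜 => (z.1.1 0, z.1.2 0) := by fun_prop
  have ha00 : Measurable fun z : Obs n 𝒴 𝒳 × 𝒜 => (z.2, z.1.1 0, z.1.2 0) := by fun_prop
  have hpim : Measurable fun z : Obs n 𝒴 𝒳 × 𝒜 =>
      ω'.pi z.2 (z.1.1 0) (z.1.2 0) / ω.pi z.2 (z.1.1 0) (z.1.2 0) :=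
    (ω'.pi_measurable.comp ha00).div (ω.pi_measurable.comp ha00)
  let p : 𝒜 → 𝒴 × 𝒳 → ℝ := fun a h => ω.pi a h.1 h.2
  let q : 𝒜 → 𝒴 × 𝒳 → ℝ := fun a h => ω'.pi a h.1 h.2
  have hp : Measurable (Function.uncurry p) := ω.pi_measurable
  have hq : Measurable (Function.uncurry q) := ω'.pi_measurable
  have hp0 : ∀ x h, 0 ≤ p x h := fun x h => ω.pi_nonneg ..
  have hq0 : ∀ x h, 0 ≤ q x h := fun x h => ω'.pi_nonneg ..
  have hp1 : ∀ h, ∫⁻ x, ENNReal.ofReal (p x h) ∂M.refA = 1 := fun h => ω.pi_normalized ..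
  have hq1 : ∀ h, ∫⁻ x, ENNReal.ofReal (q x h) ∂M.refA = 1 := fun h => ω'.pi_normalized ..
  have hF : Integrable (fun z => ϕ z * S (z.1.1 0, z.1.2 0)) P :=
    hϕ.mul_bdd (hS.comp h00).aestronglyMeasurable (.of_forall fun z => hC _)
  refine integral_eq_of_truncation (c := fun m z => truncMean M.refA p q m (z.1.1 0, z.1.2 0))
    hF hint hpim (measurable_gRatioFrom ω ω' 0)
    (fun z => div_nonneg (ω'.pi_nonneg ..) (ω.pi_nonneg ..))
    (fun m => (measurable_truncMean hp hq m).comp h00)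
    (fun m z => truncMean_nonneg hp0 hq0 m _) (fun m z => truncMean_le_one hp hq hp0 hq0 hq1 m _)
    (fun z => tendsto_truncMean hp hq hp0 hq0 hq1 (fun x h h0 => pi_eq_zero ω ω' h0) _) fun N => ?_
  set r : Obs n 𝒴 𝒳 × 𝒜 → ℝ :=
    fun z => min (ω'.pi z.2 (z.1.1 0) (z.1.2 0) / ω.pi z.2 (z.1.1 0) (z.1.2 0)) N with hr
  have hrm : Measurable r := hpim.min measurable_const
  have hr0 : ∀ z, 0 ≤ r z := fun z => truncRatio_nonneg hp0 hq0 N z.2 (z.1.1 0, z.1.2 0)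
  have hrN : ∀ z, r z ≤ N := fun z => min_le_right _ _
  have hC0 : ∀ h, 0 ≤ C := fun h => (abs_nonneg _).trans (hC h)
  have hFr : Integrable (fun z => ϕ z * S (z.1.1 0, z.1.2 0) * r z) P :=
    hF.mul_bdd (c := N) hrm.aestronglyMeasurable (.of_forall fun z => by
      rw [Real.norm_of_nonneg (hr0 z)]; exact hrN z)
  have hπ : ∫ z, ϕ z * S (z.1.1 0, z.1.2 0) * r z ∂P =
      ∫ z, ϕ z * S (z.1.1 0, z.1.2 0) * truncMean M.refA p q N (z.1.1 0, z.1.2 0) ∂P := by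
    let b : ω.Direction := Direction.ofPi
      (fun x h => S h * (truncRatio p q N x h - truncMean M.refA p q N h))
      ((hS.comp measurable_snd).mul ((measurable_truncRatio hp hq N).sub
        ((measurable_truncMean hp hq N).comp measurable_snd)))
      (B := C * (N + 1))
      (fun x h => by
        rw [abs_mul]
        have := hC0 h
        gcongr
        · exact hC h
        · exact abs_truncRatio_sub_truncMean_le hp hq hp0 hq0 hq1 N x h)
      (fun h => integral_mul_truncRatio_sub_truncMean hp hq hp0 hq0 hp1 hq1 N h (S h))
    have hb : ∀ z, b.toFun z = S (z.1.1 0, z.1.2 0) *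
        (r z - truncMean M.refA p q N (z.1.1 0, z.1.2 0)) := by
      intro z
      simp only [b, Direction.toFun, Direction.ofPi, Finset.sum_const_zero, zero_add, add_zero]
      rfl
    have h := horth b
    simp only [hb, mul_sub, ← mul_assoc] at h
    have hFc : Integrable (fun z => ϕ z * S (z.1.1 0, z.1.2 0) *
        truncMean M.refA p q N (z.1.1 0, z.1.2 0)) P :=
      hF.mul_bdd (c := 1) ((measurable_truncMean hp hq N).comp
        h00).aestronglyMeasurable (.of_forall fun z => by
        rw [Real.norm_of_nonneg (truncMean_nonneg hp0 hq0 N _)]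
        exact truncMean_le_one hp hq hp0 hq0 hq1 N _)
    rw [integral_sub hFr hFc] at h
    exact sub_eq_zero.1 h
  rw [← hπ]
  have key := integral_mul_gRatioFrom ω' hϕ horth n 0 (zero_add n)
    (fun h => S (h.1 0, h.2.1 0) * truncRatio p q N h.2.2 (h.1 0, h.2.1 0))
    ((hS.comp (f := fun h : (Fin 2 → 𝒴) × (Fin 1 → 𝒳) × 𝒜 => (h.1 0, h.2.1 0)) (by fun_prop)).mul
      ((measurable_truncRatio hp hq N).comp
        (f := fun h : (Fin 2 → 𝒴) × (Fin 1 → 𝒳) × 𝒜 => (h.2.2, h.1 0, h.2.1 0)) (by fun_prop)))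
    (C * N) (fun h => by
      rw [abs_mul, abs_of_nonneg (truncRatio_nonneg hp0 hq0 N _ _)]
      exact mul_le_mul (hC _) (truncRatio_le N _ _) (truncRatio_nonneg hp0 hq0 N _ _)
        (hC0 (h.1 0, h.2.1 0)))
  have he : ∀ z : Obs n 𝒴 𝒳 × 𝒜, S ((history n.zero_le z).1 0, (history n.zero_le z).2.1 0) *
      truncRatio p q N (history n.zero_le z).2.2
        ((history n.zero_le z).1 0, (history n.zero_le z).2.1 0) =
      S (z.1.1 0, z.1.2 0) * r z := fun z => rfl
  simp only [he, ← mul_assoc] at key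
  simp only [← mul_assoc]
  refine key ?_
  refine hint.mono (hFr.1.mul (measurable_gRatioFrom ω ω' 0).aestronglyMeasurable)
    (.of_forall fun z => ?_)
  rw [mul_assoc]
  simp only [norm_mul, Real.norm_eq_abs]
  rw [abs_of_nonneg (hr0 z), abs_of_nonneg
    (div_nonneg (ω'.pi_nonneg z.2 (z.1.1 0) (z.1.2 0)) (ω.pi_nonneg z.2 (z.1.1 0) (z.1.2 0)))]
  gcongr
  exact min_le_left _ _

/-- The outermost truncation: the truncated `ν` ratio serves as the bounded `S` of
`integral_mul_piRatio`. The initial condition has no past, so its conditioning variable is of type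
`Unit`. -/
theorem integral_mul_ratio :
    Integrable (fun z => ϕ z * (ω'.nu (z.1.1 0) (z.1.2 0) / ω.nu (z.1.1 0) (z.1.2 0) *
      (ω'.pi z.2 (z.1.1 0) (z.1.2 0) / ω.pi z.2 (z.1.1 0) (z.1.2 0) * gRatioFrom ω ω' 0 z))) P →
    ∫ z, ϕ z * (ω'.nu (z.1.1 0) (z.1.2 0) / ω.nu (z.1.1 0) (z.1.2 0) *
      (ω'.pi z.2 (z.1.1 0) (z.1.2 0) / ω.pi z.2 (z.1.1 0) (z.1.2 0) * gRatioFrom ω ω' 0 z)) ∂P =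
    ∫ z, ϕ z ∂P := by
  intro hint
  have h00 : Measurable fun z : Obs n 𝒴 𝒳 × 𝒜 => (z.1.1 0, z.1.2 0) := by fun_prop
  have ha00 : Measurable fun z : Obs n 𝒴 𝒳 × 𝒜 => (z.2, z.1.1 0, z.1.2 0) := by fun_prop
  have hnum : Measurable fun z : Obs n 𝒴 𝒳 × 𝒜 =>
      ω'.nu (z.1.1 0) (z.1.2 0) / ω.nu (z.1.1 0) (z.1.2 0) :=
    (ω'.nu_measurable.comp h00).div (ω.nu_measurable.comp h00)
  have hpim : Measurable fun z : Obs n 𝒴 𝒳 × 𝒜 =>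
      ω'.pi z.2 (z.1.1 0) (z.1.2 0) / ω.pi z.2 (z.1.1 0) (z.1.2 0) :=
    (ω'.pi_measurable.comp ha00).div (ω.pi_measurable.comp ha00)
  -- the initial condition
  let p : 𝒴 × 𝒳 → Unit → ℝ := fun x _ => ω.nu x.1 x.2
  let q : 𝒴 × 𝒳 → Unit → ℝ := fun x _ => ω'.nu x.1 x.2
  have hp : Measurable (Function.uncurry p) := ω.nu_measurable.comp measurable_fst
  have hq : Measurable (Function.uncurry q) := ω'.nu_measurable.comp measurable_fst
  have hp0 : ∀ x h, 0 ≤ p x h := fun x h => ω.nu_nonneg ..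
  have hq0 : ∀ x h, 0 ≤ q x h := fun x h => ω'.nu_nonneg ..
  have hp1 : ∀ h, ∫⁻ x, ENNReal.ofReal (p x h) ∂((M.refY 0).prod (M.refX 0)) = 1 :=
    fun h => ω.nu_normalized
  have hq1 : ∀ h, ∫⁻ x, ENNReal.ofReal (q x h) ∂((M.refY 0).prod (M.refX 0)) = 1 :=
    fun h => ω'.nu_normalized
  refine integral_eq_of_truncation (c := fun m z => truncMean ((M.refY 0).prod (M.refX 0)) p q m ())
    hϕ hint hnum (hpim.mul (measurable_gRatioFrom ω ω' 0))
    (fun z => div_nonneg (ω'.nu_nonneg ..) (ω.nu_nonneg ..)) (fun m => measurable_const)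
    (fun m z => truncMean_nonneg hp0 hq0 m _) (fun m z => truncMean_le_one hp hq hp0 hq0 hq1 m _)
    (fun z => tendsto_truncMean hp hq hp0 hq0 hq1 (fun x h h0 => nu_eq_zero ω ω' h0) _) fun N => ?_
  set rν : Obs n 𝒴 𝒳 × 𝒜 → ℝ :=
    fun z => min (ω'.nu (z.1.1 0) (z.1.2 0) / ω.nu (z.1.1 0) (z.1.2 0)) N with hrν
  have hrνm : Measurable rν := hnum.min measurable_const
  have hrν0 : ∀ z, 0 ≤ rν z := fun z => truncRatio_nonneg hp0 hq0 N (z.1.1 0, z.1.2 0) ()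
  have hrνN : ∀ z, rν z ≤ N := fun z => min_le_right _ _
  have hν : ∫ z, ϕ z * rν z ∂P = ∫ z, ϕ z * truncMean ((M.refY 0).prod (M.refX 0)) p q N () ∂P := by
    let b : ω.Direction := Direction.ofNu
      (fun x => 1 * (truncRatio p q N x () - truncMean ((M.refY 0).prod (M.refX 0)) p q N ()))
      ((((measurable_truncRatio hp hq N).comp (measurable_prodMk_right (y := ()))).sub
        measurable_const).const_mul 1)
      (B := N + 1)
      (fun x => by
        rw [one_mul]; exact abs_truncRatio_sub_truncMean_le hp hq hp0 hq0 hq1 N x ())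
      (integral_mul_truncRatio_sub_truncMean hp hq hp0 hq0 hp1 hq1 N () 1)
    have hb : ∀ z, b.toFun z = rν z - truncMean ((M.refY 0).prod (M.refX 0)) p q N () := by
      intro z
      simp only [b, Direction.toFun, Direction.ofNu, Finset.sum_const_zero, zero_add, one_mul]
      rfl
    have h := horth b
    simp only [hb, mul_sub] at h
    rw [integral_sub (hϕ.mul_bdd (c := N) hrνm.aestronglyMeasurable (.of_forall fun z => by
        rw [Real.norm_of_nonneg (hrν0 z)]; exact hrνN z)) (hϕ.mul_const _)] at h
    exact sub_eq_zero.1 h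
  rw [← hν]
  -- the heterogeneity
  have hF : Integrable (fun z => ϕ z * rν z) P :=
    hϕ.mul_bdd (c := N) hrνm.aestronglyMeasurable (.of_forall fun z => by
        rw [Real.norm_of_nonneg (hrν0 z)]; exact hrνN z)
  have hint' : Integrable (fun z => ϕ z * rν z *
      (ω'.pi z.2 (z.1.1 0) (z.1.2 0) / ω.pi z.2 (z.1.1 0) (z.1.2 0) * gRatioFrom ω ω' 0 z)) P := by
    refine hint.mono (hF.1.mul
      (hpim.mul (measurable_gRatioFrom ω ω' 0)).aestronglyMeasurable) (.of_forall fun z => ?_)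
    simp only [norm_mul, Real.norm_eq_abs]
    rw [abs_of_nonneg (hrν0 z), abs_of_nonneg
      (div_nonneg (ω'.nu_nonneg (z.1.1 0) (z.1.2 0)) (ω.nu_nonneg (z.1.1 0) (z.1.2 0))),
      mul_assoc]
    gcongr
    exact min_le_left _ _
  simp only [← mul_assoc (ϕ _)]
  exact integral_mul_piRatio ω' hϕ horth (fun h => truncRatio p q N h ())
    ((measurable_truncRatio hp hq N).comp (measurable_prodMk_right (y := ()))) (C := N)
    (fun h => by
      rw [abs_of_nonneg (truncRatio_nonneg hp0 hq0 N _ _)]; exact truncRatio_le N _ _) hint'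

omit hϕ horth in
-- The outcome factors do not involve the nuisance parameter. By common support a factor vanishing
-- at `ω` also vanishes at `ω'`, so the ratios lose nothing.
theorem fullDensity_eq_mul_ratio (θ : Vec K) (z : Obs n 𝒴 𝒳 × 𝒜) :
    M.fullDensity θ ω' z = M.fullDensity θ ω z *
      (ω'.nu (z.1.1 0) (z.1.2 0) / ω.nu (z.1.1 0) (z.1.2 0) *
      (ω'.pi z.2 (z.1.1 0) (z.1.2 0) / ω.pi z.2 (z.1.1 0) (z.1.2 0) * gRatioFrom ω ω' 0 z)) := by
  have hmul : ∀ {r s : ℝ}, (r = 0 → s = 0) → r * (s / r) = s := by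
    intro r s h
    by_cases h0 : r = 0
    · rw [h0, zero_mul, h h0]
    · exact mul_div_cancel₀ _ h0
  have hν := hmul (nu_eq_zero ω ω' (y := z.1.1 0) (x := z.1.2 0))
  have hπ := hmul (pi_eq_zero ω ω' (a := z.2) (y := z.1.1 0) (x := z.1.2 0))
  have hg : (∏ j : Fin n, ω.g j (z.1.2 j.succ)
      (fun i : Fin (j + 2) => z.1.1 (Fin.castLE (by omega) i))
      (fun i : Fin (j + 1) => z.1.2 (Fin.castLE (by omega) i)) z.2) * gRatioFrom ω ω' 0 z =
      ∏ j : Fin n, ω'.g j (z.1.2 j.succ)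
      (fun i : Fin (j + 2) => z.1.1 (Fin.castLE (by omega) i))
      (fun i : Fin (j + 1) => z.1.2 (Fin.castLE (by omega) i)) z.2 := by
    simp only [gRatioFrom, zero_le, Finset.filter_true, ← Finset.prod_mul_distrib]
    exact Finset.prod_congr rfl fun j _ => hmul (g_eq_zero ω ω')
  unfold PanelModel.fullDensity
  rw [← hg, ← hν, ← hπ, hν, hπ]
  nth_rewrite 1 [← hν]
  nth_rewrite 1 [← hπ]
  ring

end Nuisance

/-- If a function of the observed data is orthogonal to all bounded directions at a working
nuisance parameter, then its mean does not depend on the nuisance parameter. -/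
theorem PanelModel.integral_obsLaw_eq_of_orthogonal (M : PanelModel n K 𝒴 𝒳 𝒜) {θ : Vec K}
    (hθ : θ ∈ M.Θ) {ω : Nuisance M} (ω' : Nuisance M) {g : Obs n 𝒴 𝒳 → ℝ}
    (hg : Integrable g (M.obsLaw θ ω)) (hg' : Integrable g (M.obsLaw θ ω'))
    (horth : ∀ b : ω.Direction, ∫ z, g z.1 * b.toFun z ∂(M.fullLaw θ ω) = 0) :
    ∫ d, g d ∂(M.obsLaw θ ω') = ∫ d, g d ∂(M.obsLaw θ ω) := by
  have h := Nuisance.integral_mul_ratio ω' (M.integrable_comp_fst ω hg) horth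
  rw [M.integrable_fullLaw_iff hθ, M.integral_fullLaw hθ] at h
  have he : (fun z : Obs n 𝒴 𝒳 × 𝒜 => M.fullDensity θ ω z •
      (g z.1 * (ω'.nu (z.1.1 0) (z.1.2 0) / ω.nu (z.1.1 0) (z.1.2 0) *
      (ω'.pi z.2 (z.1.1 0) (z.1.2 0) / ω.pi z.2 (z.1.1 0) (z.1.2 0) *
        Nuisance.gRatioFrom ω ω' 0 z)))) = fun z => M.fullDensity θ ω' z • g z.1 := by
    funext z
    rw [Nuisance.fullDensity_eq_mul_ratio (ω := ω) ω']
    simp only [smul_eq_mul]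
    ring
  rw [he, M.integral_comp_fst ω hg, ← M.integral_fullLaw hθ, M.integral_comp_fst ω' hg'] at h
  -- Integrability of the reweighted function under `ω` is just integrability of `g` under `ω'`.
  exact h ((M.integrable_fullLaw_iff hθ ω').1 (M.integrable_comp_fst ω' hg'))

/-! ### Differentiability in quadratic mean along bounded directions -/

theorem eLpNorm_two_sq {X E : Type*} [MeasurableSpace X] [NormedAddCommGroup E] (μ : Measure X)
    (f : X → E) : eLpNorm f 2 μ ^ 2 = ∫⁻ x, ‖f x‖ₑ ^ 2 ∂μ := by
  have h := eLpNorm_nnreal_pow_eq_lintegral (μ := μ) (f := f) (p := 2) two_ne_zero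
  simpa using h

/-- With `W = L / l`, the error `√W - 1 - (W - 1) / 2 = -(√W - 1)² / 2` is at most `(W - 1)²` in
absolute value, because `|√W - 1| ≤ |W - 1|`. If `l = 0`, the hypothesis forces `L = 0`. -/
theorem abs_sqrt_sub_le {L l β η B C : ℝ} (hl : 0 ≤ l) (hL : 0 ≤ L) (hβ : |β| ≤ B) (hC : 0 ≤ C)
    (hη : |η| ≤ 1) (h : |L - l - η * (l * β)| ≤ C * η ^ 2 * l) :
    |√L - √l - 1 / 2 * (η * β) * √l| ≤ (C + (B + C) ^ 2) * η ^ 2 * √l := by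
  rcases hl.eq_or_lt with rfl | hl
  · have hL0 : L = 0 := by simpa using h
    simp [hL0]
  obtain ⟨W, rfl⟩ : ∃ W, L = l * W := ⟨L / l, by field_simp⟩
  have hW : 0 ≤ W := nonneg_of_mul_nonneg_right hL hl
  have h1 : |W - 1 - η * β| ≤ C * η ^ 2 := by
    have e : l * W - l - η * (l * β) = l * (W - 1 - η * β) := by ring
    rw [e, abs_mul, abs_of_pos hl, mul_comm] at h
    exact le_of_mul_le_mul_right h hl
  have hB : 0 ≤ B := (abs_nonneg β).trans hβ
  have h2 : |W - 1| ≤ (B + C) * |η| := by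
    have e : W - 1 = (W - 1 - η * β) + η * β := by ring
    calc |W - 1| ≤ |W - 1 - η * β| + |η * β| := by
          conv_lhs => rw [e]
          exact abs_add_le _ _
      _ ≤ C * η ^ 2 + |η| * B := by
          rw [abs_mul]; gcongr
      _ ≤ C * |η| + |η| * B := by
          gcongr
          rw [← sq_abs]
          nlinarith [abs_nonneg η]
      _ = _ := by ring
  have h3 : |√W - 1 - 1 / 2 * (W - 1)| ≤ (W - 1) ^ 2 := by
    have hs : √W * √W = W := Real.mul_self_sqrt hW
    have hs0 := Real.sqrt_nonneg W
    have e : √W - 1 - 1 / 2 * (W - 1) = -(1 / 2 * (√W - 1) ^ 2) := by nlinarith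
    have e2 : (W - 1) ^ 2 = (√W - 1) ^ 2 * (√W + 1) ^ 2 := by
      nth_rewrite 1 [← hs]; ring
    rw [e, abs_neg, abs_of_nonneg (by positivity), e2]
    nlinarith [sq_nonneg (√W - 1), mul_nonneg (sq_nonneg (√W - 1)) hs0,
      mul_nonneg (sq_nonneg (√W - 1)) (mul_nonneg hs0 hs0)]
  have h4 : (W - 1) ^ 2 ≤ (B + C) ^ 2 * η ^ 2 := by
    rw [← sq_abs (W - 1), ← sq_abs η, ← mul_pow]
    gcongr
  rw [Real.sqrt_mul hl.le]
  have e : √l * √W - √l - 1 / 2 * (η * β) * √l =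
      ((√W - 1 - 1 / 2 * (W - 1)) + 1 / 2 * (W - 1 - η * β)) * √l := by ring
  rw [e, abs_mul, abs_of_nonneg (Real.sqrt_nonneg l)]
  gcongr
  calc _ ≤ |√W - 1 - 1 / 2 * (W - 1)| + |1 / 2 * (W - 1 - η * β)| := abs_add_le _ _
    _ ≤ (W - 1) ^ 2 + 1 / 2 * (C * η ^ 2) := by
        rw [abs_mul, abs_of_pos (by norm_num : (0 : ℝ) < 1 / 2)]; gcongr
    _ ≤ (B + C) ^ 2 * η ^ 2 + C * η ^ 2 := by
        have : 0 ≤ C * η ^ 2 := by positivity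
        linarith
    _ = _ := by ring

/-- Split as `β (√l - √l₀) + (β - β₀) √l₀`. The first term uses `(√l - √l₀)² ≤ |l - l₀|`. In the
second, `β` need not be near `β₀`, but `|β - β₀| l₀ ≤ 2 B J`. The constant is `10 = 2 (1 + 4)`. -/
theorem sq_mul_sqrt_sub_le {l l₀ β β₀ B J : ℝ} (hl : 0 ≤ l) (hl₀ : 0 ≤ l₀) (hβ : |β| ≤ B)
    (hβ₀ : |β₀| ≤ B) (h : |l - l₀| ≤ J) (hm : |l * β - l₀ * β₀| ≤ B * J) :
    (β * √l - β₀ * √l₀) ^ 2 ≤ 10 * B ^ 2 * J := by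
  have hB : 0 ≤ B := (abs_nonneg β).trans hβ
  have hJ : 0 ≤ J := (abs_nonneg _).trans h
  have h1 : (√l - √l₀) ^ 2 ≤ J := by
    refine le_trans ?_ h
    have e : l - l₀ = (√l - √l₀) * (√l + √l₀) := by
      nlinarith [Real.mul_self_sqrt hl, Real.mul_self_sqrt hl₀]
    rw [e, abs_mul, abs_of_nonneg (add_nonneg (Real.sqrt_nonneg l) (Real.sqrt_nonneg l₀)),
      ← sq_abs, sq]
    gcongr
    rw [abs_le]
    constructor <;> linarith [Real.sqrt_nonneg l, Real.sqrt_nonneg l₀]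
  have h2 : |β - β₀| * l₀ ≤ 2 * B * J := by
    have e : (β - β₀) * l₀ = (l * β - l₀ * β₀) - β * (l - l₀) := by ring
    rw [← abs_of_nonneg hl₀, ← abs_mul, e]
    calc _ ≤ |l * β - l₀ * β₀| + |β * (l - l₀)| := abs_sub _ _
      _ ≤ B * J + B * J := by rw [abs_mul]; gcongr
      _ = _ := by ring
  have h3 : |β - β₀| ≤ 2 * B := (abs_sub _ _).trans (by linarith)
  have h4 : (β - β₀) ^ 2 * l₀ ≤ 4 * B ^ 2 * J := by
    rw [← sq_abs, sq, mul_assoc]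
    calc _ ≤ 2 * B * (2 * B * J) := by gcongr
      _ = _ := by ring
  have h5 : β ^ 2 ≤ B ^ 2 := by rw [← sq_abs]; gcongr
  have h6 : β ^ 2 * (√l - √l₀) ^ 2 ≤ B ^ 2 * J := by gcongr
  have e : β * √l - β₀ * √l₀ = β * (√l - √l₀) + (β - β₀) * √l₀ := by ring
  have h7 : ((β - β₀) * √l₀) ^ 2 = (β - β₀) ^ 2 * l₀ := by
    rw [mul_pow, Real.sq_sqrt hl₀]
  rw [e]
  calc _ ≤ 2 * ((β * (√l - √l₀)) ^ 2 + ((β - β₀) * √l₀) ^ 2) := add_sq_le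
    _ ≤ 2 * (B ^ 2 * J + 4 * B ^ 2 * J) := by rw [h7, mul_pow]; gcongr
    _ = _ := by ring

namespace PanelModel

variable (M : PanelModel n K 𝒴 𝒳 𝒜) {θ₀ : Vec K} {ω : Nuisance M}

theorem integral_fullDensity {θ : Vec K} (hθ : θ ∈ M.Θ) (ω : Nuisance M) :
    ∫ z, M.fullDensity θ ω z ∂M.fullRef = 1 :=
  integral_eq_one_of_lintegral_ofReal_eq_one (M.measurable_fullDensity hθ ω)
    (M.fullDensity_nonneg hθ ω) (M.lintegral_fullDensity hθ ω)

/-- Pointwise continuity of the joint density in the parameter implies continuity in mean. -/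
theorem tendsto_integral_abs_fullDensity_sub (hθ₀ : θ₀ ∈ interior M.Θ)
    (hcont : ∀ᵐ z ∂M.fullRef, ContinuousAt (fun θ => M.fullDensity θ ω z) θ₀) :
    Tendsto (fun θ => ∫ z, |M.fullDensity θ ω z - M.fullDensity θ₀ ω z| ∂M.fullRef) (𝓝 θ₀)
      (𝓝 0) := by
  have hmem : ∀ᶠ θ in 𝓝 θ₀, θ ∈ M.Θ := mem_interior_iff_mem_nhds.1 hθ₀
  have h0 := interior_subset hθ₀
  -- Scheffé's argument: the positive part of the density at `θ₀` minus that at `θ` is dominated by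
  -- the integrable density at `θ₀`, although the densities at `θ` have no common dominating
  -- function.
  have hpos : Tendsto
      (fun θ => ∫ z, max (M.fullDensity θ₀ ω z - M.fullDensity θ ω z) 0 ∂M.fullRef) (𝓝 θ₀)
      (𝓝 (∫ _z, (0 : ℝ) ∂M.fullRef)) := by
    refine tendsto_integral_filter_of_dominated_convergence (M.fullDensity θ₀ ω) ?_ ?_
      (M.integrable_fullDensity h0 ω) ?_
    · filter_upwards [hmem] with θ hθ
      exact (((M.measurable_fullDensity h0 ω).sub (M.measurable_fullDensity hθ ω)).max
        measurable_const).aestronglyMeasurable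
    · filter_upwards [hmem] with θ hθ
      refine .of_forall fun z => ?_
      rw [Real.norm_of_nonneg (le_max_right _ _)]
      exact max_le (by linarith [M.fullDensity_nonneg hθ ω z]) (M.fullDensity_nonneg h0 ω z)
    · filter_upwards [hcont] with z hz
      have h1 : Tendsto (fun θ => M.fullDensity θ₀ ω z - M.fullDensity θ ω z) (𝓝 θ₀) (𝓝 0) := by
        simpa using hz.tendsto.const_sub (M.fullDensity θ₀ ω z)
      simpa using h1.max (tendsto_const_nhds (x := (0 : ℝ)))
  rw [integral_zero] at hpos
  have h2 := hpos.const_mul 2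
  rw [mul_zero] at h2
  refine h2.congr' ?_
  filter_upwards [hmem] with θ hθ
  have hi := (M.integrable_fullDensity hθ ω)
  have hi0 := (M.integrable_fullDensity h0 ω)
  -- Both densities have mass one, so the signed difference integrates to zero and the `L¹` distance
  -- is twice the integral of the positive part.
  have e : ∀ z, |M.fullDensity θ ω z - M.fullDensity θ₀ ω z| =
      (M.fullDensity θ ω z - M.fullDensity θ₀ ω z) +
        2 * max (M.fullDensity θ₀ ω z - M.fullDensity θ ω z) 0 := by
    intro z
    rcases le_total (M.fullDensity θ ω z) (M.fullDensity θ₀ ω z) with h | h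
    · rw [abs_of_nonpos (by linarith), max_eq_left (by linarith)]; ring
    · rw [abs_of_nonneg (by linarith), max_eq_right (by linarith)]; ring
  have him : Integrable (fun z => max (M.fullDensity θ₀ ω z - M.fullDensity θ ω z) 0) M.fullRef :=
    (hi0.sub hi).pos_part
  simp_rw [e]
  have his : Integrable (fun z => M.fullDensity θ ω z - M.fullDensity θ₀ ω z) M.fullRef := hi.sub hi0
  rw [integral_add his (him.const_mul 2), integral_const_mul, integral_sub hi hi0,
    M.integral_fullDensity hθ, M.integral_fullDensity h0, sub_self, zero_add]

theorem eLpNorm_sqrt_lik {θ : Vec K} (hθ : θ ∈ M.Θ) (ω : Nuisance M) :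
    eLpNorm (fun d => √(M.lik θ ω d)) 2 M.obsRef = 1 := by
  have h : eLpNorm (fun d => √(M.lik θ ω d)) 2 M.obsRef ^ 2 = 1 := by
    rw [eLpNorm_two_sq]
    have e : ∀ d, ‖√(M.lik θ ω d)‖ₑ ^ 2 = ENNReal.ofReal (M.lik θ ω d) := by
      intro d
      rw [Real.enorm_of_nonneg (Real.sqrt_nonneg _), ← ENNReal.ofReal_pow (Real.sqrt_nonneg _),
        Real.sq_sqrt (M.lik_nonneg hθ ω d)]
    simp_rw [e]
    rw [lintegral_congr_ae (M.ae_ofReal_lik hθ ω), ← M.lintegral_fullDensity hθ ω, fullRef,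
      lintegral_prod _ (M.measurable_fullDensity hθ ω).ennreal_ofReal.aemeasurable]
  exact (ENNReal.pow_right_strictMono two_ne_zero).injective (by simpa using h)

theorem ae_obsLaw_iff {θ : Vec K} (hθ : θ ∈ M.Θ) {p : Obs n 𝒴 𝒳 → Prop} :
    (∀ᵐ d ∂(M.obsLaw θ ω), p d) ↔ ∀ᵐ d ∂M.obsRef, 0 < M.lik θ ω d → p d := by
  rw [M.obsLaw_eq_withDensity hθ, ae_withDensity_iff (M.measurable_lik hθ ω).ennreal_ofReal]
  simp only [ne_eq, ENNReal.ofReal_eq_zero, not_le]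

/-- A version of `g` is determined only up to null sets of the data law; the factor `√lik` vanishes
where the reference measure sees more. -/
theorem aestronglyMeasurable_mul_sqrt_lik {θ : Vec K} (hθ : θ ∈ M.Θ) {g : Obs n 𝒴 𝒳 → ℝ}
    (hg : AEStronglyMeasurable g (M.obsLaw θ ω)) :
    AEStronglyMeasurable (fun d => g d * √(M.lik θ ω d)) M.obsRef := by
  obtain ⟨g', hg', h⟩ := hg
  refine ⟨fun d => g' d * √(M.lik θ ω d),
    hg'.mul (M.measurable_lik hθ ω).sqrt.stronglyMeasurable, ?_⟩
  filter_upwards [(M.ae_obsLaw_iff hθ).1 h] with d hd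
  rcases (M.lik_nonneg hθ ω d).eq_or_lt with h0 | h0
  · simp [← h0]
  · rw [hd h0]

/-- Apply `sq_mul_sqrt_sub_le` at each data point, with `J` the `L¹` distance of the density
sections in `a`, and integrate. Pointwise continuity of the conditional mean in `θ` is never needed.
-/
theorem tendsto_eLpNorm_condMean_mul_sqrt_lik (hθ₀ : θ₀ ∈ interior M.Θ)
    (hcont : ∀ᵐ z ∂M.fullRef, ContinuousAt (fun θ => M.fullDensity θ ω z) θ₀)
    {w : Obs n 𝒴 𝒳 × 𝒜 → ℝ} (hw : Measurable w) {B : ℝ} (hB : ∀ z, |w z| ≤ B) :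
    Tendsto (fun θ => eLpNorm (fun d => M.condMean θ ω w d * √(M.lik θ ω d) -
      M.condMean θ₀ ω w d * √(M.lik θ₀ ω d)) 2 M.obsRef) (𝓝 θ₀) (𝓝 0) := by
  have hmem : ∀ᶠ θ in 𝓝 θ₀, θ ∈ M.Θ := mem_interior_iff_mem_nhds.1 hθ₀
  have h0 := interior_subset hθ₀
  have hlim : Tendsto (fun θ => ENNReal.ofReal (10 * B ^ 2 *
      ∫ z, |M.fullDensity θ ω z - M.fullDensity θ₀ ω z| ∂M.fullRef) ^ (1 / 2 : ℝ)) (𝓝 θ₀)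
      (𝓝 0) := by
    have h1 := (M.tendsto_integral_abs_fullDensity_sub hθ₀ hcont).const_mul (10 * B ^ 2)
    rw [mul_zero] at h1
    have h2 := (ENNReal.continuous_rpow_const (y := 1 / 2)).tendsto (ENNReal.ofReal 0) |>.comp
      (ENNReal.tendsto_ofReal h1)
    simpa [Function.comp_def] using h2
  refine tendsto_of_tendsto_of_tendsto_of_le_of_le' tendsto_const_nhds hlim
    (.of_forall fun _ => zero_le) ?_
  filter_upwards [hmem] with θ hθ
  rw [← ENNReal.rpow_inv_le_iff (by norm_num)]
  norm_num
  rw [eLpNorm_two_sq]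
  have hi : Integrable (fun z => |M.fullDensity θ ω z - M.fullDensity θ₀ ω z|) M.fullRef :=
    ((M.integrable_fullDensity hθ ω).sub (M.integrable_fullDensity h0 ω)).abs
  have hi' : Integrable (fun d => ∫ a, |M.fullDensity θ ω (d, a) - M.fullDensity θ₀ ω (d, a)|
      ∂M.refA) M.obsRef := hi.integral_prod_left
  rw [fullRef, integral_prod _ hi, ← integral_const_mul,
    ofReal_integral_eq_lintegral_ofReal (hi'.const_mul _) (.of_forall fun d =>
      mul_nonneg (by positivity) (integral_nonneg fun a => abs_nonneg _))]
  refine lintegral_mono_ae ?_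
  filter_upwards [M.ae_integrable_fullDensity hθ ω, M.ae_integrable_fullDensity h0 ω,
    M.ae_abs_condMean_le hθ ω hB, M.ae_abs_condMean_le h0 ω hB,
    M.ae_lik_mul_condMean hθ ω hB, M.ae_lik_mul_condMean h0 ω hB] with d d1 d2 d3 d4 d5 d6
  rw [← enorm_pow, Real.enorm_of_nonneg (sq_nonneg _)]
  refine ENNReal.ofReal_le_ofReal (sq_mul_sqrt_sub_le (M.lik_nonneg hθ ω d) (M.lik_nonneg h0 ω d)
    d3 d4 ?_ ?_)
  · rw [lik, lik, ← integral_sub d1 d2]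
    exact abs_integral_le_integral_abs
  · have hwd : Measurable fun a => w (d, a) := hw.comp (by fun_prop)
    rw [d5, d6, ← integral_sub (d1.mul_bdd hwd.aestronglyMeasurable (.of_forall fun _ => hB _))
      (d2.mul_bdd hwd.aestronglyMeasurable (.of_forall fun _ => hB _)), ← integral_const_mul,
      ← Real.norm_eq_abs]
    refine norm_integral_le_of_norm_le ((d1.sub d2).abs.const_mul B) (.of_forall fun a => ?_)
    rw [← sub_mul, norm_mul, mul_comm]
    exact mul_le_mul_of_nonneg_right (hB _) (norm_nonneg _)

/-- Integrating out `a` turns `b` into its conditional mean, while a uniform remainder `D` becomes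
`D` times the likelihood. -/
theorem abs_lik_sub_le {θ : Vec K} (hθ : θ ∈ M.Θ) {ω' : Nuisance M}
    {b w : Obs n 𝒴 𝒳 × 𝒜 → ℝ} (hb : Measurable b) {B : ℝ} (hB : ∀ z, |b z| ≤ B)
    (hw : Measurable w) {η D : ℝ} (hD : ∀ z, |w z - 1 - η * b z| ≤ D)
    (hp : ∀ z, M.fullDensity θ ω' z = M.fullDensity θ ω z * w z) :
    ∀ᵐ d ∂M.obsRef, |M.lik θ ω' d - M.lik θ ω d - η * (M.lik θ ω d * M.condMean θ ω b d)| ≤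
      D * M.lik θ ω d := by
  filter_upwards [M.ae_integrable_fullDensity hθ ω, M.ae_lik_mul_condMean hθ ω hB] with d d1 d2
  have hbd : Measurable fun a => b (d, a) := hb.comp (by fun_prop)
  have hwd : Measurable fun a => w (d, a) - 1 - η * b (d, a) :=
    ((hw.comp (by fun_prop)).sub_const 1).sub (hbd.const_mul η)
  have i1 := d1.mul_bdd hbd.aestronglyMeasurable (.of_forall fun a => hB (d, a))
  have i2 := d1.mul_bdd hwd.aestronglyMeasurable (.of_forall fun a => hD (d, a))
  refine le_of_eq_of_le (congrArg _ ?_)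
    (M.abs_integral_fullDensity_mul_le hθ ω (w := fun z => w z - 1 - η * b z) hD d1)
  have e : M.lik θ ω' d = ∫ a, ((M.fullDensity θ ω (d, a) +
      η * (M.fullDensity θ ω (d, a) * b (d, a))) +
      M.fullDensity θ ω (d, a) * (w (d, a) - 1 - η * b (d, a))) ∂M.refA := by
    refine integral_congr_ae (.of_forall fun a => ?_)
    simp only [hp]
    ring
  have i3 : Integrable (fun a => M.fullDensity θ ω (d, a) +
      η * (M.fullDensity θ ω (d, a) * b (d, a))) M.refA := d1.add (i1.const_mul η)
  rw [e, integral_add i3 i2, integral_add d1 (i1.const_mul η), integral_const_mul, d2]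
  simp only [lik]
  ring

theorem eLpNorm_le_ofReal_mul {X : Type*} [MeasurableSpace X] {μ : Measure X} {f g : X → ℝ}
    {C : ℝ} (hg : eLpNorm g 2 μ = 1) (h : ∀ᵐ x ∂μ, |f x| ≤ C * |g x|) :
    eLpNorm f 2 μ ≤ ENNReal.ofReal C := by
  have h' : ∀ᵐ x ∂μ, ‖f x‖ ≤ C * ‖g x‖ := h
  refine (eLpNorm_le_mul_eLpNorm_of_ae_le_mul h' 2).trans ?_
  rw [hg, mul_one]

/-- A path in a bounded direction is differentiable in quadratic mean jointly with the parameter,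
and its score is the conditional mean of the direction given the observed data. -/
theorem exists_path_quadraticMean (hθ₀ : θ₀ ∈ interior M.Θ)
    (hcont : ∀ᵐ z ∂M.fullRef, ContinuousAt (fun θ => M.fullDensity θ ω z) θ₀)
    {path₁ : ℝ → Nuisance M} {η₁ : ℝ} {s₁ : Obs n 𝒴 𝒳 → ℝ}
    (reg : M.IsRegularSubmodel θ₀ ω path₁ η₁ s₁) (b : ω.Direction) :
    ∃ path : ℝ → Nuisance M, path 0 = ω ∧
      ∀ ε : ℝ, 0 < ε → ∀ᶠ q : Vec K × ℝ in 𝓝 (θ₀, 0),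
      eLpNorm (fun d => √(M.lik q.1 (path q.2) d) - √(M.lik θ₀ ω d)
        - (1 / 2) * (inner ℝ (q.1 - θ₀) (M.score θ₀ ω d) +
          (q.2 - 0) * M.condMean θ₀ ω b.toFun d) * √(M.lik θ₀ ω d))
      2 M.obsRef ≤ ENNReal.ofReal (ε * ‖q - (θ₀, 0)‖) := by
  have hmem : ∀ᶠ θ in 𝓝 θ₀, θ ∈ M.Θ := mem_interior_iff_mem_nhds.1 hθ₀
  have h0 := interior_subset hθ₀
  obtain ⟨path, w, C, δ, hδ, hpath, hw, hp, hwb⟩ := b.exists_path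
  obtain ⟨B, hB⟩ := b.exists_abs_toFun_le
  refine ⟨path, hpath, fun ε hε => ?_⟩
  -- The constant of `abs_sqrt_sub_le`, with `|C|` for `C` to have nonnegativity.
  set C' : ℝ := |C| + (B + |C|) ^ 2 with hC'
  have hC'0 : 0 ≤ C' := by positivity
  have E1 : ∀ᶠ q : Vec K × ℝ in 𝓝 (θ₀, 0), q.1 ∈ M.Θ := continuousAt_fst.eventually hmem
  have E2 : ∀ᶠ q : Vec K × ℝ in 𝓝 (θ₀, 0), |q.2| < min δ (min 1 (ε / 3 / (C' + 1))) := by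
    have h1 : Tendsto (fun q : Vec K × ℝ => |q.2|) (𝓝 (θ₀, 0)) (𝓝 |(0 : ℝ)|) :=
      (continuous_abs.comp continuous_snd).tendsto _
    rw [abs_zero] at h1
    exact h1.eventually (gt_mem_nhds (by positivity))
  -- Freezing the given submodel at `η₁` leaves differentiability in quadratic mean in `θ` alone, at
  -- fixed `ω`.
  have E3 : ∀ᶠ q : Vec K × ℝ in 𝓝 (θ₀, 0), eLpNorm (fun d => √(M.lik q.1 ω d) - √(M.lik θ₀ ω d)
        - (1 / 2) * (inner ℝ (q.1 - θ₀) (M.score θ₀ ω d)) * √(M.lik θ₀ ω d))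
      2 M.obsRef ≤ ENNReal.ofReal (ε / 3 * ‖q.1 - θ₀‖) := by
    have h1 : Tendsto (fun q : Vec K × ℝ => (q.1, η₁)) (𝓝 (θ₀, 0)) (𝓝 (θ₀, η₁)) :=
      (continuous_fst.prodMk continuous_const).tendsto _
    filter_upwards [h1.eventually (reg.quadraticMean (ε / 3) (by positivity))] with q hq
    simpa [reg.through] using hq
  have E4 : ∀ᶠ q : Vec K × ℝ in 𝓝 (θ₀, 0),
      eLpNorm (fun d => M.condMean q.1 ω b.toFun d * √(M.lik q.1 ω d) -
        M.condMean θ₀ ω b.toFun d * √(M.lik θ₀ ω d)) 2 M.obsRef ≤ ENNReal.ofReal (ε / 3) :=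
    ((M.tendsto_eLpNorm_condMean_mul_sqrt_lik hθ₀ hcont b.measurable_toFun hB).comp
      (continuous_fst.tendsto (θ₀, (0 : ℝ)))).eventually
        (ge_mem_nhds (ENNReal.ofReal_pos.2 (by positivity)))
  filter_upwards [E1, E2, E3, E4] with q hq1 hq2 hq3 hq4
  obtain ⟨θ, η⟩ := q
  simp only at hq1 hq2 hq3 hq4 ⊢
  have hηδ : |η| ≤ δ := (hq2.trans_le (min_le_left _ _)).le
  have hη1 : |η| ≤ 1 := (hq2.trans_le ((min_le_right _ _).trans (min_le_left _ _))).le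
  have hηε : C' * |η| ≤ ε / 3 := by
    have h1 : |η| * (C' + 1) ≤ ε / 3 := by
      rw [← le_div_iff₀ (by positivity)]
      exact (hq2.trans_le ((min_le_right _ _).trans (min_le_right _ _))).le
    nlinarith [abs_nonneg η]
  -- The error splits into moving `θ` at fixed `ω` (`T1`), moving `η` at the shifted `θ` (`T2`), and
  -- replacing the direction's score at `θ` by that at `θ₀` (`T3`). Each costs at most `ε / 3` times
  -- the increment.
  set T1 : Obs n 𝒴 𝒳 → ℝ := fun d => √(M.lik θ ω d) - √(M.lik θ₀ ω d)
        - (1 / 2) * (inner ℝ (θ - θ₀) (M.score θ₀ ω d)) * √(M.lik θ₀ ω d) with hT1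
  set T2 : Obs n 𝒴 𝒳 → ℝ := fun d => √(M.lik θ (path η) d) - √(M.lik θ ω d) -
    1 / 2 * (η * M.condMean θ ω b.toFun d) * √(M.lik θ ω d) with hT2
  set T3 : Obs n 𝒴 𝒳 → ℝ := fun d => (1 / 2 * η) *
    (M.condMean θ ω b.toFun d * √(M.lik θ ω d) -
        M.condMean θ₀ ω b.toFun d * √(M.lik θ₀ ω d)) with hT3
  have hm : ∀ {ϑ : Vec K}, ϑ ∈ M.Θ → ∀ ω', Measurable fun d => √(M.lik ϑ ω' d) :=
    fun h ω' => (M.measurable_lik h ω').sqrt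
  have hcm : ∀ {ϑ : Vec K}, ϑ ∈ M.Θ → Measurable (M.condMean ϑ ω b.toFun) :=
    fun h => M.measurable_condMean h ω b.measurable_toFun
  have m1 : AEStronglyMeasurable T1 M.obsRef := by
    refine (((hm hq1 ω).sub (hm h0 ω)).aestronglyMeasurable).sub ?_
    exact M.aestronglyMeasurable_mul_sqrt_lik h0
      ((AEStronglyMeasurable.inner aestronglyMeasurable_const reg.score_memLp.1).const_mul (1 / 2))
  have m2 : AEStronglyMeasurable T2 M.obsRef :=
    (((hm hq1 _).sub (hm hq1 ω)).sub
      ((((hcm hq1).const_mul η).const_mul (1 / 2)).mul (hm hq1 ω))).aestronglyMeasurable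
  have m3 : AEStronglyMeasurable T3 M.obsRef :=
    ((((hcm hq1).mul (hm hq1 ω)).sub ((hcm h0).mul (hm h0 ω))).const_mul _).aestronglyMeasurable
  have n2 : eLpNorm T2 2 M.obsRef ≤ ENNReal.ofReal (C' * η ^ 2) := by
    refine eLpNorm_le_ofReal_mul (M.eLpNorm_sqrt_lik hq1 ω) ?_
    have hD : ∀ z, |w η z - 1 - η * b.toFun z| ≤ |C| * η ^ 2 := fun z =>
      (hwb η z hηδ).trans (mul_le_mul_of_nonneg_right (le_abs_self C) (sq_nonneg η))
    filter_upwards [M.abs_lik_sub_le hq1 b.measurable_toFun hB (hw η) hD (fun z => hp θ η z),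
      M.ae_abs_condMean_le hq1 ω hB] with d d1 d2
    rw [abs_of_nonneg (Real.sqrt_nonneg _)]
    exact abs_sqrt_sub_le (M.lik_nonneg hq1 ω d) (M.lik_nonneg hq1 _ d) d2 (abs_nonneg C) hη1 d1
  have n3 : eLpNorm T3 2 M.obsRef ≤ ENNReal.ofReal (|η| * (ε / 3)) := by
    have h1 : eLpNorm T3 2 M.obsRef ≤ ‖1 / 2 * η‖ₑ * ENNReal.ofReal (ε / 3) := by
      refine (eLpNorm_const_smul (1 / 2 * η) (fun d => M.condMean θ ω b.toFun d * √(M.lik θ ω d) -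
        M.condMean θ₀ ω b.toFun d * √(M.lik θ₀ ω d)) 2 M.obsRef).le.trans ?_
      gcongr
    refine h1.trans ?_
    rw [← ofReal_norm, ← ENNReal.ofReal_mul (norm_nonneg _)]
    refine ENNReal.ofReal_le_ofReal ?_
    rw [norm_mul, Real.norm_eq_abs, Real.norm_eq_abs, abs_of_pos (by norm_num : (0 : ℝ) < 1 / 2)]
    nlinarith [abs_nonneg η, mul_nonneg (abs_nonneg η) hε.le]
  have hdec : (fun d => √(M.lik θ (path η) d) - √(M.lik θ₀ ω d)
        - (1 / 2) * (inner ℝ (θ - θ₀) (M.score θ₀ ω d) +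
          (η - 0) * M.condMean θ₀ ω b.toFun d) * √(M.lik θ₀ ω d)) = T1 + T2 + T3 := by
    funext d
    simp only [Pi.add_apply, hT1, hT2, hT3]
    ring
  have hn1 : ‖θ - θ₀‖ ≤ ‖((θ, η) : Vec K × ℝ) - (θ₀, 0)‖ := by
    simp
  have hn2 : |η| ≤ ‖((θ, η) : Vec K × ℝ) - (θ₀, 0)‖ := by
    simp
  rw [hdec]
  refine (eLpNorm_add_le (m1.add m2) m3 one_le_two).trans
    ((add_le_add (eLpNorm_add_le m1 m2 one_le_two) le_rfl).trans
    ((add_le_add (add_le_add hq3 n2) n3).trans ?_))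
  rw [← ENNReal.ofReal_add (by positivity) (by positivity),
    ← ENNReal.ofReal_add (by positivity) (by positivity)]
  refine ENNReal.ofReal_le_ofReal ?_
  have h1 : C' * η ^ 2 ≤ ε / 3 * |η| := by
    rw [← sq_abs, sq, ← mul_assoc]
    gcongr
  nlinarith

end PanelModel

/-! ### Scores of bounded directions are orthogonal to the complement of the tangent set -/

section SimpleFunc

variable {X : Type*} [MeasurableSpace X] {P : Measure X}

theorem integrable_simpleFunc_mul (ϕ : SimpleFunc X ℝ) {y : X → ℝ} (hy : Integrable y P) :
    Integrable (fun x => ϕ x * y x) P := by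
  obtain ⟨C, hC⟩ := ϕ.exists_forall_norm_le
  exact hy.bdd_mul (c := C) ϕ.aestronglyMeasurable (.of_forall hC)

/-- Integration against a fixed integrable function, as a functional on simple functions. -/
def simpleFuncPairing (y : X → ℝ) (hy : Integrable y P) : SimpleFunc X ℝ →ₗ[ℝ] ℝ where
  toFun ϕ := ∫ x, ϕ x * y x ∂P
  map_add' ϕ ψ := by
    simp only [SimpleFunc.coe_add, Pi.add_apply, add_mul]
    exact integral_add (integrable_simpleFunc_mul ϕ hy) (integrable_simpleFunc_mul ψ hy)
  map_smul' c ϕ := by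
    simp only [SimpleFunc.coe_smul, Pi.smul_apply, smul_eq_mul, mul_assoc, RingHom.id_apply]
    exact integral_const_mul c _

/-- A function which is orthogonal to all simple functions orthogonal to a finite family is a
linear combination of that family. -/
theorem exists_ae_eq_sum_of_orthogonal {ι : Type*} [Fintype ι] {v : ι → X → ℝ} {y : X → ℝ}
    (hv : ∀ i, Integrable (v i) P) (hy : Integrable y P)
    (h : ∀ ϕ : SimpleFunc X ℝ, (∀ i, ∫ x, ϕ x * v i x ∂P = 0) → ∫ x, ϕ x * y x ∂P = 0) :
    ∃ c : ι → ℝ, y =ᵐ[P] fun x => ∑ i, c i * v i x := by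
  have hmem : simpleFuncPairing y hy ∈
      Submodule.span ℝ (Set.range fun i => simpleFuncPairing (v i) (hv i)) := by
    -- Algebraic duality: a functional vanishing on the common kernel of finitely many functionals
    -- is a combination of them. No topology enters, so simple functions suffice as test functions.
    refine mem_span_of_iInf_ker_le_ker fun ϕ hϕ => ?_
    simp only [Submodule.mem_iInf, LinearMap.mem_ker] at hϕ ⊢
    exact h ϕ hϕ
  obtain ⟨c, hc⟩ := (Submodule.mem_span_range_iff_exists_fun ℝ).1 hmem
  refine ⟨c, ?_⟩
  have hs : Integrable (fun x => ∑ i, c i * v i x) P :=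
    integrable_finsetSum _ fun i _ => (hv i).const_mul (c i)
  -- Testing the identity of functionals on indicators gives equality of all set integrals.
  refine hy.ae_eq_of_forall_setIntegral_eq _ _ hs fun s hs' _ => ?_
  have hind : ∀ {u : X → ℝ}, ∫ x, (SimpleFunc.piecewise s hs' (SimpleFunc.const X (1 : ℝ))
      (SimpleFunc.const X 0)) x * u x ∂P = ∫ x in s, u x ∂P := by
    intro u
    rw [← integral_indicator hs']
    refine integral_congr_ae (.of_forall fun x => ?_)
    by_cases hx : x ∈ s <;> simp [hx]
  have h1 := LinearMap.congr_fun hc (SimpleFunc.piecewise s hs' (SimpleFunc.const X (1 : ℝ))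
      (SimpleFunc.const X 0))
  simp only [LinearMap.sum_apply, LinearMap.smul_apply, simpleFuncPairing, LinearMap.coe_mk,
    AddHom.coe_mk, smul_eq_mul] at h1
  rw [hind] at h1
  rw [← h1, integral_finsetSum _ fun i _ => ((hv i).const_mul (c i)).integrableOn]
  refine Finset.sum_congr rfl fun i _ => ?_
  rw [integral_const_mul, hind]

end SimpleFunc

/-- Differentiability of a curve of square-integrable functions in mean square. -/
theorem hasDerivAt_toLp {X : Type*} [MeasurableSpace X] {μ : Measure X} {f : ℝ → X → ℝ}
    {g : X → ℝ} {η₀ : ℝ} (hf : ∀ η, MemLp (f η) 2 μ) (hg : MemLp g 2 μ)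
    (h : ∀ ε : ℝ, 0 < ε → ∀ᶠ η in 𝓝 η₀,
      eLpNorm (fun x => f η x - f η₀ x - (η - η₀) * g x) 2 μ ≤ ENNReal.ofReal (ε * |η - η₀|)) :
    HasDerivAt (fun η => (hf η).toLp (f η)) (hg.toLp g) η₀ := by
  rw [hasDerivAt_iff_isLittleO, Asymptotics.isLittleO_iff]
  intro ε hε
  filter_upwards [h ε hε] with η hη
  have e : (hf η).toLp (f η) - (hf η₀).toLp (f η₀) - (η - η₀) • hg.toLp g =
      (((hf η).sub (hf η₀)).sub (hg.const_smul (η - η₀))).toLp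
        (f η - f η₀ - (η - η₀) • g) := rfl
  rw [e, Lp.norm_toLp]
  refine ENNReal.toReal_le_of_le_ofReal (by positivity) ?_
  exact hη

theorem inner_toLp {X : Type*} [MeasurableSpace X] {μ : Measure X} {f g : X → ℝ}
    (hf : MemLp f 2 μ) (hg : MemLp g 2 μ) :
    inner ℝ (hf.toLp f) (hg.toLp g) = ∫ x, f x * g x ∂μ := by
  rw [L2.inner_def]
  refine integral_congr_ae ?_
  filter_upwards [hf.coeFn_toLp, hg.coeFn_toLp] with x h1 h2
  rw [h1, h2, real_inner_eq_re_inner, RCLike.inner_apply]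
  simp [mul_comm]

namespace PanelModel

variable (M : PanelModel n K 𝒴 𝒳 𝒜) {θ₀ : Vec K} {ω : Nuisance M}

/-- Multiplication by `√lik` is an isometry from `L²` of the data law into `L²` of the reference
measure, where curves of root likelihoods can be differentiated. -/
theorem memLp_mul_sqrt_lik {θ : Vec K} (hθ : θ ∈ M.Θ) {g : Obs n 𝒴 𝒳 → ℝ}
    (hg : MemLp g 2 (M.obsLaw θ ω)) : MemLp (fun d => g d * √(M.lik θ ω d)) 2 M.obsRef := by
  refine ⟨M.aestronglyMeasurable_mul_sqrt_lik hθ hg.1, ?_⟩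
  have h : eLpNorm (fun d => g d * √(M.lik θ ω d)) 2 M.obsRef ^ 2 =
      eLpNorm g 2 (M.obsLaw θ ω) ^ 2 := by
    rw [eLpNorm_two_sq, eLpNorm_two_sq, M.obsLaw_eq_withDensity hθ,
      lintegral_withDensity_eq_lintegral_mul_non_measurable _
      (M.measurable_lik hθ ω).ennreal_ofReal (.of_forall fun _ => ENNReal.ofReal_lt_top)]
    refine lintegral_congr fun d => ?_
    rw [enorm_mul, mul_pow, mul_comm, Real.enorm_of_nonneg (Real.sqrt_nonneg _),
      ← ENNReal.ofReal_pow (Real.sqrt_nonneg _), Real.sq_sqrt (M.lik_nonneg hθ ω d), Pi.mul_apply]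
  have h2 : eLpNorm (fun d => g d * √(M.lik θ ω d)) 2 M.obsRef ^ 2 < ⊤ := by
    rw [h]; exact ENNReal.pow_lt_top hg.2
  exact (ENNReal.pow_lt_top_iff.1 h2).resolve_right two_ne_zero

/-- If the mean of a bounded function is constant along a regular submodel, then the function is
uncorrelated with the nuisance score. -/
theorem integral_mul_score_eq_zero (hθ₀ : θ₀ ∈ M.Θ) {path : ℝ → Nuisance M} {η₀ : ℝ}
    {s : Obs n 𝒴 𝒳 → ℝ} (reg : M.IsRegularSubmodel θ₀ ω path η₀ s) {ϕ : Obs n 𝒴 𝒳 → ℝ}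
    (hϕ : Measurable ϕ) {B : ℝ} (hB : ∀ d, ‖ϕ d‖ ≤ B)
    (hconst : ∀ ω', ∫ d, ϕ d ∂(M.obsLaw θ₀ ω') = ∫ d, ϕ d ∂(M.obsLaw θ₀ ω)) :
    ∫ d, ϕ d * s d ∂(M.obsLaw θ₀ ω) = 0 := by
  have hone : ∀ ω', MemLp (fun _ => (1 : ℝ)) 2 (M.obsLaw θ₀ ω') := fun ω' =>
    have := M.isProbabilityMeasure_obsLaw hθ₀ ω'
    memLp_const 1
  have hr : ∀ η, MemLp (fun d => √(M.lik θ₀ (path η) d)) 2 M.obsRef := fun η => by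
    simpa using M.memLp_mul_sqrt_lik hθ₀ (hone (path η))
  have hϕr : ∀ {u : Obs n 𝒴 𝒳 → ℝ}, MemLp u 2 M.obsRef → MemLp (fun d => ϕ d * u d) 2 M.obsRef :=
    fun hu => hu.of_le_mul (c := B) (hϕ.aestronglyMeasurable.mul hu.1) (.of_forall fun d => by
      rw [norm_mul]
      exact mul_le_mul_of_nonneg_right (hB d) (norm_nonneg _))
  have hu : MemLp (fun d => (1 / 2 * s d) * √(M.lik θ₀ ω d)) 2 M.obsRef :=
    M.memLp_mul_sqrt_lik hθ₀ (reg.memLp.const_mul (1 / 2))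
  have hquad : ∀ ε : ℝ, 0 < ε → ∀ᶠ η in 𝓝 η₀, eLpNorm (fun d => √(M.lik θ₀ (path η) d) -
      √(M.lik θ₀ (path η₀) d) - (η - η₀) * ((1 / 2 * s d) * √(M.lik θ₀ ω d))) 2 M.obsRef ≤
      ENNReal.ofReal (ε * |η - η₀|) := by
    intro ε hε
    have h1 : Tendsto (fun η : ℝ => (θ₀, η)) (𝓝 η₀) (𝓝 (θ₀, η₀)) :=
      (continuous_const.prodMk continuous_id).tendsto _
    filter_upwards [h1.eventually (reg.quadraticMean ε hε)] with η hη
    have h2 : ‖((θ₀, η) : Vec K × ℝ) - (θ₀, η₀)‖ = |η - η₀| := by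
      simp [Prod.norm_def]
    rw [h2] at hη
    refine le_of_eq_of_le (congrArg (fun f => eLpNorm f 2 M.obsRef) (funext fun d => ?_)) hη
    simp only [reg.through, sub_self, inner_zero_left, zero_add]
    ring
  have hF := hasDerivAt_toLp hr hu hquad
  have hG : HasDerivAt (fun η => (hϕr (hr η)).toLp _) ((hϕr hu).toLp _) η₀ := by
    refine hasDerivAt_toLp (fun η => hϕr (hr η)) (hϕr hu) fun ε hε => ?_
    filter_upwards [hquad (ε / (|B| + 1)) (by positivity)] with η hη
    refine (eLpNorm_le_mul_eLpNorm_of_ae_le_mul (c := |B| + 1) (g := fun d =>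
      √(M.lik θ₀ (path η) d) -
      √(M.lik θ₀ (path η₀) d) - (η - η₀) * ((1 / 2 * s d) * √(M.lik θ₀ ω d)))
      (.of_forall fun d => ?_) 2).trans ?_
    · have e : ϕ d * √(M.lik θ₀ (path η) d) - ϕ d * √(M.lik θ₀ (path η₀) d) -
          (η - η₀) * (ϕ d * ((1 / 2 * s d) * √(M.lik θ₀ ω d))) = ϕ d * (√(M.lik θ₀ (path η) d) -
          √(M.lik θ₀ (path η₀) d) - (η - η₀) * ((1 / 2 * s d) * √(M.lik θ₀ ω d))) := by ring
      rw [e, norm_mul]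
      exact mul_le_mul_of_nonneg_right (by linarith [hB d, le_abs_self B]) (norm_nonneg _)
    · refine (mul_le_mul_right hη _).trans ?_
      rw [← ENNReal.ofReal_mul (by positivity)]
      refine ENNReal.ofReal_le_ofReal (le_of_eq ?_)
      field_simp
  -- The inner product of `ϕ √lik` with `√lik` is the mean of `ϕ`, constant along the path. The
  -- product rule gives two equal terms, each half the mean of `ϕ s`.
  have hGF := hG.inner ℝ hF
  have hc : (fun η => inner ℝ ((hϕr (hr η)).toLp _) ((hr η).toLp _)) =
      fun _ => ∫ d, ϕ d ∂(M.obsLaw θ₀ ω) := by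
    funext η
    rw [inner_toLp, ← hconst (path η), M.integral_obsLaw hθ₀]
    refine integral_congr_ae (.of_forall fun d => ?_)
    simp only [smul_eq_mul]
    rw [mul_assoc, Real.mul_self_sqrt (M.lik_nonneg hθ₀ _ d), mul_comm]
  rw [hc] at hGF
  have h0 := hGF.unique (hasDerivAt_const η₀ _)
  rw [inner_toLp, inner_toLp] at h0
  have e1 : ∀ d, ϕ d * √(M.lik θ₀ (path η₀) d) * ((1 / 2 * s d) * √(M.lik θ₀ ω d)) =
      1 / 2 * (M.lik θ₀ ω d • (ϕ d * s d)) := by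
    intro d
    rw [reg.through, smul_eq_mul]
    nth_rewrite 3 [← Real.mul_self_sqrt (M.lik_nonneg hθ₀ ω d)]
    ring
  have e2 : ∀ d, ϕ d * ((1 / 2 * s d) * √(M.lik θ₀ ω d)) * √(M.lik θ₀ (path η₀) d) =
      1 / 2 * (M.lik θ₀ ω d • (ϕ d * s d)) := by
    intro d
    rw [← e1]; ring
  simp_rw [e1, e2] at h0
  rw [integral_const_mul, ← M.integral_obsLaw hθ₀ ω] at h0
  linarith

/-- The components of the score for the parameter, as elements of `L²`. -/
def scoreLp (hS : MemLp (M.score θ₀ ω) 2 (M.obsLaw θ₀ ω)) (i : Fin K) :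
    Lp ℝ 2 (M.obsLaw θ₀ ω) :=
  ((EuclideanSpace.proj (𝕜 := ℝ) i : Vec K →L[ℝ] ℝ).comp_memLp' hS).toLp _

/-- The information matrix is the Gram matrix of the joint score in `L²`, so it is nonsingular
exactly when these scores are linearly independent. -/
theorem infoMatrix_det_ne_zero_iff (hS : MemLp (M.score θ₀ ω) 2 (M.obsLaw θ₀ ω))
    {s : Obs n 𝒴 𝒳 → ℝ} (hs : MemLp s 2 (M.obsLaw θ₀ ω)) :
    (M.infoMatrix θ₀ ω s).det ≠ 0 ↔ LinearIndependent ℝ (M.scoreLp hS) ∧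
      hs.toLp s ∉ Submodule.span ℝ (Set.range (M.scoreLp hS)) := by
  have hgram : M.infoMatrix θ₀ ω s =
      Matrix.gram ℝ (Sum.elim (M.scoreLp hS) fun _ : Unit => hs.toLp s) := by
    ext i j
    rw [Matrix.gram_apply]
    rcases i with i | i <;> rcases j with j | j <;>
      simp only [Sum.elim_inl, Sum.elim_inr, scoreLp, inner_toLp] <;> rfl
  rw [hgram, Matrix.det_gram_ne_zero_iff_linearIndependent, linearIndependent_sum,
    Sum.elim_comp_inl, Sum.elim_comp_inr]
  refine and_congr_right fun _ => ?_
  rw [linearIndependent_unique_iff, Set.range_const]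
  constructor
  · rintro ⟨h1, h2⟩
    exact (Submodule.disjoint_span_singleton' h1).1 h2
  · intro h
    have h1 : hs.toLp s ≠ 0 := fun h0 => h (h0 ▸ Submodule.zero_mem _)
    exact ⟨h1, (Submodule.disjoint_span_singleton' h1).2 h⟩

theorem memLp_condMean (hθ₀ : θ₀ ∈ M.Θ) (b : ω.Direction) :
    MemLp (M.condMean θ₀ ω b.toFun) 2 (M.obsLaw θ₀ ω) := by
  have := M.isProbabilityMeasure_obsLaw hθ₀ ω
  obtain ⟨B, hB⟩ := b.exists_abs_toFun_le
  refine MemLp.of_bound (M.measurable_condMean hθ₀ ω b.measurable_toFun).aestronglyMeasurable B ?_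
  rw [M.ae_obsLaw_iff hθ₀]
  filter_upwards [M.ae_abs_condMean_le hθ₀ ω hB] with d hd _
  exact hd

theorem condMean_add (hθ₀ : θ₀ ∈ M.Θ) (b c : ω.Direction) :
    M.condMean θ₀ ω (b.add c).toFun =ᵐ[M.obsLaw θ₀ ω]
      M.condMean θ₀ ω b.toFun + M.condMean θ₀ ω c.toFun := by
  obtain ⟨B, hB⟩ := b.exists_abs_toFun_le
  obtain ⟨C, hC⟩ := c.exists_abs_toFun_le
  rw [EventuallyEq, M.ae_obsLaw_iff hθ₀]
  filter_upwards [M.ae_integrable_fullDensity hθ₀ ω] with d hd _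
  have hb : Measurable fun a => b.toFun (d, a) := b.measurable_toFun.comp (by fun_prop)
  have hc : Measurable fun a => c.toFun (d, a) := c.measurable_toFun.comp (by fun_prop)
  simp only [condMean, Pi.add_apply, Nuisance.Direction.add_toFun, mul_add]
  rw [integral_add (hd.mul_bdd hb.aestronglyMeasurable (.of_forall fun _ => hB _))
    (hd.mul_bdd hc.aestronglyMeasurable (.of_forall fun _ => hC _)), add_div]

/-- If every direction had its score in the span of the `θ`-score, the score `s` of the given
submodel would be annihilated by all simple functions orthogonal to the `θ`-score. It would then lie
in the span itself, making the information singular. -/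
theorem exists_condMean_notMem_span (hθ₀ : θ₀ ∈ M.Θ) {path : ℝ → Nuisance M} {η₀ : ℝ}
    {s : Obs n 𝒴 𝒳 → ℝ} (reg : M.IsRegularSubmodel θ₀ ω path η₀ s) :
    ∃ b : ω.Direction, (M.memLp_condMean hθ₀ b).toLp _ ∉
      Submodule.span ℝ (Set.range (M.scoreLp reg.score_memLp)) := by
  have := M.isProbabilityMeasure_obsLaw hθ₀ ω
  by_contra! hcon
  refine ((M.infoMatrix_det_ne_zero_iff reg.score_memLp reg.memLp).1 reg.info_nonsingular).2 ?_
  have hSi : ∀ i, MemLp (fun d => M.score θ₀ ω d i) 2 (M.obsLaw θ₀ ω) := fun i =>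
    (EuclideanSpace.proj (𝕜 := ℝ) i : Vec K →L[ℝ] ℝ).comp_memLp' reg.score_memLp
  obtain ⟨c, hc⟩ := exists_ae_eq_sum_of_orthogonal (P := M.obsLaw θ₀ ω)
    (v := fun i d => M.score θ₀ ω d i) (y := s)
    (fun i => (hSi i).integrable one_le_two) (reg.memLp.integrable one_le_two) (by
      intro ϕ hϕ
      obtain ⟨C, hC⟩ := ϕ.exists_forall_norm_le
      have hϕ2 : MemLp ϕ 2 (M.obsLaw θ₀ ω) := MemLp.of_bound ϕ.aestronglyMeasurable C (.of_forall hC)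
      have hint : ∀ ω', Integrable ϕ (M.obsLaw θ₀ ω') := fun ω' =>
        have := M.isProbabilityMeasure_obsLaw hθ₀ ω'
        Integrable.of_bound ϕ.aestronglyMeasurable C (.of_forall hC)
      -- A simple function is bounded, hence integrable at every nuisance value, so orthogonality to
      -- all directions makes its mean constant.
      refine M.integral_mul_score_eq_zero hθ₀ reg ϕ.measurable hC fun ω' =>
        M.integral_obsLaw_eq_of_orthogonal hθ₀ ω' (hint ω) (hint ω') fun b => ?_
      obtain ⟨B, hB⟩ := b.exists_abs_toFun_le
      rw [← M.integral_mul_condMean hθ₀ ω b.measurable_toFun hB (hint ω),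
        ← inner_toLp hϕ2 (M.memLp_condMean hθ₀ b)]
      have hle : Submodule.span ℝ (Set.range (M.scoreLp reg.score_memLp)) ≤
          LinearMap.ker (innerₛₗ ℝ (hϕ2.toLp ϕ)) := by
        rw [Submodule.span_le]
        rintro _ ⟨i, rfl⟩
        simp only [SetLike.mem_coe, LinearMap.mem_ker, innerₛₗ_apply_apply]
        rw [scoreLp, inner_toLp]
        exact hϕ i
      exact hle (hcon b))
  rw [Submodule.mem_span_range_iff_exists_fun]
  refine ⟨c, Lp.ext ?_⟩
  have h1 : ∀ᵐ d ∂(M.obsLaw θ₀ ω), ∀ i, M.scoreLp reg.score_memLp i d = M.score θ₀ ω d i :=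
    ae_all_iff.2 fun i => MemLp.coeFn_toLp _
  have h2 : ⇑(∑ i, c i • M.scoreLp reg.score_memLp i) =ᵐ[M.obsLaw θ₀ ω]
      fun d => ∑ i, c i * M.scoreLp reg.score_memLp i d := by
    refine (Lp.coeFn_fun_finsetSum _ _).trans ?_
    have h3 : ∀ᵐ d ∂(M.obsLaw θ₀ ω), ∀ i, (c i • M.scoreLp reg.score_memLp i) d =
        c i * M.scoreLp reg.score_memLp i d := ae_all_iff.2 fun i => Lp.coeFn_smul _ _
    filter_upwards [h3] with d hd
    simp [hd]
  filter_upwards [h1, h2, hc, reg.memLp.coeFn_toLp] with d d1 d2 d3 d4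
  rw [d2, d4, d3]
  simp only [d1]

/-- Singular information is the only obstruction to regularity, and `hb` excludes it; independence
of the `θ`-scores is inherited from the given submodel. -/
theorem isNuisanceScore_condMean (hθ₀ : θ₀ ∈ interior M.Θ)
    (hcont : ∀ᵐ z ∂M.fullRef, ContinuousAt (fun θ => M.fullDensity θ ω z) θ₀)
    {path : ℝ → Nuisance M} {η₀ : ℝ}
    {s : Obs n 𝒴 𝒳 → ℝ} (reg : M.IsRegularSubmodel θ₀ ω path η₀ s) (b : ω.Direction)
    (hb : (M.memLp_condMean (interior_subset hθ₀) b).toLp _ ∉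
      Submodule.span ℝ (Set.range (M.scoreLp reg.score_memLp))) :
    M.IsNuisanceScore θ₀ ω (M.condMean θ₀ ω b.toFun) := by
  obtain ⟨path', h0, hq⟩ := M.exists_path_quadraticMean hθ₀ hcont reg b
  exact ⟨path', 0, {
    through := h0
    differentiable := reg.differentiable
    score_memLp := reg.score_memLp
    memLp := M.memLp_condMean (interior_subset hθ₀) b
    quadraticMean := hq
    info_nonsingular := (M.infoMatrix_det_ne_zero_iff reg.score_memLp _).2
      ⟨((M.infoMatrix_det_ne_zero_iff reg.score_memLp reg.memLp).1 reg.info_nonsingular).1, hb⟩ }⟩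

/-- A square-integrable function which is orthogonal to the scores of all regular parametric
submodels is orthogonal to all bounded directions. -/
theorem integral_mul_direction_eq_zero (hθ₀ : θ₀ ∈ interior M.Θ)
    (hcont : ∀ᵐ z ∂M.fullRef, ContinuousAt (fun θ => M.fullDensity θ ω z) θ₀)
    (hreg : ∃ s, M.IsNuisanceScore θ₀ ω s) {g : Obs n 𝒴 𝒳 → ℝ}
    (hg : MemLp g 2 (M.obsLaw θ₀ ω))
    (horth : ∀ s, M.IsNuisanceScore θ₀ ω s → ∫ d, g d * s d ∂(M.obsLaw θ₀ ω) = 0)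
    (b : ω.Direction) : ∫ z, g z.1 * b.toFun z ∂(M.fullLaw θ₀ ω) = 0 := by
  have h0 := interior_subset hθ₀
  have := M.isProbabilityMeasure_obsLaw h0 ω
  obtain ⟨s, path, η₀, reg⟩ := hreg
  obtain ⟨B, hB⟩ := b.exists_abs_toFun_le
  rw [← M.integral_mul_condMean h0 ω b.measurable_toFun hB (hg.integrable one_le_two)]
  by_cases hb : (M.memLp_condMean h0 b).toLp _ ∈
      Submodule.span ℝ (Set.range (M.scoreLp reg.score_memLp))
  -- Here the path of `b` itself is not regular. For `c` outside the span, `b + c` is outside as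
  -- well; both have genuine nuisance scores, and subtracting their orthogonality relations leaves
  -- that of `b`.
  · obtain ⟨c, hc⟩ := M.exists_condMean_notMem_span h0 reg
    have hadd : (M.memLp_condMean h0 (b.add c)).toLp _ =
        (M.memLp_condMean h0 b).toLp _ + (M.memLp_condMean h0 c).toLp _ := by
      rw [← MemLp.toLp_add]
      exact MemLp.toLp_congr _ _ (M.condMean_add h0 b c)
    have hbc : (M.memLp_condMean h0 (b.add c)).toLp _ ∉
        Submodule.span ℝ (Set.range (M.scoreLp reg.score_memLp)) := by
      rw [hadd, Submodule.add_mem_iff_right _ hb]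
      exact hc
    have h1 := horth _ (M.isNuisanceScore_condMean hθ₀ hcont reg c hc)
    have h2 := horth _ (M.isNuisanceScore_condMean hθ₀ hcont reg (b.add c) hbc)
    rw [← inner_toLp hg (M.memLp_condMean h0 _)] at h1 h2 ⊢
    rw [hadd, inner_add_right, h1, add_zero] at h2
    exact h2
  · exact horth _ (M.isNuisanceScore_condMean hθ₀ hcont reg b hb)

end PanelModel

/-! ### Best approximation by the orthocomplement of the tangent set -/

section BestApproximation

variable {E : Type*} [NormedAddCommGroup E] [InnerProductSpace ℝ E] (W : Submodule ℝ E)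
  [W.HasOrthogonalProjection]

theorem norm_sub_sq_eq_add_starProjection (x : E) {q : E} (hq : q ∈ W) :
    ‖x - q‖ ^ 2 = ‖x - W.starProjection x‖ ^ 2 + ‖W.starProjection x - q‖ ^ 2 := by
  have h : inner ℝ (x - W.starProjection x) (W.starProjection x - q) = 0 :=
    W.starProjection_inner_eq_zero x _ (W.sub_mem (W.starProjection_apply_mem x) hq)
  have e : x - q = (x - W.starProjection x) + (W.starProjection x - q) := by abel
  rw [e, norm_add_sq_real, h]
  ring

theorem forall_norm_sub_le_iff_eq_starProjection (x : E) {p : E} (hp : p ∈ W) :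
    (∀ q ∈ W, ‖x - p‖ ≤ ‖x - q‖) ↔ p = W.starProjection x := by
  constructor
  · intro h
    have h1 := h _ (W.starProjection_apply_mem x)
    have h2 := norm_sub_sq_eq_add_starProjection W x hp
    have h3 : ‖W.starProjection x - p‖ ^ 2 ≤ 0 := by
      nlinarith [norm_nonneg (x - p), norm_nonneg (x - W.starProjection x)]
    have h4 : ‖W.starProjection x - p‖ = 0 := by
      nlinarith [norm_nonneg (W.starProjection x - p)]
    exact (sub_eq_zero.1 (norm_eq_zero.1 h4)).symm
  · rintro rfl q hq
    refine le_of_sq_le_sq ?_ (norm_nonneg _)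
    rw [norm_sub_sq_eq_add_starProjection W x hq]
    nlinarith [norm_nonneg (W.starProjection x - q)]

end BestApproximation

namespace PanelModel

variable (M : PanelModel n K 𝒴 𝒳 𝒜) {θ₀ : Vec K} {ω : Nuisance M} {L : ℕ}

/-- The orthocomplement of the tangent set as a subspace. -/
def tangentPerpSubmodule (θ₀ : Vec K) (ω : Nuisance M) [IsFiniteMeasure (M.obsLaw θ₀ ω)] (L : ℕ) :
    Submodule ℝ (Lp (Vec L) 2 (M.obsLaw θ₀ ω)) :=
  (M.tangentSet θ₀ ω L ⊔ Submodule.span ℝ (Set.range fun v : Vec L =>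
    indicatorConstLp 2 MeasurableSet.univ (measure_ne_top (M.obsLaw θ₀ ω) _) v))ᗮ

instance [IsFiniteMeasure (M.obsLaw θ₀ ω)] :
    (M.tangentPerpSubmodule θ₀ ω L).HasOrthogonalProjection := by
  have : CompleteSpace (M.tangentPerpSubmodule θ₀ ω L) :=
    Submodule.instOrthogonalCompleteSpace _
  exact .ofCompleteSpace _

/-- Mean zero is orthogonality to the constant vectors, so both defining conditions are
orthogonality to one subspace. -/
theorem mem_tangentPerpSubmodule [IsFiniteMeasure (M.obsLaw θ₀ ω)]
    {u : Lp (Vec L) 2 (M.obsLaw θ₀ ω)} :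
    u ∈ M.tangentPerpSubmodule θ₀ ω L ↔ u ∈ M.tangentPerp θ₀ ω L := by
  rw [tangentPerpSubmodule, ← Submodule.inf_orthogonal, Submodule.mem_inf, tangentPerp,
    Set.mem_ofPred_eq, and_comm]
  refine and_congr ?_ ?_
  · rw [Submodule.mem_orthogonal]
    constructor
    · intro h
      have h1 : ∀ v : Vec L, inner ℝ v (∫ d, u d ∂(M.obsLaw θ₀ ω)) = 0 := by
        intro v
        rw [← h _ (Submodule.subset_span ⟨v, rfl⟩),
          L2.inner_indicatorConstLp_eq_inner_setIntegral, Measure.restrict_univ]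
      exact inner_self_eq_zero.1 (h1 _)
    · intro h v hv
      have hle : Submodule.span ℝ (Set.range fun v : Vec L =>
          indicatorConstLp 2 MeasurableSet.univ (measure_ne_top (M.obsLaw θ₀ ω) _) v) ≤
          LinearMap.ker (innerₛₗ ℝ u) := by
        rw [Submodule.span_le]
        rintro _ ⟨v, rfl⟩
        simp only [SetLike.mem_coe, LinearMap.mem_ker, innerₛₗ_apply_apply]
        rw [real_inner_comm, L2.inner_indicatorConstLp_eq_inner_setIntegral, Measure.restrict_univ,
          h, inner_zero_right]
      have := hle hv
      rw [LinearMap.mem_ker, innerₛₗ_apply_apply] at this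
      rw [real_inner_comm, this]
  · rw [Submodule.mem_orthogonal']

theorem lintegral_enorm_sub_sq {X E : Type*} [MeasurableSpace X] [NormedAddCommGroup E]
    {P : Measure X} {S : X → E} (hS : MemLp S 2 P) (q : Lp E 2 P) :
    ∫⁻ d, ‖S d - q d‖ₑ ^ 2 ∂P = ‖hS.toLp S - q‖ₑ ^ 2 := by
  rw [Lp.enorm_def, eLpNorm_two_sq]
  refine lintegral_congr_ae ?_
  filter_upwards [hS.coeFn_toLp, Lp.coeFn_sub (hS.toLp S) q] with d h1 h2
  rw [h2, Pi.sub_apply, h1]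

/-- Pythagoras identifies the minimizer in a closed subspace with the projection. Existence and
almost sure uniqueness are both read off from this equivalence. -/
theorem isArgMin_iff [IsFiniteMeasure (M.obsLaw θ₀ ω)] {S p : Obs n 𝒴 𝒳 → Vec L}
    (hS : MemLp S 2 (M.obsLaw θ₀ ω)) : M.IsArgMin θ₀ ω S p ↔
      p =ᵐ[M.obsLaw θ₀ ω] (M.tangentPerpSubmodule θ₀ ω L).starProjection (hS.toLp S) := by
  set W := M.tangentPerpSubmodule θ₀ ω L with hW
  have hle : ∀ {p : Obs n 𝒴 𝒳 → Vec L} (hp : MemLp p 2 (M.obsLaw θ₀ ω)),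
      (∀ q ∈ M.tangentPerp θ₀ ω L,
        ∫⁻ d, ‖S d - p d‖ₑ ^ 2 ∂(M.obsLaw θ₀ ω) ≤ ∫⁻ d, ‖S d - q d‖ₑ ^ 2 ∂(M.obsLaw θ₀ ω)) ↔
      ∀ q ∈ W, ‖hS.toLp S - hp.toLp p‖ ≤ ‖hS.toLp S - q‖ := by
    intro p hp
    have e : ∫⁻ d, ‖S d - p d‖ₑ ^ 2 ∂(M.obsLaw θ₀ ω) = ‖hS.toLp S - hp.toLp p‖ₑ ^ 2 := by
      rw [← lintegral_enorm_sub_sq hS]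
      refine lintegral_congr_ae ?_
      filter_upwards [hp.coeFn_toLp] with d hd
      rw [hd]
    simp only [e, lintegral_enorm_sub_sq hS, ← M.mem_tangentPerpSubmodule]
    refine forall₂_congr fun q _ => ?_
    rw [(ENNReal.pow_right_strictMono two_ne_zero).le_iff_le, enorm_le_iff_norm_le]
  constructor
  · rintro ⟨⟨hp, hpW⟩, hmin⟩
    have h := (forall_norm_sub_le_iff_eq_starProjection W (hS.toLp S)
      (M.mem_tangentPerpSubmodule.2 hpW)).1 ((hle hp).1 hmin)
    rw [← h]
    exact hp.coeFn_toLp.symm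
  · intro h
    have hp : MemLp p 2 (M.obsLaw θ₀ ω) := (memLp_congr_ae h).2 (Lp.memLp _)
    have hpe : hp.toLp p = W.starProjection (hS.toLp S) := Lp.ext (hp.coeFn_toLp.trans h)
    have hpW : hp.toLp p ∈ W := hpe ▸ W.starProjection_apply_mem _
    exact ⟨⟨hp, M.mem_tangentPerpSubmodule.1 hpW⟩, (hle hp).2
      ((forall_norm_sub_le_iff_eq_starProjection W (hS.toLp S) hpW).2 hpe)⟩

/-- Sharing its right-hand side with `isArgMin_iff`, this identifies the working-model functions
with the efficient ones under correct specification. -/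
theorem isOrthProj_iff [IsFiniteMeasure (M.obsLaw θ₀ ω)] {S p : Obs n 𝒴 𝒳 → Vec L}
    (hS : MemLp S 2 (M.obsLaw θ₀ ω)) : M.IsOrthProj θ₀ ω S p ↔
      p =ᵐ[M.obsLaw θ₀ ω] (M.tangentPerpSubmodule θ₀ ω L).starProjection (hS.toLp S) := by
  set W := M.tangentPerpSubmodule θ₀ ω L with hW
  constructor
  · rintro ⟨_, hp, hpW, horth⟩
    have h : W.starProjection (hS.toLp S) = hp.toLp p :=
      Submodule.eq_starProjection_of_mem_of_inner_eq_zero (M.mem_tangentPerpSubmodule.2 hpW)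
        fun q hq => horth q (M.mem_tangentPerpSubmodule.1 hq)
    rw [h]
    exact hp.coeFn_toLp.symm
  · intro h
    have hp : MemLp p 2 (M.obsLaw θ₀ ω) := (memLp_congr_ae h).2 (Lp.memLp _)
    have hpe : hp.toLp p = W.starProjection (hS.toLp S) := Lp.ext (hp.coeFn_toLp.trans h)
    have hpW : hp.toLp p ∈ W := hpe ▸ W.starProjection_apply_mem _
    refine ⟨hS, hp, M.mem_tangentPerpSubmodule.1 hpW, fun q hq => ?_⟩
    rw [hpe]
    exact W.starProjection_inner_eq_zero _ _ (M.mem_tangentPerpSubmodule.2 hq)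

/-- Every element of the orthocomplement of the tangent set at a working model has mean zero at
every nuisance parameter under which it is integrable. -/
theorem integral_eq_zero_of_mem_tangentPerp (hθ₀ : θ₀ ∈ interior M.Θ)
    (hcont : ∀ᵐ z ∂M.fullRef, ContinuousAt (fun θ => M.fullDensity θ ω z) θ₀)
    (hreg : ∃ s, M.IsNuisanceScore θ₀ ω s) {p : Obs n 𝒴 𝒳 → Vec L}
    (hp : MemLp p 2 (M.obsLaw θ₀ ω)) (hpT : hp.toLp p ∈ M.tangentPerp θ₀ ω L) (ω' : Nuisance M)
    (hint : Integrable p (M.obsLaw θ₀ ω')) : ∫ d, p d ∂(M.obsLaw θ₀ ω') = 0 := by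
  have h0 := interior_subset hθ₀
  have := M.isProbabilityMeasure_obsLaw h0 ω
  have hp1 : Integrable p (M.obsLaw θ₀ ω) := hp.integrable one_le_two
  have hmean : ∫ d, p d ∂(M.obsLaw θ₀ ω) = 0 := by
    rw [← hpT.1]
    exact integral_congr_ae hp.coeFn_toLp.symm
  -- Pairing with a fixed `v` reduces to real-valued functions. Orthogonality of `p` to `s • v`,
  -- which lies in the tangent set, is orthogonality of the pairing to `s`.
  have key : ∀ v : Vec L, inner ℝ v (∫ d, p d ∂(M.obsLaw θ₀ ω')) = 0 := by
    intro v
    have hg : MemLp (fun d => inner ℝ v (p d)) 2 (M.obsLaw θ₀ ω) := hp.const_inner v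
    rw [← integral_inner hint, M.integral_obsLaw_eq_of_orthogonal h0 ω'
      (hg.integrable one_le_two) (hint.const_inner v)
      (M.integral_mul_direction_eq_zero hθ₀ hcont hreg hg ?_), integral_inner hp1, hmean,
      inner_zero_right]
    rintro s ⟨path, η₀, reg⟩
    have hsv : MemLp (fun d => s d • v) 2 (M.obsLaw θ₀ ω) := by
      simpa using! (ContinuousLinearMap.toSpanSingleton ℝ v).comp_memLp' reg.memLp
    have hmem : hsv.toLp _ ∈ M.tangentSet θ₀ ω L :=
      Submodule.le_topologicalClosure _
        (Submodule.subset_span ⟨s, v, ⟨path, η₀, reg⟩, hsv.coeFn_toLp⟩)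
    rw [← hpT.2 _ hmem, L2.inner_def]
    refine integral_congr_ae ?_
    filter_upwards [hp.coeFn_toLp, hsv.coeFn_toLp] with d h1 h2
    rw [h1, h2, inner_smul_right, real_inner_comm, mul_comm]
  exact inner_self_eq_zero.1 (key _)

end PanelModel

end

/-! ### The main theorem -/

theorem theorem4 {n K L : ℕ} {𝒴 𝒳 𝒜 : Type*}
    [MeasurableSpace 𝒴] [MeasurableSpace 𝒳] [MeasurableSpace 𝒜]
    (M : PanelModel n K 𝒴 𝒳 𝒜) (θ₀ : Vec K) (hθ₀ : θ₀ ∈ interior M.Θ)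
    -- the true nuisance parameter and the working model
    (ω₀ ω' : Nuisance M)
    -- smoothness and regularity of the likelihood at the working model
    (hcont : ∀ᵐ z ∂M.fullRef, ContinuousAt (fun θ => M.fullDensity θ ω' z) θ₀)
    (hreg : ∃ s, M.IsNuisanceScore θ₀ ω' s)
    -- the average effect and a moment function that identifies it
    (h : Vec K → Obs n 𝒴 𝒳 × 𝒜 → Vec L) (φ : Vec K → Obs n 𝒴 𝒳 → Vec L)
    (hh : Integrable (h θ₀) (M.fullLaw θ₀ ω₀))
    (hφ : Integrable (φ θ₀) (M.obsLaw θ₀ ω₀))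
    (hident : ∫ d, φ θ₀ d ∂(M.obsLaw θ₀ ω₀) = M.averageEffect h θ₀ ω₀)
    (hφ2 : MemLp (φ θ₀) 2 (M.obsLaw θ₀ ω')) :
    -- the working-model moment functions are well defined
    (∃ φs, M.IsLocEffScore θ₀ ω' φs ∧
      ∀ φs', M.IsLocEffScore θ₀ ω' φs' → φs' =ᵐ[M.obsLaw θ₀ ω'] φs) ∧
    (∃ ψ, M.IsLocEffAverage θ₀ ω' (φ θ₀) ψ ∧
      ∀ ψ', M.IsLocEffAverage θ₀ ω' (φ θ₀) ψ' → ψ' =ᵐ[M.obsLaw θ₀ ω'] ψ) ∧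
    -- the moment restrictions hold under the true data generating process
    (∀ φs, M.IsLocEffScore θ₀ ω' φs → Integrable φs (M.obsLaw θ₀ ω₀) →
      ∫ d, φs d ∂(M.obsLaw θ₀ ω₀) = 0) ∧
    (∀ ψ, M.IsLocEffAverage θ₀ ω' (φ θ₀) ψ → Integrable ψ (M.obsLaw θ₀ ω₀) →
      ∫ d, (ψ d - M.averageEffect h θ₀ ω₀) ∂(M.obsLaw θ₀ ω₀) = 0) ∧
    -- under correct specification they are the efficient moment restrictions
    (ω' = ω₀ →
      (∀ φs, M.IsLocEffScore θ₀ ω' φs → M.IsEfficientScore θ₀ ω₀ φs ∧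
        ∀ φe, M.IsEfficientScore θ₀ ω₀ φe → φs =ᵐ[M.obsLaw θ₀ ω₀] φe) ∧
      (∀ ψ, M.IsLocEffAverage θ₀ ω' (φ θ₀) ψ → M.IsEfficientAverage θ₀ ω₀ (φ θ₀) ψ ∧
        ∀ ψe, M.IsEfficientAverage θ₀ ω₀ (φ θ₀) ψe → ψ =ᵐ[M.obsLaw θ₀ ω₀] ψe)) := by
  have h0 := interior_subset hθ₀
  have hP' := M.isProbabilityMeasure_obsLaw h0 ω'
  have hP₀ := M.isProbabilityMeasure_obsLaw h0 ω₀
  have hS : MemLp (M.score θ₀ ω') 2 (M.obsLaw θ₀ ω') := by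
    obtain ⟨_, _, _, reg⟩ := hreg
    exact reg.score_memLp
  have hzero : ∀ {L : ℕ} {S p : Obs n 𝒴 𝒳 → Vec L}, M.IsArgMin θ₀ ω' S p →
      Integrable p (M.obsLaw θ₀ ω₀) → ∫ d, p d ∂(M.obsLaw θ₀ ω₀) = 0 := by
    rintro L S p ⟨⟨hp, hpT⟩, -⟩ hint
    exact M.integral_eq_zero_of_mem_tangentPerp hθ₀ hcont hreg hp hpT ω₀ hint
  refine ⟨⟨_, (M.isArgMin_iff hS).2 .rfl, fun φs' h' => (M.isArgMin_iff hS).1 h'⟩,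
    ⟨_, ⟨_, (M.isArgMin_iff hφ2).2 .rfl, rfl⟩, ?_⟩, fun φs hφs hint => hzero hφs hint, ?_, ?_⟩
  · rintro _ ⟨p, hp, rfl⟩
    exact EventuallyEq.rfl.sub ((M.isArgMin_iff hφ2).1 hp)
  · rintro _ ⟨p, hp, rfl⟩ hint
    -- The subtracted projection is integrable at the truth as the difference of `φ θ₀` and the
    -- residual, so it has mean zero there and the residual keeps the mean of `φ θ₀`.
    have hpi : Integrable p (M.obsLaw θ₀ ω₀) := by
      refine (hφ.sub hint).congr (.of_forall fun d => ?_)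
      simp
    rw [integral_sub hint (integrable_const _), integral_sub hφ hpi, hzero hp hpi, hident]
    simp
  · rintro rfl
    refine ⟨fun φs hφs => ?_, ?_⟩
    · have h1 := (M.isArgMin_iff hS).1 hφs
      exact ⟨(M.isOrthProj_iff hS).2 h1, fun φe he => h1.trans ((M.isOrthProj_iff hS).1 he).symm⟩
    · rintro _ ⟨p, hp, rfl⟩
      have h1 := (M.isArgMin_iff hφ2).1 hp
      refine ⟨⟨p, (M.isOrthProj_iff hφ2).2 h1, rfl⟩, ?_⟩
      rintro _ ⟨pe, hpe, rfl⟩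
      exact EventuallyEq.rfl.sub (h1.trans ((M.isOrthProj_iff hφ2).1 hpe).symm)
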